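/- \textbf{Setting.} Identify $\mathbb R^2=\mathbb C$. For a smooth immersion $c:[0,2\pi]\to\mathbb R^2$ put $D_s=|c'|^{-1}\partial_\theta$, $ds=|c'|\,d\theta$, $v=D_sc$, $n=iv$, $\kappa=\langle D_sv,n\rangle$. The space $\mathrm{Imm}([0,2\pi],\mathbb R^2)/\mathrm{Mot}$ of open curves modulo Euclidean motions is identified with the set of all smooth immersions $c:[0,2\pi]\to\mathbb R^2$ with $c(0)=0$ and $v(0)=1$; it carries the weak Riemannian metric $$G_c(h,k)=\int_0^{2\pi}\langle D_sh,v\rangle\langle D_sk,v\rangle+\langle D_s^2h,n\rangle\langle D_s^2k,n\rangle\,ds .$$ A geodesic from $c_0$ to $c_1$ is a smooth path $c(t,\theta)$, $t\in[0,1]$, in this space from $c_0$ to $c_1$ that is a critical point of the energy $\frac12\int_0^1G_c(c_t,c_t)\,dt$ under smooth variations with fixed end points; $\mathrm{dist}^G_{\mathrm{op}}(c_0,c_1)$ is the infimum of the lengths $\int_0^1\sqrt{G_c(c_t,c_t)}\,dt$ of smooth paths from $c_0$ to $c_1$. Let $$R(c)=(\sqrt{|c'|},\,\kappa|c'|^2),\qquad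 R^{-1}(q)(\theta)=\int_0^\theta q_1^2\exp\Big(i\int_0^\sigma q_2q_1^{-2}\,d\tau\Big)d\sigma .$$ On $\mathbb R_{>0}\times\mathbb R$ consider the Riemannian metric $g=4\,dx^2+x^{-6}\,dy^2$ with geodesic distance $\mathrm{dist}$ (geodesics are parametrized on $[0,1]$), and let $$F(u)=\int_0^u\frac{z^6\,dz}{\sqrt{1-z^6}}\quad(0\le u\le1),\qquad A=F(1)=0.30358\ldots$$ \textbf{Theorem.} (1) Any two points of $(\mathbb R_{>0}\times\mathbb R,g)$ are joined by a unique geodesic, and it has minimal length among smooth paths. If the points are $(x_0,y)$ and $(x_1,y)$, it is $t\mapsto(x_0+t(x_1-x_0),y)$. If they are $(x_0,y_0)$ and $(x_1,y_1)$ with $x_0\le x_1$ and $y_0\ne y_1$, put $\epsilon=\mathrm{sign}(y_1-y_0)$. (a) If $|y_1-y_0|\le 2x_1^4\big(A-F(x_0/x_1)\big)$, there is a unique $C\in(0,1/x_1]$ with $|y_1-y_0|=\frac2{C^4}\big(F(Cx_1)-F(Cx_0)\big)$, and the trajectory of the geodesic is the graph $y(x)=y_0+\epsilon\frac2{C^4}\big(F(Cx)-F(Cx_0)\big)$,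 $x_0\le x\le x_1$. (b) If $|y_1-y_0|>2x_1^4\big(A-F(x_0/x_1)\big)$, there is a unique $\bar x>x_1$ with $|y_1-y_0|=2\bar x^4\big(2A-F(x_0/\bar x)-F(x_1/\bar x)\big)$, and the trajectory is the union of the graphs $y=y_0+2\epsilon\bar x^4\big(F(x/\bar x)-F(x_0/\bar x)\big)$, $x_0\le x\le\bar x$, and $y=y_1-2\epsilon\bar x^4\big(F(x/\bar x)-F(x_1/\bar x)\big)$, $x_1\le x\le\bar x$. (2) For all $(x_0,y_0),(x_1,y_1)\in\mathbb R_{>0}\times\mathbb R$, $$\mathrm{dist}((x_0,y_0),(x_1,y_1))\ge2\sqrt{|x_0-x_1|^2+\frac{|y_0-y_1|^2}{2^{1/2}\big(x_0^4+x_1^4+\frac1{2A}|y_0-y_1|\big)^{3/2}}}\,.$$ (3) For any $c_0,c_1\in\mathrm{Imm}([0,2\pi],\mathbb R^2)/\mathrm{Mot}$ there is a unique geodesic connecting them. It is $c(t,\theta)=R^{-1}(q(t,\cdot))(\theta)$, where for each $\theta\in[0,2\pi]$ the curve $t\mapsto q(t,\theta)$ is the geodesic of $g$ from $R(c_0)(\theta)$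 to $R(c_1)(\theta)$. It has minimal length among smooth paths from $c_0$ to $c_1$, and if $c_0$ and $c_1$ have positive curvature, so has every $c(t,\cdot)$. (4) For such $c_0,c_1$, with curvatures $\kappa_0,\kappa_1$, $$\mathrm{dist}^G_{\mathrm{op}}(c_0,c_1)^2\ge\int_0^{2\pi}\frac{2^{3/2}\big(|c_1'|^2\kappa_1-|c_0'|^2\kappa_0\big)^2}{\Big(|c_0'|^2+|c_1'|^2+\frac1{2A}\big||c_1'|^2\kappa_1-|c_0'|^2\kappa_0\big|\Big)^{3/2}}+4\Big(\sqrt{|c_1'|}-\sqrt{|c_0'|}\Big)^2d\theta .$$ -/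

import Mathlib

open Set
open scoped ContDiff

namespace H2Curves

noncomputable section

/-! ### The half plane `ℝ_{>0} × ℝ` with `g = 4 dx² + x⁻⁶ dy²` -/

/-- The time interval `[0,1]`. -/
abbrev T : Set ℝ := Icc 0 1

/-- The half plane `ℝ_{>0} × ℝ`, as a subset of `ℝ²`. -/
def halfPlane : Set (Fin 2 → ℝ) := {p | 0 < p 0}

/-- The matrix of `g = 4 dx² + x⁻⁶ dy²` in the coordinates `(x, y) = (p 0, p 1)`. -/
def gMat (p : Fin 2 → ℝ) : Matrix (Fin 2) (Fin 2) ℝ :=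
  !![4, 0; 0, (p 0) ^ (-6 : ℤ)]

/-- `g_p(h, k)`. -/
def gInner (p h k : Fin 2 → ℝ) : ℝ := ∑ i, ∑ j, gMat p i j * h i * k j

/-- The partial derivative `∂_l g_{ij}` at `p`. -/
def gPartial (p : Fin 2 → ℝ) (l i j : Fin 2) : ℝ :=
  fderiv ℝ (fun r => gMat r i j) p (Pi.single l 1)

/-- The Christoffel symbols
`Γ^k_{ij} = ½ ∑_l g^{kl} (∂_i g_{jl} + ∂_j g_{il} - ∂_l g_{ij})` of `g`. -/
def christoffel (p : Fin 2 → ℝ) (k i j : Fin 2) : ℝ :=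
  (1 / 2) * ∑ l, (gMat p)⁻¹ k l * (gPartial p i j l + gPartial p j i l - gPartial p l i j)

/-- A smooth path `[0,1] → ℝ_{>0} × ℝ`. -/
structure IsPlanePath (γ : ℝ → Fin 2 → ℝ) : Prop where
  smooth : ContDiffOn ℝ ∞ γ T
  mem : ∀ t ∈ T, γ t ∈ halfPlane

/-- The velocity of a path on `[0,1]` (one-sided at the end points). -/
def velocity (γ : ℝ → Fin 2 → ℝ) (t : ℝ) : Fin 2 → ℝ := derivWithin γ T t

/-- A geodesic `[0,1] → (ℝ_{>0} × ℝ, g)`: a smooth path with `∇_{∂_t} γ̇ = 0`. -/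
structure IsPlaneGeodesic (γ : ℝ → Fin 2 → ℝ) : Prop extends IsPlanePath γ where
  geodesic_eq : ∀ t ∈ T, ∀ k : Fin 2,
    derivWithin (velocity γ) T t k
      + ∑ i, ∑ j, christoffel (γ t) k i j * velocity γ t i * velocity γ t j = 0

/-- The `g`-length of a path. -/
def planeLength (γ : ℝ → Fin 2 → ℝ) : ℝ :=
  ∫ t in (0 : ℝ)..1, √(gInner (γ t) (velocity γ t) (velocity γ t))

/-- The lengths of the smooth paths in the half plane from `p₀` to `p₁`. -/
def planeLengths (p₀ p₁ : Fin 2 → ℝ) : Set ℝ :=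
  {L | ∃ γ, IsPlanePath γ ∧ γ 0 = p₀ ∧ γ 1 = p₁ ∧ planeLength γ = L}

/-- The geodesic distance of `g`. -/
def planeDist (p₀ p₁ : Fin 2 → ℝ) : ℝ := sInf (planeLengths p₀ p₁)

/-- `F(u) = ∫₀ᵘ z⁶ / √(1 - z⁶) dz`, for `u ∈ [0,1]`. -/
def F (u : ℝ) : ℝ := ∫ z in (0 : ℝ)..u, z ^ 6 / √(1 - z ^ 6)

/-- `A = F(1)`. -/
def A : ℝ := F 1

/-! ### Open plane curves modulo Euclidean motions; `ℝ²` is identified with `ℂ` -/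

/-- The parameter interval `[0,2π]`. -/
abbrev M : Set ℝ := Icc 0 (2 * Real.pi)

/-- `c' = ∂_θ c` (one-sided at the end points). -/
def dθ (c : ℝ → ℂ) (θ : ℝ) : ℂ := derivWithin c M θ

/-- The arc length derivative `D_s h = h' / |c'|` along the curve `c`. -/
def Ds (c h : ℝ → ℂ) (θ : ℝ) : ℂ := ((‖dθ c θ‖⁻¹ : ℝ) : ℂ) * dθ h θ

/-- The unit tangent `v = D_s c`. -/
def tangent (c : ℝ → ℂ) : ℝ → ℂ := Ds c c

/-- The unit normal `n = J v`. -/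
def normal (c : ℝ → ℂ) (θ : ℝ) : ℂ := Complex.I * tangent c θ

/-- The curvature `κ = ⟨D_s v, n⟩`. -/
def curvature (c : ℝ → ℂ) (θ : ℝ) : ℝ := inner ℝ (Ds c (tangent c) θ) (normal c θ)

/-- `c` represents a point of `Imm([0,2π], ℝ²)/Mot`, identified with the set of all smooth
immersions `c : [0,2π] → ℝ²` with `c(0) = 0` and turning angle `0` at `θ = 0`.
Only the values of `c` on `[0,2π]` matter. -/
structure IsImmMot (c : ℝ → ℂ) : Prop where
  smooth : ContDiffOn ℝ ∞ c M
  immersion : ∀ θ ∈ M, dθ c θ ≠ 0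
  base : c 0 = 0
  angle : tangent c 0 = 1

/-- Positively oriented strictly convex curves: `κ > 0`. -/
def IsConvex (c : ℝ → ℂ) : Prop := ∀ θ ∈ M, 0 < curvature c θ

/-- The metric
`G_c(h,k) = ∫ ⟨D_s h, v⟩⟨D_s k, v⟩ + ⟨D_s² h, n⟩⟨D_s² k, n⟩ ds`, where `ds = |c'| dθ`. -/
def G (c h k : ℝ → ℂ) : ℝ :=
  ∫ θ in (0 : ℝ)..(2 * Real.pi),
    (inner ℝ (Ds c h θ) (tangent c θ) * inner ℝ (Ds c k θ) (tangent c θ)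
      + inner ℝ (Ds c (Ds c h) θ) (normal c θ) * inner ℝ (Ds c (Ds c k) θ) (normal c θ))
      * ‖dθ c θ‖

/-- A smooth path `[0,1] → Imm([0,2π], ℝ²)/Mot`, i.e. a jointly smooth map `c(t, θ)`. -/
structure IsPath (c : ℝ → ℝ → ℂ) : Prop where
  smooth : ContDiffOn ℝ ∞ (fun p : ℝ × ℝ => c p.1 p.2) (T ×ˢ M)
  mem : ∀ t ∈ T, IsImmMot (c t)

/-- The velocity `c_t(t, ·)` of a path of curves. -/
def pathVelocity (c : ℝ → ℝ → ℂ) (t θ : ℝ) : ℂ := derivWithin (fun s => c s θ) T t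

/-- The energy `½ ∫₀¹ G_c(c_t, c_t) dt`. -/
def energy (c : ℝ → ℝ → ℂ) : ℝ :=
  (1 / 2) * ∫ t in (0 : ℝ)..1, G (c t) (pathVelocity c t) (pathVelocity c t)

/-- The length `∫₀¹ √(G_c(c_t, c_t)) dt`. -/
def pathLength (c : ℝ → ℝ → ℂ) : ℝ :=
  ∫ t in (0 : ℝ)..1, √(G (c t) (pathVelocity c t) (pathVelocity c t))

/-- The path `c` runs from `c₀` to `c₁`. -/
def Connects (c : ℝ → ℝ → ℂ) (c₀ c₁ : ℝ → ℂ) : Prop :=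
  EqOn (c 0) c₀ M ∧ EqOn (c 1) c₁ M

/-- `C(σ, t, θ)`, `|σ| < ε`, is a smooth variation of the path `c` through paths in
`Imm([0,2π], ℝ²)/Mot` with the same end points as `c`. -/
structure IsVariation (c : ℝ → ℝ → ℂ) (ε : ℝ) (C : ℝ → ℝ → ℝ → ℂ) : Prop where
  smooth : ContDiffOn ℝ ∞ (fun p : ℝ × ℝ × ℝ => C p.1 p.2.1 p.2.2) (Ioo (-ε) ε ×ˢ T ×ˢ M)
  mem : ∀ σ ∈ Ioo (-ε) ε, ∀ t ∈ T, IsImmMot (C σ t)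
  center : ∀ t ∈ T, EqOn (C 0 t) (c t) M
  fixed : ∀ σ ∈ Ioo (-ε) ε, Connects (C σ) (c 0) (c 1)

/-- A geodesic `[0,1] → (Imm([0,2π], ℝ²)/Mot, G)`: a smooth path that is a critical point of the
energy among all smooth variations with fixed end points. -/
structure IsGeodesic (c : ℝ → ℝ → ℂ) : Prop extends IsPath c where
  critical : ∀ ε > 0, ∀ C, IsVariation c ε C → HasDerivAt (fun σ => energy (C σ)) 0 0

/-- The lengths of the smooth paths from `c₀` to `c₁` in `Imm([0,2π], ℝ²)/Mot`. -/
def pathLengths (c₀ c₁ : ℝ → ℂ) : Set ℝ :=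
  {L | ∃ c, IsPath c ∧ Connects c c₀ c₁ ∧ pathLength c = L}

/-- The geodesic distance of `G` on the space of open curves. -/
def distOp (c₀ c₁ : ℝ → ℂ) : ℝ := sInf (pathLengths c₀ c₁)

/-- The `R`-transform `R(c) = (√|c'|, κ |c'|²)`. -/
def R (c : ℝ → ℂ) (θ : ℝ) : Fin 2 → ℝ := ![√‖dθ c θ‖, curvature c θ * ‖dθ c θ‖ ^ 2]

/-- `R⁻¹(q)(θ) = ∫₀^θ q₁² exp(i ∫₀^σ q₂ q₁⁻² dτ) dσ`. -/
def Rinv (q : ℝ → Fin 2 → ℝ) (θ : ℝ) : ℂ :=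
  ∫ σ in (0 : ℝ)..θ,
    (((q σ 0) ^ 2 : ℝ) : ℂ) *
      Complex.exp (Complex.I * ((∫ τ in (0 : ℝ)..σ, q τ 1 / (q τ 0) ^ 2 : ℝ) : ℂ))

end

end H2Curves

open H2Curves

namespace H2Curves

open scoped Topology
open MeasureTheory

noncomputable section

/-! ### Volterra integration on `C([0,1], ℝ)` -/

/-- The extension of a function on `[0,1]` to the real line, constant outside `[0,1]`. -/
def iccExt (f : C(T, ℝ)) : ℝ → ℝ := IccExtend zero_le_one f

lemma continuous_iccExt (f : C(T, ℝ)) : Continuous (iccExt f) := f.continuous.Icc_extend'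

lemma iccExt_of_mem (f : C(T, ℝ)) {t : ℝ} (ht : t ∈ T) : iccExt f t = f ⟨t, ht⟩ :=
  IccExtend_of_mem _ _ ht

lemma abs_iccExt_le (f : C(T, ℝ)) (t : ℝ) : |iccExt f t| ≤ ‖f‖ := by
  simpa [iccExt, IccExtend] using f.norm_coe_le_norm (projIcc 0 1 zero_le_one t)

lemma hasDerivAt_integral_iccExt (f : C(T, ℝ)) (t : ℝ) :
    HasDerivAt (fun t => ∫ s in (0 : ℝ)..t, iccExt f s) (iccExt f t) t :=
  (continuous_iccExt f).integral_hasStrictDerivAt 0 t |>.hasDerivAt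

lemma abs_integral_iccExt_le (f : C(T, ℝ)) (a b : ℝ) : |∫ s in a..b, iccExt f s| ≤ ‖f‖ * |b - a| :=
  intervalIntegral.norm_integral_le_of_norm_le_const (f := iccExt f) fun t _ => abs_iccExt_le f t

/-- Integration from `0`, as a continuous linear operator on `C([0,1], ℝ)`. -/
def volterra : C(T, ℝ) →L[ℝ] C(T, ℝ) :=
  LinearMap.mkContinuous
    { toFun := fun f => ⟨fun t => ∫ s in (0 : ℝ)..t, iccExt f s,
        (continuous_iff_continuousAt.2 fun t =>
          (hasDerivAt_integral_iccExt f t).continuousAt).comp continuous_subtype_val⟩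
      map_add' := fun f g => by
        ext t
        exact intervalIntegral.integral_add ((continuous_iccExt f).intervalIntegrable _ _)
          ((continuous_iccExt g).intervalIntegrable _ _)
      map_smul' := fun c f => by
        ext t
        exact intervalIntegral.integral_const_mul c (iccExt f) } 1 fun f => by
    refine (ContinuousMap.norm_le _ (by positivity)).2 fun t => ?_
    refine (abs_integral_iccExt_le f 0 t).trans ?_
    rw [sub_zero, abs_of_nonneg t.2.1, one_mul]
    exact mul_le_of_le_one_right (norm_nonneg _) t.2.2

lemma volterra_apply (f : C(T, ℝ)) (t : T) : volterra f t = ∫ s in (0 : ℝ)..t, iccExt f s := rfl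

lemma iccExt_volterra (f : C(T, ℝ)) {t : ℝ} (ht : t ∈ T) :
    iccExt (volterra f) t = ∫ s in (0 : ℝ)..t, iccExt f s := by
  rw [iccExt_of_mem _ ht]; rfl

lemma isCompactOperator_volterra : IsCompactOperator volterra := by
  refine (isCompactOperator_iff_isCompact_closure_image_ball
    (volterra : C(T, ℝ) →ₗ[ℝ] C(T, ℝ)) (r := 1) one_pos).2 ?_
  let e : C(T, ℝ) ≃ᵢ BoundedContinuousFunction T ℝ := ContinuousMap.isometryEquivBoundedOfCompact T ℝ
  have h : IsCompact (closure (e '' (volterra '' Metric.ball 0 1))) := by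
    refine BoundedContinuousFunction.arzela_ascoli (Icc (-1) 1) isCompact_Icc _ ?_ ?_
    · rintro _ t ⟨_, ⟨f, hf, rfl⟩, rfl⟩
      rw [mem_ball_zero_iff] at hf
      refine abs_le.1 ?_
      refine (abs_integral_iccExt_le f 0 t).trans ?_
      rw [sub_zero, abs_of_nonneg t.2.1]
      exact mul_le_one₀ hf.le t.2.1 t.2.2
    · refine Metric.equicontinuous_of_continuity_modulus id continuous_id.continuousAt.tendsto _ ?_
      rintro s t ⟨_, ⟨_, ⟨f, hf, rfl⟩, rfl⟩⟩
      rw [mem_ball_zero_iff] at hf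
      change |(∫ u in (0 : ℝ)..s, iccExt f u) - ∫ u in (0 : ℝ)..t, iccExt f u| ≤ dist s t
      rw [intervalIntegral.integral_interval_sub_left
        ((continuous_iccExt f).intervalIntegrable _ _) ((continuous_iccExt f).intervalIntegrable _ _)]
      refine (abs_integral_iccExt_le f t s).trans ?_
      exact mul_le_of_le_one_left (abs_nonneg _) hf.le
  have h2 := e.toHomeomorph.image_closure (volterra '' Metric.ball 0 1)
  exact e.toHomeomorph.isCompact_image.1 (h2 ▸ h)

lemma eq_zero_of_eq_volterra (b v : C(T, ℝ)) (h : v = volterra (volterra (b * v))) : v = 0 := by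
  set U : ℝ → ℝ := fun t => ∫ s in (0 : ℝ)..t, iccExt (b * v) s with hU
  set V : ℝ → ℝ := fun t => ∫ s in (0 : ℝ)..t, iccExt (volterra (b * v)) s with hV
  have hVv : ∀ t (ht : t ∈ T), V t = v ⟨t, ht⟩ := fun t ht => by
    conv_rhs => rw [h]
    rfl
  have hdU : ∀ t, HasDerivAt U (iccExt (b * v) t) t := hasDerivAt_integral_iccExt _
  have hdV : ∀ t, HasDerivAt V (iccExt (volterra (b * v)) t) t := hasDerivAt_integral_iccExt _
  have key := eq_zero_of_abs_deriv_le_mul_abs_self_of_eq_zero_right (a := 0) (b := 1)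
    (f := fun t => (V t, U t)) (f' := fun t => (iccExt (volterra (b * v)) t, iccExt (b * v) t))
    (K := 1 + ‖b‖)
    (fun t _ => ((hdV t).prodMk (hdU t)).continuousAt.continuousWithinAt)
    (fun t _ => ((hdV t).prodMk (hdU t)).hasDerivWithinAt) (by simp [hU, hV])
    (fun t ht => by
      have ht' : t ∈ T := ⟨ht.1, ht.2.le⟩
      rw [iccExt_volterra _ ht', iccExt_of_mem _ ht']
      have hb : |b ⟨t, ht'⟩| ≤ ‖b‖ := b.norm_coe_le_norm _
      have h1 : |U t| ≤ ‖(V t, U t)‖ := norm_snd_le (V t, U t)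
      have h2 : |V t| ≤ ‖(V t, U t)‖ := norm_fst_le (V t, U t)
      have h0 := norm_nonneg (V t, U t)
      refine norm_prod_le_iff.2 ⟨?_, ?_⟩
      · change |U t| ≤ _
        nlinarith [norm_nonneg b]
      · change |b ⟨t, ht'⟩ * v ⟨t, ht'⟩| ≤ _
        rw [← hVv t ht', abs_mul]
        nlinarith [mul_le_mul hb h2 (abs_nonneg _) (norm_nonneg b)])
  ext t
  rw [← hVv t t.2]
  exact congrArg Prod.fst (key t t.2)

/-! ### The initial value problem `x'' = -3 k² x⁵` -/

/-- The coordinate function of `[0,1]`. -/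
def coordT : C(T, ℝ) := ⟨fun t => t, continuous_subtype_val⟩

/-- The integral equation `x = x₀ + w t - 3 k² ∫∫ x⁵`, for `P = (x₀, w, k)`. -/
def ivp (P : ℝ × ℝ × ℝ) (x : C(T, ℝ)) : C(T, ℝ) :=
  x - P.1 • 1 - P.2.1 • coordT + (3 * P.2.2 ^ 2) • volterra (volterra (x ^ 5))

lemma contDiff_ivp : ContDiff ℝ ∞ fun u : (ℝ × ℝ × ℝ) × C(T, ℝ) => ivp u.1 u.2 := by
  unfold ivp
  fun_prop

lemma hasDerivAt_ivp {P : ℝ → ℝ × ℝ × ℝ} {x : ℝ → C(T, ℝ)} {P' : ℝ × ℝ × ℝ} {v : C(T, ℝ)} {s : ℝ}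
    (hP : HasDerivAt P P' s) (hx : HasDerivAt x v s) :
    HasDerivAt (fun s => ivp (P s) (x s))
      (v - P'.1 • 1 - P'.2.1 • coordT + (6 * (P s).2.2 * P'.2.2) • volterra (volterra (x s ^ 5))
        + (15 * (P s).2.2 ^ 2) • volterra (volterra (x s ^ 4 * v))) s := by
  have h1 : HasDerivAt (fun s => (P s).1) P'.1 s := hP.fst
  have h2 : HasDerivAt (fun s => (P s).2.1) P'.2.1 s := hP.snd.fst
  have h3 : HasDerivAt (fun s => (P s).2.2) P'.2.2 s := hP.snd.snd
  have h5 := (volterra.hasFDerivAt (x := volterra (x s ^ 5))).comp_hasDerivAt s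
    ((volterra.hasFDerivAt (x := x s ^ 5)).comp_hasDerivAt s (hx.pow 5))
  have := (((hx.sub (h1.smul_const 1)).sub (h2.smul_const coordT)).add
    (((h3.pow 2).const_mul 3).smul h5))
  refine this.congr_deriv ?_
  have e : (5 : C(T, ℝ)) * x s ^ 4 * v = (5 : ℝ) • (x s ^ 4 * v) := by
    ext t
    exact mul_assoc (5 : ℝ) _ _
  simp only [Nat.cast_ofNat, Nat.add_one_sub_one, e, map_smul, smul_smul]
  norm_num
  ring_nf

lemma ivp_unique {P : ℝ × ℝ × ℝ} {x x' : C(T, ℝ)} (hx : ivp P x = 0) (hx' : ivp P x' = 0) :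
    x = x' := by
  refine sub_eq_zero.1 (eq_zero_of_eq_volterra
    ((-(3 * P.2.2 ^ 2)) • (x ^ 4 + x ^ 3 * x' + x ^ 2 * x' ^ 2 + x * x' ^ 3 + x' ^ 4)) _ ?_)
  have e : (-(3 * P.2.2 ^ 2)) • (x ^ 4 + x ^ 3 * x' + x ^ 2 * x' ^ 2 + x * x' ^ 3 + x' ^ 4)
      * (x - x') = (-(3 * P.2.2 ^ 2)) • (x ^ 5 - x' ^ 5) := by
    rw [smul_mul_assoc]; congr 1; ring
  rw [e, map_smul, map_smul, map_sub, map_sub]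
  have h := hx.trans hx'.symm
  unfold ivp at h
  rw [← sub_eq_zero] at h ⊢
  rw [← h]
  module

lemma isInvertible_fderiv_ivp (P : ℝ × ℝ × ℝ) (x : C(T, ℝ)) :
    (fderiv ℝ (fun u : (ℝ × ℝ × ℝ) × C(T, ℝ) => ivp u.1 u.2) (P, x) ∘L
      .inr ℝ (ℝ × ℝ × ℝ) C(T, ℝ)).IsInvertible := by
  set L := fderiv ℝ (fun u : (ℝ × ℝ × ℝ) × C(T, ℝ) => ivp u.1 u.2) (P, x) ∘L
      .inr ℝ (ℝ × ℝ × ℝ) C(T, ℝ) with hL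
  set K : C(T, ℝ) →L[ℝ] C(T, ℝ) := volterra ∘L ((-(15 * P.2.2 ^ 2)) • volterra ∘L
    ContinuousLinearMap.mul ℝ C(T, ℝ) (x ^ 4)) with hK
  have hLv : ∀ v, L v = v - K v := fun v => by
    have h1 := (contDiff_ivp.differentiable (by simp) (P, x)).hasFDerivAt.comp_hasDerivAt_of_eq
      (0 : ℝ) (f := fun s : ℝ => (P, x + s • v)) ((hasDerivAt_const 0 P).prodMk
        (((hasDerivAt_id (0 : ℝ)).smul_const v).const_add x)) (by simp)
    have h2 := hasDerivAt_ivp (hasDerivAt_const (0 : ℝ) P)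
      (((hasDerivAt_id (0 : ℝ)).smul_const v).const_add x)
    have h3 := h1.unique h2
    simp only [one_smul] at h3
    change fderiv ℝ (fun u : (ℝ × ℝ × ℝ) × C(T, ℝ) => ivp u.1 u.2) (P, x) (0, v) = _
    rw [h3]
    simp [hK]
  have hc : IsCompactOperator K := isCompactOperator_volterra.comp_clm _
  have hne : ¬ Module.End.HasEigenvalue (K : Module.End ℝ C(T, ℝ)) 1 := fun he => by
    obtain ⟨v, hv⟩ := he.exists_hasEigenvector
    refine hv.2 (eq_zero_of_eq_volterra ((-(15 * P.2.2 ^ 2)) • x ^ 4) v ?_)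
    have := hv.apply_eq_smul
    rw [one_smul] at this
    conv_lhs => rw [← this]
    simp [hK]
  have hu := (hc.hasEigenvalue_or_mem_resolventSet one_ne_zero).resolve_left hne
  obtain ⟨u, hu⟩ := spectrum.mem_resolventSet_iff.1 hu
  refine ⟨ContinuousLinearEquiv.ofUnit u, ?_⟩
  ext1 v
  rw [hLv]
  change (u : C(T, ℝ) →L[ℝ] C(T, ℝ)) v = _
  rw [hu]
  simp

/-- The parameters `(x₀, w, k)` for which `x'' = -3 k² x⁵` has a positive solution on `[0,1]` with
initial value `x₀` and initial velocity `w`. -/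
def solDomain : Set (ℝ × ℝ × ℝ) := {P | ∃ x : C(T, ℝ), (∀ t, 0 < x t) ∧ ivp P x = 0}

open Classical in
/-- The positive solution with the given initial values. -/
def sol (P : ℝ × ℝ × ℝ) : C(T, ℝ) := if h : P ∈ solDomain then h.choose else 0

lemma sol_pos {P : ℝ × ℝ × ℝ} (h : P ∈ solDomain) (t : T) : 0 < sol P t := by
  rw [sol, dif_pos h]; exact h.choose_spec.1 t

lemma ivp_sol {P : ℝ × ℝ × ℝ} (h : P ∈ solDomain) : ivp P (sol P) = 0 := by
  rw [sol, dif_pos h]; exact h.choose_spec.2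

lemma sol_eq {P : ℝ × ℝ × ℝ} {x : C(T, ℝ)} (hpos : ∀ t, 0 < x t) (hx : ivp P x = 0) :
    P ∈ solDomain ∧ sol P = x :=
  have h : P ∈ solDomain := ⟨x, hpos, hx⟩
  ⟨h, ivp_unique (ivp_sol h) hx⟩

lemma sol_smooth_aux {P : ℝ × ℝ × ℝ} (h : P ∈ solDomain) :
    (∀ᶠ Q in 𝓝 P, Q ∈ solDomain) ∧ ContDiffAt ℝ ∞ sol P := by
  have cd : ContDiffAt ℝ ∞ (fun u : (ℝ × ℝ × ℝ) × C(T, ℝ) => ivp u.1 u.2) (P, sol P) :=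
    contDiff_ivp.contDiffAt
  have hi := isInvertible_fderiv_ivp P (sol P)
  set ψ := cd.implicitFunction (by simp) hi
  have hψ : ContDiffAt ℝ ∞ ψ P := cd.contDiffAt_implicitFunction (by simp) hi
  have hψP : ψ P = sol P := cd.implicitFunction_apply_self (by simp) hi
  have h0 : ∀ᶠ Q in 𝓝 P, ivp Q (ψ Q) = 0 := by
    have := cd.eventually_apply_implicitFunction (by simp) hi
    simpa [ivp_sol h] using this
  have ho : IsOpen {x : C(T, ℝ) | ∀ t, 0 < x t} := by
    have := ContinuousMap.isOpen_setOfPred_mapsTo (X := T) (Y := ℝ) isCompact_univ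
      (isOpen_Ioi (a := (0 : ℝ)))
    convert this using 1
    ext x
    simp [MapsTo]
  have h1 : ∀ᶠ Q in 𝓝 P, ψ Q ∈ {x : C(T, ℝ) | ∀ t, 0 < x t} :=
    hψ.continuousAt.eventually (ho.mem_nhds (by rw [hψP]; exact sol_pos h))
  refine ⟨?_, hψ.congr_of_eventuallyEq ?_⟩
  · filter_upwards [h0, h1] with Q hQ hQ' using (sol_eq hQ' hQ).1
  · filter_upwards [h0, h1] with Q hQ hQ' using (sol_eq hQ' hQ).2

lemma isOpen_solDomain : IsOpen solDomain :=
  isOpen_iff_mem_nhds.2 fun _ h => (sol_smooth_aux h).1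

lemma contDiffOn_sol : ContDiffOn ℝ ∞ sol solDomain :=
  fun _ h => (sol_smooth_aux h).2.contDiffWithinAt

/-- The linearized initial value problem. -/
lemma fderiv_sol {P : ℝ × ℝ × ℝ} (h : P ∈ solDomain) (P' : ℝ × ℝ × ℝ) :
    fderiv ℝ sol P P' = P'.1 • 1 + P'.2.1 • coordT
      - volterra (volterra ((6 * P.2.2 * P'.2.2) • sol P ^ 5
        + (15 * P.2.2 ^ 2) • (sol P ^ 4 * fderiv ℝ sol P P'))) := by
  have hl : HasDerivAt (fun s : ℝ => P + s • P') P' 0 := by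
    simpa using ((hasDerivAt_id (0 : ℝ)).smul_const P').const_add P
  have hs : HasDerivAt (fun s : ℝ => sol (P + s • P')) (fderiv ℝ sol P P') 0 :=
    ((sol_smooth_aux h).2.differentiableAt (by simp)).hasFDerivAt.comp_hasDerivAt_of_eq 0 hl
      (by simp)
  have h1 := hasDerivAt_ivp hl hs
  have h2 : ∀ᶠ s : ℝ in 𝓝 0, ivp (P + s • P') (sol (P + s • P')) = 0 := by
    have hc : Filter.Tendsto (fun s : ℝ => P + s • P') (𝓝 0) (𝓝 P) := by
      simpa using hl.continuousAt.tendsto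
    filter_upwards [hc.eventually (sol_smooth_aux h).1] with s hs' using ivp_sol hs'
  have h3 := h1.unique ((hasDerivAt_const (0 : ℝ) (0 : C(T, ℝ))).congr_of_eventuallyEq h2)
  simp only [zero_smul, add_zero] at h3
  rw [← sub_eq_zero, ← h3]
  simp only [map_add, map_smul]
  module

end
end H2Curves

namespace H2Curves

open scoped Topology
open MeasureTheory

noncomputable section

/-! ### Geodesics of the half plane in Hamiltonian form -/

lemma uniqueDiffOn_T : UniqueDiffOn ℝ T := uniqueDiffOn_Icc zero_lt_one

lemma zero_mem_T : (0 : ℝ) ∈ T := ⟨le_rfl, zero_le_one⟩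

lemma one_mem_T : (1 : ℝ) ∈ T := ⟨zero_le_one, le_rfl⟩

lemma eqOn_T_of_hasDerivWithinAt {f g f' : ℝ → ℝ} (hf : ∀ t ∈ T, HasDerivWithinAt f (f' t) T t)
    (hg : ∀ t ∈ T, HasDerivWithinAt g (f' t) T t) (h0 : f 0 = g 0) : EqOn f g T :=
  eq_of_derivWithin_eq (fun t ht => (hf t ht).differentiableWithinAt)
    (fun t ht => (hg t ht).differentiableWithinAt)
    (fun t ht => by
      have ht' : t ∈ T := Ico_subset_Icc_self ht
      rw [(hf t ht').derivWithin (uniqueDiffOn_T t ht'),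
        (hg t ht').derivWithin (uniqueDiffOn_T t ht')]) h0

/-- The geodesic equations of `g` on `[0,1]`, solved for the velocity, where `2 k` is the conserved
momentum `x⁻⁶ y'`. -/
structure IsSol (x z y : ℝ → ℝ) (k : ℝ) : Prop where
  pos : ∀ t ∈ T, 0 < x t
  dx : ∀ t ∈ T, HasDerivWithinAt x (z t) T t
  dz : ∀ t ∈ T, HasDerivWithinAt z (-(3 * k ^ 2 * x t ^ 5)) T t
  dy : ∀ t ∈ T, HasDerivWithinAt y (2 * k * x t ^ 6) T t

lemma exists_isSol {P : ℝ × ℝ × ℝ} (h : P ∈ solDomain) (y₀ : ℝ) :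
    ∃ x z y, IsSol x z y P.2.2 ∧ x 0 = P.1 ∧ z 0 = P.2.1 ∧ y 0 = y₀ ∧
      ∀ t : T, x t = sol P t := by
  set X : ℝ → ℝ := fun t => P.1 + P.2.1 * t
    - 3 * P.2.2 ^ 2 * ∫ s in (0 : ℝ)..t, iccExt (volterra (sol P ^ 5)) s with hX
  have hXs : ∀ t : T, X t = sol P t := fun t => by
    have := congrArg (fun f : C(T, ℝ) => f t) (ivp_sol h)
    simp only [ivp, ContinuousMap.add_apply, ContinuousMap.sub_apply, ContinuousMap.smul_apply,
      ContinuousMap.one_apply, ContinuousMap.zero_apply, smul_eq_mul, coordT,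
      ContinuousMap.coe_mk] at this
    rw [volterra_apply] at this
    simp only [hX]
    linarith
  have hXe : ∀ t (ht : t ∈ T), X t = sol P ⟨t, ht⟩ := fun t ht => hXs ⟨t, ht⟩
  refine ⟨X, fun t => P.2.1 - 3 * P.2.2 ^ 2 * ∫ s in (0 : ℝ)..t, iccExt (sol P ^ 5) s,
    fun t => y₀ + 2 * P.2.2 * ∫ s in (0 : ℝ)..t, iccExt (sol P ^ 6) s,
    ⟨fun t ht => ?_, fun t ht => ?_, fun t ht => ?_, fun t ht => ?_⟩, ?_, ?_, ?_, hXs⟩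
  · rw [hXe t ht]; exact sol_pos h _
  · have h1 := (((hasDerivAt_id t).const_mul P.2.1).const_add P.1).sub
      ((hasDerivAt_integral_iccExt (volterra (sol P ^ 5)) t).const_mul (3 * P.2.2 ^ 2))
    rw [iccExt_volterra _ ht, mul_one] at h1
    exact h1.hasDerivWithinAt
  · have h1 := ((hasDerivAt_integral_iccExt (sol P ^ 5) t).const_mul (3 * P.2.2 ^ 2)).const_sub P.2.1
    rw [iccExt_of_mem _ ht] at h1
    rw [hXe t ht]
    exact h1.hasDerivWithinAt
  · have h1 := ((hasDerivAt_integral_iccExt (sol P ^ 6) t).const_mul (2 * P.2.2)).const_add y₀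
    rw [iccExt_of_mem _ ht] at h1
    rw [hXe t ht]
    exact h1.hasDerivWithinAt
  all_goals simp [hX]

namespace IsSol

variable {x z y : ℝ → ℝ} {k : ℝ}

lemma continuousOn_x (h : IsSol x z y k) : ContinuousOn x T :=
  fun t ht => (h.dx t ht).continuousWithinAt

lemma sol_eq (h : IsSol x z y k) :
    (x 0, z 0, k) ∈ solDomain ∧ ∀ t : T, sol (x 0, z 0, k) t = x t := by
  let X : C(T, ℝ) := ⟨fun t => x t, continuousOn_iff_continuous_domRestrict.1 h.continuousOn_x⟩
  have e1 : EqOn z (fun t => z 0 - 3 * k ^ 2 * ∫ s in (0 : ℝ)..t, iccExt (X ^ 5) s) T := by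
    refine eqOn_T_of_hasDerivWithinAt h.dz (fun t ht => ?_) (by simp)
    have h1 := ((hasDerivAt_integral_iccExt (X ^ 5) t).const_mul (3 * k ^ 2)).const_sub (z 0)
    rw [iccExt_of_mem _ ht] at h1
    exact h1.hasDerivWithinAt
  have e2 : EqOn x (fun t => x 0 + z 0 * t
      - 3 * k ^ 2 * ∫ s in (0 : ℝ)..t, iccExt (volterra (X ^ 5)) s) T := by
    refine eqOn_T_of_hasDerivWithinAt h.dx (fun t ht => ?_) (by simp)
    have h1 := (((hasDerivAt_id t).const_mul (z 0)).const_add (x 0)).sub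
      ((hasDerivAt_integral_iccExt (volterra (X ^ 5)) t).const_mul (3 * k ^ 2))
    rw [iccExt_volterra _ ht, mul_one] at h1
    rw [e1 ht]
    exact h1.hasDerivWithinAt
  have h0 : ivp (x 0, z 0, k) X = 0 := by
    ext t
    have := e2 t.2
    simp only [ivp, ContinuousMap.add_apply, ContinuousMap.sub_apply, ContinuousMap.smul_apply,
      ContinuousMap.one_apply, ContinuousMap.zero_apply, smul_eq_mul, coordT,
      ContinuousMap.coe_mk, volterra_apply] at this ⊢
    change x t - _ - _ + _ = 0
    linarith
  have := H2Curves.sol_eq (x := X) (fun t => h.pos t t.2) h0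
  exact ⟨this.1, fun t => by rw [this.2]; rfl⟩

lemma mem_solDomain (h : IsSol x z y k) : (x 0, z 0, k) ∈ solDomain := h.sol_eq.1

/-- Two geodesics with the same initial values agree. -/
lemma eqOn (h : IsSol x z y k) {x' z' y' : ℝ → ℝ} (h' : IsSol x' z' y' k) (hx : x 0 = x' 0)
    (hz : z 0 = z' 0) (hy : y 0 = y' 0) : EqOn x x' T ∧ EqOn z z' T ∧ EqOn y y' T := by
  have e : EqOn x x' T := fun t ht => by
    have h1 := h.sol_eq.2 ⟨t, ht⟩
    rw [hx, hz, h'.sol_eq.2 ⟨t, ht⟩] at h1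
    exact h1.symm
  refine ⟨e, eqOn_T_of_hasDerivWithinAt h.dz (fun t ht => ?_) hz,
    eqOn_T_of_hasDerivWithinAt h.dy (fun t ht => ?_) hy⟩
  · rw [e ht]; exact h'.dz t ht
  · rw [e ht]; exact h'.dy t ht

lemma scale (h : IsSol x z y k) {s : ℝ} (hs : s ∈ T) :
    IsSol (fun t => x (s * t)) (fun t => s * z (s * t)) (fun t => y (s * t)) (s * k) := by
  have hm : MapsTo (fun t : ℝ => s * t) T T := fun t ht =>
    ⟨mul_nonneg hs.1 ht.1, mul_le_one₀ hs.2 ht.1 ht.2⟩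
  have hd : ∀ t, HasDerivWithinAt (fun t : ℝ => s * t) s T t := fun t => by
    simpa using ((hasDerivAt_id t).const_mul s).hasDerivWithinAt
  refine ⟨fun t ht => h.pos _ (hm ht), fun t ht => ?_, fun t ht => ?_, fun t ht => ?_⟩
  · exact ((h.dx _ (hm ht)).comp t (hd t) hm).congr_deriv (by ring)
  · exact (((h.dz _ (hm ht)).comp t (hd t) hm).const_mul s).congr_deriv (by ring)
  · exact ((h.dy _ (hm ht)).comp t (hd t) hm).congr_deriv (by ring)

lemma reverse (h : IsSol x z y k) :
    IsSol (fun t => x (1 - t)) (fun t => -z (1 - t)) (fun t => y (1 - t)) (-k) := by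
  have hm : MapsTo (fun t : ℝ => 1 - t) T T := fun t ht => ⟨by linarith [ht.2], by linarith [ht.1]⟩
  have hd : ∀ t, HasDerivWithinAt (fun t : ℝ => 1 - t) (-1) T t := fun t => by
    simpa using ((hasDerivAt_id t).const_sub 1).hasDerivWithinAt
  refine ⟨fun t ht => h.pos _ (hm ht), fun t ht => ?_, fun t ht => ?_, fun t ht => ?_⟩
  · exact ((h.dx _ (hm ht)).comp t (hd t) hm).congr_deriv (by ring)
  · exact (((h.dz _ (hm ht)).comp t (hd t) hm).neg).congr_deriv (by ring)
  · exact ((h.dy _ (hm ht)).comp t (hd t) hm).congr_deriv (by ring)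

lemma reflect (h : IsSol x z y k) : IsSol x z (fun t => -y t) (-k) :=
  ⟨h.pos, h.dx, fun t ht => (h.dz t ht).congr_deriv (by ring),
    fun t ht => (h.dy t ht).neg.congr_deriv (by ring)⟩

/-- The conserved energy. -/
lemma energy_eq (h : IsSol x z y k) {t : ℝ} (ht : t ∈ T) :
    z t ^ 2 + k ^ 2 * x t ^ 6 = z 0 ^ 2 + k ^ 2 * x 0 ^ 6 := by
  refine eqOn_T_of_hasDerivWithinAt (f := fun t => z t ^ 2 + k ^ 2 * x t ^ 6)
    (g := fun _ => z 0 ^ 2 + k ^ 2 * x 0 ^ 6) (f' := fun _ => 0) (fun t ht => ?_)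
    (fun t _ => hasDerivWithinAt_const _ _ _) rfl ht
  refine (((h.dz t ht).pow 2).add (((h.dx t ht).pow 6).const_mul (k ^ 2))).congr_deriv ?_
  simp; ring

end IsSol

/-- The increment of `y` along the solution with parameters `P`. -/
def endY (P : ℝ × ℝ × ℝ) : ℝ := 2 * P.2.2 * volterra (sol P ^ 6) ⟨1, one_mem_T⟩

/-- The final value of `x` along the solution with parameters `P`. -/
def endX (P : ℝ × ℝ × ℝ) : ℝ := sol P ⟨1, one_mem_T⟩

lemma contDiff_apply_CT (t : T) : ContDiff ℝ ∞ fun f : C(T, ℝ) => f t :=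
  (ContinuousMap.evalCLM ℝ t : C(T, ℝ) →L[ℝ] ℝ).contDiff

lemma contDiffOn_endX : ContDiffOn ℝ ∞ endX solDomain :=
  (contDiff_apply_CT _).comp_contDiffOn contDiffOn_sol

lemma contDiffOn_endY : ContDiffOn ℝ ∞ endY solDomain :=
  (contDiff_const.mul (contDiff_snd.comp contDiff_snd)).contDiffOn.mul
    ((contDiff_apply_CT _).comp_contDiffOn (volterra.contDiff.comp_contDiffOn (contDiffOn_sol.pow 6)))

namespace IsSol

variable {x z y : ℝ → ℝ} {k : ℝ}

lemma endX_eq (h : IsSol x z y k) : endX (x 0, z 0, k) = x 1 := h.sol_eq.2 ⟨1, one_mem_T⟩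

lemma endY_eq (h : IsSol x z y k) : endY (x 0, z 0, k) = y 1 - y 0 := by
  have e : EqOn y (fun t => y 0 + 2 * k * ∫ s in (0 : ℝ)..t, iccExt (sol (x 0, z 0, k) ^ 6) s) T := by
    refine eqOn_T_of_hasDerivWithinAt h.dy (fun t ht => ?_) (by simp)
    have h1 := ((hasDerivAt_integral_iccExt (sol (x 0, z 0, k) ^ 6) t).const_mul
      (2 * k)).const_add (y 0)
    rw [iccExt_of_mem _ ht] at h1
    have h2 := h.sol_eq.2 ⟨t, ht⟩
    rw [← h2]
    exact h1.hasDerivWithinAt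
  rw [e one_mem_T]
  simp [endY, volterra_apply]

lemma mem_solDomain_scale (h : IsSol x z y k) {s : ℝ} (hs : s ∈ T) :
    (x 0, s * z 0, s * k) ∈ solDomain := by simpa using (h.scale hs).mem_solDomain

lemma x_eq_endX (h : IsSol x z y k) {s : ℝ} (hs : s ∈ T) : x s = endX (x 0, s * z 0, s * k) := by
  simpa using (h.scale hs).endX_eq.symm

lemma y_eq_endY (h : IsSol x z y k) {s : ℝ} (hs : s ∈ T) :
    y s = y 0 + endY (x 0, s * z 0, s * k) := by
  have := (h.scale hs).endY_eq
  simp only [mul_zero, mul_one] at this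
  linarith

lemma contDiffOn_x (h : IsSol x z y k) : ContDiffOn ℝ ∞ x T :=
  (contDiffOn_endX.comp (t := solDomain) (s := T) (f := fun s => (x 0, s * z 0, s * k)) (by fun_prop)
    fun _ hs => h.mem_solDomain_scale hs).congr fun _ hs => h.x_eq_endX hs

lemma contDiffOn_y (h : IsSol x z y k) : ContDiffOn ℝ ∞ y T :=
  (contDiffOn_const.add (contDiffOn_endY.comp (t := solDomain) (s := T)
    (f := fun s => (x 0, s * z 0, s * k)) (by fun_prop)
    fun _ hs => h.mem_solDomain_scale hs)).congr fun _ hs => h.y_eq_endY hs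

end IsSol

lemma gPartial_eq {p : Fin 2 → ℝ} (hp : 0 < p 0) (l i j : Fin 2) :
    gPartial p l i j = if l = 0 ∧ i = 1 ∧ j = 1 then -6 * p 0 ^ (-7 : ℤ) else 0 := by
  have h : HasFDerivAt (fun r : Fin 2 → ℝ => r 0 ^ (-6 : ℤ))
      ((((-6 : ℤ) : ℝ) * p 0 ^ (-6 - 1 : ℤ)) • ContinuousLinearMap.proj (R := ℝ) (φ := fun _ : Fin 2 => ℝ) 0) p := by
    have h1 := (hasDerivAt_zpow (-6) (p 0) (Or.inl hp.ne')).comp_hasFDerivAt p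
      (hasFDerivAt_apply (𝕜 := ℝ) (0 : Fin 2) p)
    exact h1
  have h11 : (fun r : Fin 2 → ℝ => gMat r 1 1) = fun r => r 0 ^ (-6 : ℤ) := by
    funext r; simp [gMat]
  unfold gPartial
  fin_cases i <;> fin_cases j <;> fin_cases l <;>
    first | (simp [gMat]; done) | (simp only [Fin.mk_one, Fin.zero_eta, h11, h.fderiv]; simp)

lemma gMat_inv {p : Fin 2 → ℝ} (hp : 0 < p 0) :
    (gMat p)⁻¹ = !![1 / 4, 0; 0, (p 0) ^ (6 : ℤ)] := by
  apply Matrix.inv_eq_right_inv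
  have : p 0 ≠ 0 := hp.ne'
  ext i j
  fin_cases i <;> fin_cases j <;> simp [gMat, Matrix.mul_apply, zpow_neg]
  field_simp

lemma sum_christoffel_zero {p : Fin 2 → ℝ} (hp : 0 < p 0) (v : Fin 2 → ℝ) :
    ∑ i, ∑ j, christoffel p 0 i j * v i * v j = 3 / 4 * (p 0) ^ (-7 : ℤ) * v 1 ^ 2 := by
  simp [christoffel, gMat_inv hp, gPartial_eq hp, Fin.sum_univ_two]
  ring

lemma sum_christoffel_one {p : Fin 2 → ℝ} (hp : 0 < p 0) (v : Fin 2 → ℝ) :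
    ∑ i, ∑ j, christoffel p 1 i j * v i * v j = -6 * v 0 * v 1 / p 0 := by
  have : p 0 ≠ 0 := hp.ne'
  simp [christoffel, gMat_inv hp, gPartial_eq hp, Fin.sum_univ_two]
  field_simp
  ring

lemma gInner_self (p h : Fin 2 → ℝ) :
    gInner p h h = 4 * h 0 ^ 2 + (p 0) ^ (-6 : ℤ) * h 1 ^ 2 := by
  simp [gInner, gMat, Fin.sum_univ_two]
  ring

lemma hasDerivWithinAt_vec {f g : ℝ → ℝ} {f' g' t : ℝ} {s : Set ℝ} (hf : HasDerivWithinAt f f' s t)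
    (hg : HasDerivWithinAt g g' s t) :
    HasDerivWithinAt (fun t => ![f t, g t]) ![f', g'] s t :=
  hasDerivWithinAt_pi.2 (Fin.forall_fin_two.2 ⟨hf, hg⟩)

lemma IsSol.velocity_eq {x z y : ℝ → ℝ} {k : ℝ} (h : IsSol x z y k) {t : ℝ} (ht : t ∈ T) :
    velocity (fun t => ![x t, y t]) t = ![z t, 2 * k * x t ^ 6] :=
  (hasDerivWithinAt_vec (h.dx t ht) (h.dy t ht)).derivWithin (uniqueDiffOn_T t ht)

lemma IsSol.isPlaneGeodesic {x z y : ℝ → ℝ} {k : ℝ} (h : IsSol x z y k) :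
    IsPlaneGeodesic (fun t => ![x t, y t]) := by
  refine ⟨⟨contDiffOn_pi.2 (Fin.forall_fin_two.2 ⟨h.contDiffOn_x, h.contDiffOn_y⟩), h.pos⟩, ?_⟩
  intro t ht
  have hx := h.pos t ht
  have hd : derivWithin (velocity (fun t => ![x t, y t])) T t
      = ![-(3 * k ^ 2 * x t ^ 5), 2 * k * (6 * x t ^ 5 * z t)] := by
    refine HasDerivWithinAt.derivWithin (HasDerivWithinAt.congr_of_mem ?_
      (fun s hs => h.velocity_eq hs) ht) (uniqueDiffOn_T t ht)
    refine hasDerivWithinAt_vec (h.dz t ht) ?_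
    exact (((h.dx t ht).pow 6).const_mul (2 * k)).congr_deriv (by simp)
  have hp : 0 < ![x t, y t] 0 := hx
  rw [hd, h.velocity_eq ht]
  refine Fin.forall_fin_two.2 ⟨?_, ?_⟩
  · rw [sum_christoffel_zero hp]
    have : x t ≠ 0 := hx.ne'
    simp [zpow_neg]
    field_simp
    norm_num
  · rw [sum_christoffel_one hp]
    simp
    field_simp
    ring

lemma IsPlaneGeodesic.exists_isSol {γ : ℝ → Fin 2 → ℝ} (h : IsPlaneGeodesic γ) :
    ∃ z k, IsSol (fun t => γ t 0) z (fun t => γ t 1) k := by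
  have hd : ∀ t ∈ T, HasDerivWithinAt γ (velocity γ t) T t := fun t ht =>
    (h.smooth.differentiableOn (by simp) t ht).hasDerivWithinAt
  have hv : ContDiffOn ℝ ∞ (velocity γ) T := h.smooth.derivWithin uniqueDiffOn_T (by simp)
  have hdv : ∀ t ∈ T, HasDerivWithinAt (velocity γ) (derivWithin (velocity γ) T t) T t :=
    fun t ht => (hv.differentiableOn (by simp) t ht).hasDerivWithinAt
  have dx := fun t ht => hasDerivWithinAt_pi.1 (hd t ht) 0
  have dy := fun t ht => hasDerivWithinAt_pi.1 (hd t ht) 1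
  have dz : ∀ t ∈ T, HasDerivWithinAt (fun t => velocity γ t 0)
      (-(3 / 4 * (γ t 0) ^ (-7 : ℤ) * velocity γ t 1 ^ 2)) T t := fun t ht => by
    refine (hasDerivWithinAt_pi.1 (hdv t ht) 0).congr_deriv ?_
    have := h.geodesic_eq t ht 0
    rw [sum_christoffel_zero (h.mem t ht)] at this
    linarith
  have du : ∀ t ∈ T, HasDerivWithinAt (fun t => velocity γ t 1)
      (6 * velocity γ t 0 * velocity γ t 1 / γ t 0) T t := fun t ht => by
    refine (hasDerivWithinAt_pi.1 (hdv t ht) 1).congr_deriv ?_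
    have := h.geodesic_eq t ht 1
    rw [sum_christoffel_one (h.mem t ht)] at this
    linarith [neg_div (γ t 0) (6 * velocity γ t 0 * velocity γ t 1),
      show -6 * velocity γ t 0 * velocity γ t 1 / γ t 0
        = -(6 * velocity γ t 0 * velocity γ t 1 / γ t 0) by ring]
  have hc : EqOn (fun t => velocity γ t 1 / γ t 0 ^ 6) (fun _ => velocity γ 0 1 / γ 0 0 ^ 6) T := by
    refine eqOn_T_of_hasDerivWithinAt (f' := fun _ => 0) (fun t ht => ?_)
      (fun t _ => hasDerivWithinAt_const _ _ _) rfl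
    have hp : γ t 0 ≠ 0 := (h.mem t ht).ne'
    refine ((du t ht).div ((dx t ht).pow 6) (pow_ne_zero 6 hp)).congr_deriv ?_
    simp
    field_simp
    ring_nf
    simp
  set k := velocity γ 0 1 / γ 0 0 ^ 6 / 2 with hk
  have hu : ∀ t ∈ T, velocity γ t 1 = 2 * k * γ t 0 ^ 6 := fun t ht => by
    have hp : γ t 0 ≠ 0 := (h.mem t ht).ne'
    have := hc ht
    simp only at this
    rw [div_eq_iff (pow_ne_zero 6 hp)] at this
    rw [this, hk]; ring
  refine ⟨fun t => velocity γ t 0, k, h.mem, dx, fun t ht => ?_, fun t ht => ?_⟩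
  · refine (dz t ht).congr_deriv ?_
    have hp : γ t 0 ≠ 0 := (h.mem t ht).ne'
    rw [hu t ht, zpow_neg]
    norm_cast
    field_simp
    ring
  · rw [← hu t ht]; exact dy t ht

lemma vec_eta (p : Fin 2 → ℝ) : ![p 0, p 1] = p := by
  ext i; fin_cases i <;> rfl

end
end H2Curves

namespace H2Curves

open scoped Topology
open MeasureTheory

noncomputable section

/-! ### The function `F` -/

/-- The integrand of `F`. -/
def fIntegrand (u : ℝ) : ℝ := u ^ 6 / √(1 - u ^ 6)

lemma fIntegrand_nonneg (u : ℝ) : 0 ≤ fIntegrand u := by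
  unfold fIntegrand
  have : 0 ≤ u ^ 6 := by positivity
  positivity

lemma measurable_fIntegrand : Measurable fIntegrand := by
  unfold fIntegrand
  fun_prop

lemma continuousAt_fIntegrand {u : ℝ} (h0 : -1 < u) (h1 : u < 1) : ContinuousAt fIntegrand u := by
  have h2 : u ^ 2 < 1 := by nlinarith
  have h : u ^ 6 < 1 := by
    calc u ^ 6 = (u ^ 2) ^ 3 := by ring
      _ < 1 := pow_lt_one₀ (sq_nonneg u) h2 (by norm_num)
  have : √(1 - u ^ 6) ≠ 0 := (Real.sqrt_pos.2 (by linarith)).ne'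
  unfold fIntegrand
  fun_prop (disch := assumption)

lemma integrableOn_fIntegrand : IntegrableOn fIntegrand (Icc 0 1) := by
  have h1 : IntervalIntegrable (fun u : ℝ => (1 - u) ^ (-(1 / 2) : ℝ)) volume 0 1 := by
    have := (intervalIntegral.intervalIntegrable_rpow' (a := 0) (b := 1)
      (r := -(1 / 2)) (by norm_num)).comp_sub_left 1
    simpa using this.symm
  rw [intervalIntegrable_iff_integrableOn_Icc_of_le zero_le_one] at h1
  refine h1.mono' measurable_fIntegrand.aestronglyMeasurable ?_
  refine (ae_restrict_iff' measurableSet_Icc).2 (Filter.Eventually.of_forall fun u hu => ?_)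
  rw [Real.norm_of_nonneg (fIntegrand_nonneg u)]
  rcases hu.2.eq_or_lt with rfl | h
  · norm_num [fIntegrand]
  have h6 : u ^ 6 ≤ u := by
    calc u ^ 6 ≤ u ^ 1 := pow_le_pow_of_le_one hu.1 hu.2 (by norm_num)
      _ = u := pow_one u
  rw [Real.rpow_neg (by linarith), ← Real.sqrt_eq_rpow, fIntegrand, div_eq_mul_inv]
  have hs : 0 < √(1 - u) := Real.sqrt_pos.2 (by linarith)
  calc u ^ 6 * (√(1 - u ^ 6))⁻¹ ≤ 1 * (√(1 - u))⁻¹ := by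
        gcongr
        linarith [hu.2]
    _ = _ := one_mul _

lemma intervalIntegrable_fIntegrand {a b : ℝ} (ha : a ∈ Icc (0 : ℝ) 1) (hb : b ∈ Icc (0 : ℝ) 1) :
    IntervalIntegrable fIntegrand volume a b :=
  (intervalIntegrable_iff.2 (integrableOn_fIntegrand.mono_set
    (uIoc_subset_uIcc.trans (uIcc_subset_Icc ha hb))))

lemma F_eq (u : ℝ) : F u = ∫ z in (0 : ℝ)..u, fIntegrand z := rfl

@[simp] lemma F_zero : F 0 = 0 := by simp [F]

lemma continuousOn_F : ContinuousOn F (Icc 0 1) := by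
  have := intervalIntegral.continuousOn_primitive_interval (f := fIntegrand) (a := 0) (b := 1)
    (μ := volume) (by rw [uIcc_of_le zero_le_one]; exact integrableOn_fIntegrand)
  rwa [uIcc_of_le zero_le_one] at this

lemma hasDerivAt_F {u : ℝ} (h0 : 0 ≤ u) (h1 : u < 1) : HasDerivAt F (fIntegrand u) u :=
  intervalIntegral.integral_hasDerivAt_right
    (intervalIntegrable_fIntegrand ⟨le_rfl, zero_le_one⟩ ⟨h0, h1.le⟩)
    measurable_fIntegrand.stronglyMeasurable.stronglyMeasurableAtFilter
    (continuousAt_fIntegrand (by linarith) h1)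

lemma F_sub {a b : ℝ} (ha : a ∈ Icc (0 : ℝ) 1) (hb : b ∈ Icc (0 : ℝ) 1) :
    F b - F a = ∫ z in a..b, fIntegrand z :=
  intervalIntegral.integral_interval_sub_left
    (intervalIntegrable_fIntegrand ⟨le_rfl, zero_le_one⟩ hb)
    (intervalIntegrable_fIntegrand ⟨le_rfl, zero_le_one⟩ ha)

lemma strictMonoOn_F : StrictMonoOn F (Icc 0 1) := by
  intro a ha b hb hab
  rw [← sub_pos, F_sub ha hb]
  refine intervalIntegral.intervalIntegral_pos_of_pos_on (intervalIntegrable_fIntegrand ha hb)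
    (fun z hz => ?_) hab
  have hz0 : 0 < z := ha.1.trans_lt hz.1
  have hz1 : z ^ 6 < 1 := pow_lt_one₀ hz0.le (hz.2.trans_le hb.2) (by norm_num)
  have := Real.sqrt_pos.2 (sub_pos.2 hz1)
  unfold fIntegrand
  positivity

lemma A_pos : 0 < A := by
  have := strictMonoOn_F ⟨le_rfl, zero_le_one⟩ ⟨zero_le_one, le_rfl⟩ (zero_lt_one (α := ℝ))
  rwa [F_zero] at this

lemma F_le {u : ℝ} (hu : u ∈ Icc (0 : ℝ) 1) : F u ≤ A * u ^ 7 := by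
  have h1 : F u = u * ∫ z in (0 : ℝ)..1, fIntegrand (u * z) := by
    rw [intervalIntegral.mul_integral_comp_mul_left]
    simp [F_eq]
  rw [h1, A, F_eq, mul_comm _ (u ^ 7), pow_succ', mul_assoc]
  refine mul_le_mul_of_nonneg_left ?_ hu.1
  rw [← intervalIntegral.integral_const_mul]
  have hi := intervalIntegrable_fIntegrand (a := 0) (b := 1) ⟨le_rfl, zero_le_one⟩
    ⟨zero_le_one, le_rfl⟩
  have hle : ∀ z ∈ Ioo (0 : ℝ) 1, fIntegrand (u * z) ≤ u ^ 6 * fIntegrand z := fun z hz => by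
    have hz1 : z ^ 6 < 1 := pow_lt_one₀ hz.1.le hz.2 (by norm_num)
    have := Real.sqrt_pos.2 (sub_pos.2 hz1)
    have hu6 : u ^ 6 ≤ 1 := pow_le_one₀ hu.1 hu.2
    have hz0 : 0 ≤ z ^ 6 := by positivity
    unfold fIntegrand
    rw [mul_pow, ← mul_div_assoc]
    gcongr
    exact mul_le_of_le_one_left hz0 hu6
  refine intervalIntegral.integral_mono_on_of_le_Ioo zero_le_one ?_ (hi.const_mul _) hle
  have hi2 : IntervalIntegrable (fun z => u ^ 6 * fIntegrand z) volume 0 1 := hi.const_mul _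
  rw [intervalIntegrable_iff_integrableOn_Ioo_of_le zero_le_one] at hi2 ⊢
  refine hi2.mono' (measurable_fIntegrand.comp (measurable_const_mul u)).aestronglyMeasurable ?_
  refine (ae_restrict_iff' measurableSet_Ioo).2 (Filter.Eventually.of_forall fun z hz => ?_)
  rw [Real.norm_of_nonneg (fIntegrand_nonneg _)]
  exact hle z hz

lemma F_le_four {u : ℝ} (hu : u ∈ Icc (0 : ℝ) 1) : F u ≤ A * u ^ 4 :=
  (F_le hu).trans (mul_le_mul_of_nonneg_left (pow_le_pow_of_le_one hu.1 hu.2 (by norm_num)) A_pos.le)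

/-! ### The change of `y` along a geodesic, as a function of the apex -/

/-- The change of `y` between `x₀` and `x₁` on one branch of the geodesic with apex `1 / C`. -/
def branchGap (x₀ x₁ C : ℝ) : ℝ := 2 / C ^ 4 * (F (C * x₁) - F (C * x₀))

/-- The change of `y` between `x₀` and `x₁` through the apex `a`. -/
def apexGap (x₀ x₁ a : ℝ) : ℝ := 2 * a ^ 4 * (2 * A - F (x₀ / a) - F (x₁ / a))

lemma branchGap_eq_integral {x₀ x₁ C : ℝ} (h0 : 0 < x₀) (h01 : x₀ ≤ x₁) (hC : 0 < C)
    (hC1 : C ≤ 1 / x₁) :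
    branchGap x₀ x₁ C = ∫ x in x₀..x₁, 2 / C ^ 3 * fIntegrand (C * x) ∧
      IntervalIntegrable (fun x => 2 / C ^ 3 * fIntegrand (C * x)) volume x₀ x₁ := by
  have h1 : 0 < x₁ := h0.trans_le h01
  have hb : C * x₁ ≤ 1 := by rwa [le_div_iff₀ h1] at hC1
  have m1 : C * x₁ ∈ Icc (0 : ℝ) 1 := ⟨by positivity, hb⟩
  have m0 : C * x₀ ∈ Icc (0 : ℝ) 1 :=
    ⟨by positivity, (mul_le_mul_of_nonneg_left h01 hC.le).trans hb⟩
  refine ⟨?_, ?_⟩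
  · rw [intervalIntegral.integral_const_mul, intervalIntegral.integral_comp_mul_left _ hC.ne',
      branchGap, F_sub m0 m1, smul_eq_mul]
    field_simp
  · have := (intervalIntegrable_fIntegrand m0 m1).comp_mul_left (c := C)
    rw [mul_div_cancel_left₀ _ hC.ne', mul_div_cancel_left₀ _ hC.ne'] at this
    exact this.const_mul _

lemma strictMonoOn_branchGap {x₀ x₁ : ℝ} (h0 : 0 < x₀) (h01 : x₀ < x₁) :
    StrictMonoOn (branchGap x₀ x₁) (Ioc 0 (1 / x₁)) := by
  intro C hC D hD hCD
  have h1 : 0 < x₁ := h0.trans h01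
  obtain ⟨eC, iC⟩ := branchGap_eq_integral h0 h01.le hC.1 hC.2
  obtain ⟨eD, iD⟩ := branchGap_eq_integral h0 h01.le hD.1 hD.2
  rw [← sub_pos, eC, eD, ← intervalIntegral.integral_sub iD iC]
  refine intervalIntegral.intervalIntegral_pos_of_pos_on (iD.sub iC) (fun x hx => ?_) h01
  have hx0 : 0 < x := h0.trans hx.1
  have hD1 : D * x < 1 := by
    have := hD.2
    rw [le_div_iff₀ h1] at this
    exact (mul_lt_mul_of_pos_left hx.2 hD.1).trans_le this
  have hDx : (D * x) ^ 6 < 1 := pow_lt_one₀ (mul_nonneg hD.1.le hx0.le) hD1 (by norm_num)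
  have hCx : (C * x) ^ 6 ≤ (D * x) ^ 6 :=
    pow_le_pow_left₀ (mul_nonneg hC.1.le hx0.le) (mul_le_mul_of_nonneg_right hCD.le hx0.le) 6
  have hs := Real.sqrt_pos.2 (sub_pos.2 hDx)
  have hss : √(1 - (D * x) ^ 6) ≤ √(1 - (C * x) ^ 6) := Real.sqrt_le_sqrt (by linarith)
  have hC0 := hC.1
  have hD0 := hD.1
  have e : ∀ E : ℝ, 0 < E → 2 / E ^ 3 * fIntegrand (E * x)
      = 2 * x ^ 6 * (E ^ 3 / √(1 - (E * x) ^ 6)) := fun E hE => by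
    unfold fIntegrand; field_simp
  rw [e C hC0, e D hD0, sub_pos]
  refine mul_lt_mul_of_pos_left ?_ (by positivity)
  calc C ^ 3 / √(1 - (C * x) ^ 6) ≤ C ^ 3 / √(1 - (D * x) ^ 6) := by gcongr
    _ < D ^ 3 / √(1 - (D * x) ^ 6) := by gcongr

lemma branchGap_inv {x₀ x₁ : ℝ} (h1 : 0 < x₁) :
    branchGap x₀ x₁ (1 / x₁) = 2 * x₁ ^ 4 * (A - F (x₀ / x₁)) := by
  unfold branchGap A
  field_simp

lemma exists_branchGap {x₀ x₁ d : ℝ} (h0 : 0 < x₀) (h01 : x₀ ≤ x₁) (hd : 0 < d)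
    (hle : d ≤ 2 * x₁ ^ 4 * (A - F (x₀ / x₁))) :
    ∃ C, 0 < C ∧ C ≤ 1 / x₁ ∧ d = branchGap x₀ x₁ C := by
  have h1 : 0 < x₁ := h0.trans_le h01
  have hA := A_pos
  obtain ⟨c, hc0, hc1, hc⟩ : ∃ c, 0 < c ∧ c ≤ 1 / x₁ ∧ branchGap x₀ x₁ c ≤ d := by
    refine ⟨min (1 / x₁) (min 1 (d / (2 * A * x₁ ^ 7))), by positivity, min_le_left _ _, ?_⟩
    set c := min (1 / x₁) (min 1 (d / (2 * A * x₁ ^ 7)))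
    have hc0 : 0 < c := by positivity
    have hc1 : c ≤ 1 / x₁ := min_le_left _ _
    have hc2 : c ≤ 1 := (min_le_right _ _).trans (min_le_left _ _)
    have hc3 : c ≤ d / (2 * A * x₁ ^ 7) := (min_le_right _ _).trans (min_le_right _ _)
    have hb : c * x₁ ≤ 1 := by rwa [le_div_iff₀ h1] at hc1
    have hF0 : 0 ≤ F (c * x₀) := by
      have := strictMonoOn_F.monotoneOn ⟨le_rfl, zero_le_one⟩ (b := c * x₀) ⟨by positivity,
        (mul_le_mul_of_nonneg_left h01 hc0.le).trans hb⟩ (by positivity)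
      rwa [F_zero] at this
    have hF1 := F_le (u := c * x₁) ⟨by positivity, hb⟩
    calc branchGap x₀ x₁ c ≤ 2 / c ^ 4 * (A * (c * x₁) ^ 7) := by
          unfold branchGap
          gcongr
          linarith
      _ = c ^ 3 * (2 * A * x₁ ^ 7) := by field_simp
      _ ≤ c ^ 1 * (2 * A * x₁ ^ 7) := by
          gcongr 1
          exact pow_le_pow_of_le_one hc0.le hc2 (by norm_num)
      _ ≤ d := by rwa [pow_one, ← le_div_iff₀ (by positivity)]
  have hcont : ContinuousOn (branchGap x₀ x₁) (Icc c (1 / x₁)) := by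
    have hm : ∀ x, 0 < x → x ≤ x₁ → ContinuousOn (fun C => F (C * x)) (Icc c (1 / x₁)) :=
      fun x hx hx1 => continuousOn_F.comp (by fun_prop) fun C hC => ⟨by
        have := hc0.trans_le hC.1
        positivity, by
        have := hC.2
        rw [le_div_iff₀ h1] at this
        exact (mul_le_mul_of_nonneg_left hx1 (hc0.le.trans hC.1)).trans this⟩
    have hne : ∀ C ∈ Icc c (1 / x₁), C ^ 4 ≠ 0 := fun C hC => by
      have := hc0.trans_le hC.1
      positivity
    exact (continuousOn_const.div (by fun_prop) hne).mul ((hm x₁ h1 le_rfl).sub (hm x₀ h0 h01))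
  obtain ⟨C, hC, hCd⟩ := intermediate_value_Icc hc1 hcont ⟨hc, by rwa [branchGap_inv h1]⟩
  exact ⟨C, hc0.trans_le hC.1, hC.2, hCd.symm⟩

lemma div_mem {x a : ℝ} (h0 : 0 < x) (h : x ≤ a) : x / a ∈ Icc (0 : ℝ) 1 :=
  ⟨div_nonneg h0.le (h0.le.trans h), div_le_one_of_le₀ h (h0.le.trans h)⟩

lemma strictMonoOn_apexGap {x₀ x₁ : ℝ} (h0 : 0 < x₀) (h01 : x₀ ≤ x₁) :
    StrictMonoOn (apexGap x₀ x₁) (Ici x₁) := by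
  intro a ha b hb hab
  have h1 : 0 < x₁ := h0.trans_le h01
  have ha' : x₁ ≤ a := ha
  have ha0 : 0 < a := h1.trans_le ha'
  have hb' : x₁ < b := ha'.trans_lt hab
  have key : ∀ x, 0 < x → x ≤ x₁ → 0 ≤ A - F (x / a) ∧ F (x / b) < F (x / a) := fun x hx hx1 => by
    have ma := div_mem hx (hx1.trans ha')
    refine ⟨sub_nonneg.2 (strictMonoOn_F.monotoneOn ma ⟨zero_le_one, le_rfl⟩ ma.2),
      strictMonoOn_F (div_mem hx (hx1.trans hb'.le)) ma ?_⟩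
    gcongr
  have k0 := key x₀ h0 h01
  have k1 := key x₁ h1 le_rfl
  unfold apexGap
  have h4 : a ^ 4 ≤ b ^ 4 := by gcongr
  have hbp : 0 < b ^ 4 := by have := ha0.trans hab; positivity
  nlinarith [mul_le_mul_of_nonneg_right h4 (add_nonneg k0.1 k1.1),
    mul_pos hbp (sub_pos.2 k0.2), mul_pos hbp (sub_pos.2 k1.2)]

lemma apexGap_self {x₀ x₁ : ℝ} (h1 : 0 < x₁) :
    apexGap x₀ x₁ x₁ = 2 * x₁ ^ 4 * (A - F (x₀ / x₁)) := by
  rw [apexGap, div_self h1.ne', A]; ring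

lemma le_apexGap {x₀ x₁ a : ℝ} (h0 : 0 < x₀) (h01 : x₀ ≤ x₁) (ha : x₁ ≤ a) :
    4 * A * a ^ 4 - 2 * A * (x₀ ^ 4 + x₁ ^ 4) ≤ apexGap x₀ x₁ a := by
  have h1 : 0 < x₁ := h0.trans_le h01
  have ha0 : 0 < a := h1.trans_le ha
  have e0 := F_le_four (div_mem h0 (h01.trans ha))
  have e1 := F_le_four (div_mem h1 ha)
  rw [div_pow, ← mul_div_assoc, le_div_iff₀ (by positivity)] at e0 e1
  unfold apexGap
  nlinarith

lemma exists_apexGap {x₀ x₁ d : ℝ} (h0 : 0 < x₀) (h01 : x₀ ≤ x₁)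
    (hlt : 2 * x₁ ^ 4 * (A - F (x₀ / x₁)) < d) :
    ∃ a, x₁ < a ∧ d = apexGap x₀ x₁ a := by
  have h1 : 0 < x₁ := h0.trans_le h01
  have hA := A_pos
  have hF : F (x₀ / x₁) ≤ A :=
    strictMonoOn_F.monotoneOn (div_mem h0 h01) ⟨zero_le_one, le_rfl⟩ (div_mem h0 h01).2
  have hd : 0 ≤ d := le_trans (mul_nonneg (by positivity) (by linarith)) hlt.le
  set b := x₁ + 1 + d / (4 * A) + x₀ ^ 4 + x₁ ^ 4 with hb
  have hb1 : x₁ ≤ b := by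
    have : 0 ≤ d / (4 * A) + x₀ ^ 4 + x₁ ^ 4 := by positivity
    linarith
  have hb2 : d ≤ apexGap x₀ x₁ b := by
    refine le_trans ?_ (le_apexGap h0 h01 hb1)
    have hq : 0 ≤ d / (4 * A) := by positivity
    have p0 : 0 < x₀ ^ 4 := by positivity
    have p1 : 0 < x₁ ^ 4 := by positivity
    have h2 : b ≤ b ^ 4 := le_self_pow₀ (by linarith) (by norm_num)
    have h3 : d = 4 * A * (d / (4 * A)) := by field_simp
    nlinarith [mul_le_mul_of_nonneg_left h2 hA.le, mul_pos hA p0, mul_pos hA p1, mul_pos hA h1]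
  have hcont : ContinuousOn (apexGap x₀ x₁) (Icc x₁ b) := by
    have hm : ∀ x, 0 < x → x ≤ x₁ → ContinuousOn (fun a => F (x / a)) (Icc x₁ b) :=
      fun x hx hx1 => continuousOn_F.comp
        (continuousOn_const.div continuousOn_id fun a ha => (h1.trans_le ha.1).ne')
        fun a ha => div_mem hx (hx1.trans ha.1)
    unfold apexGap
    exact ContinuousOn.mul (by fun_prop) ((continuousOn_const.sub (hm x₀ h0 h01)).sub
      (hm x₁ h1 le_rfl))
  obtain ⟨a, ha, had⟩ := intermediate_value_Icc hb1 hcont ⟨(apexGap_self h1 ▸ hlt).le, hb2⟩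
  refine ⟨a, lt_of_le_of_ne ha.1 ?_, had.symm⟩
  rintro rfl
  rw [apexGap_self h1] at had
  exact hlt.ne had

end
end H2Curves

namespace H2Curves

open scoped Topology
open MeasureTheory

noncomputable section

/-! ### The angle of a geodesic -/

/-- The open interval of angles. -/
abbrev angles : Set ℝ := Ioo (-(Real.pi / 2)) (Real.pi / 2)

/-- `cos^{1/3}`. -/
def crt (ψ : ℝ) : ℝ := Real.cos ψ ^ (1 / 3 : ℝ)

lemma continuous_crt : Continuous crt :=
  Real.continuous_cos.rpow_const fun _ => Or.inr (by norm_num)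

lemma crt_pos {ψ : ℝ} (h : ψ ∈ angles) : 0 < crt ψ := Real.rpow_pos_of_pos (Real.cos_pos_of_mem_Ioo h) _

lemma crt_pow_three {ψ : ℝ} (h : ψ ∈ angles) : crt ψ ^ 3 = Real.cos ψ := by
  rw [crt, ← Real.rpow_natCast, ← Real.rpow_mul (Real.cos_pos_of_mem_Ioo h).le]
  norm_num

lemma crt_le_one {ψ : ℝ} (h : ψ ∈ angles) : crt ψ ≤ 1 :=
  Real.rpow_le_one (Real.cos_pos_of_mem_Ioo h).le (Real.cos_le_one ψ) (by norm_num)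

@[simp] lemma crt_neg (ψ : ℝ) : crt (-ψ) = crt ψ := by simp [crt]

@[simp] lemma crt_zero : crt 0 = 1 := by simp [crt]

lemma hasDerivAt_crt {ψ : ℝ} (h : ψ ∈ angles) :
    HasDerivAt crt (-Real.sin ψ / (3 * crt ψ ^ 2)) ψ := by
  have hc := Real.cos_pos_of_mem_Ioo h
  have h1 := (Real.hasDerivAt_cos ψ).rpow_const (p := 1 / 3) (Or.inl hc.ne')
  refine h1.congr_deriv ?_
  have e : Real.cos ψ ^ (1 / 3 - 1 : ℝ) = (crt ψ ^ 2)⁻¹ := by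
    rw [crt, ← Real.rpow_natCast, ← Real.rpow_mul hc.le, ← Real.rpow_neg hc.le]
    norm_num
  rw [e]
  field_simp

lemma abs_lt_of_crt_lt {ψ φ : ℝ} (hψ : ψ ∈ angles) (hφ : φ ∈ angles) (h : crt ψ < crt φ) :
    |φ| < |ψ| := by
  by_contra! hle
  have h1 : Real.cos ψ < Real.cos φ := by
    rw [← crt_pow_three hψ, ← crt_pow_three hφ]
    exact pow_lt_pow_left₀ h (crt_pos hψ).le (by norm_num)
  rw [← Real.cos_abs ψ, ← Real.cos_abs φ] at h1
  refine h1.not_ge (Real.cos_le_cos_of_nonneg_of_le_pi (abs_nonneg _) ?_ hle)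
  have := abs_lt.2 hφ
  linarith [Real.pi_pos]

lemma abs_le_of_crt_le {ψ φ : ℝ} (hψ : ψ ∈ angles) (hφ : φ ∈ angles) (h : crt ψ ≤ crt φ) :
    |φ| ≤ |ψ| := by
  rcases h.lt_or_eq with h | h
  · exact (abs_lt_of_crt_lt hψ hφ h).le
  · have h1 : Real.cos ψ = Real.cos φ := by rw [← crt_pow_three hψ, ← crt_pow_three hφ, h]
    rw [← Real.cos_abs ψ, ← Real.cos_abs φ] at h1
    have a1 := abs_lt.2 hφ
    have a2 := abs_lt.2 hψ
    exact (Real.injOn_cos ⟨abs_nonneg _, by linarith [Real.pi_pos]⟩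
      ⟨abs_nonneg _, by linarith [Real.pi_pos]⟩ h1).ge

lemma exists_crt_eq {u : ℝ} (h0 : 0 < u) (h1 : u ≤ 1) :
    ∃ ψ ∈ angles, 0 ≤ ψ ∧ crt ψ = u := by
  refine ⟨Real.arccos (u ^ 3), ⟨?_, ?_⟩, Real.arccos_nonneg _, ?_⟩
  · linarith [Real.arccos_nonneg (u ^ 3), Real.pi_pos]
  · rw [Real.arccos_lt_pi_div_two]; positivity
  · have : u ^ 3 ≤ 1 := pow_le_one₀ h0.le h1
    have h3 : 0 < u ^ 3 := by positivity
    rw [crt, Real.cos_arccos (by linarith) this, ← Real.rpow_natCast, ← Real.rpow_mul h0.le]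
    norm_num

/-- `∫₀^ψ cos^{4/3} / 3`. -/
def angleGap (ψ : ℝ) : ℝ := ∫ φ in (0 : ℝ)..ψ, crt φ ^ 4 / 3

lemma hasDerivAt_angleGap (ψ : ℝ) : HasDerivAt angleGap (crt ψ ^ 4 / 3) ψ :=
  (((continuous_crt.pow 4).div_const 3).integral_hasStrictDerivAt 0 ψ).hasDerivAt

@[simp] lemma angleGap_zero : angleGap 0 = 0 := by simp [angleGap]

@[simp] lemma angleGap_neg (ψ : ℝ) : angleGap (-ψ) = -angleGap ψ := by
  have := intervalIntegral.integral_comp_neg (a := 0) (b := ψ) fun φ => crt φ ^ 4 / 3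
  simp only [crt_neg, neg_zero] at this
  rw [angleGap, angleGap, intervalIntegral.integral_symm, this]

lemma F_crt {ψ : ℝ} (h : ψ ∈ angles) (h0 : 0 ≤ ψ) : F (crt ψ) = A - angleGap ψ := by
  rcases h0.eq_or_lt with rfl | h0
  · simp [A]
  have hm : ∀ φ ∈ Icc 0 ψ, φ ∈ angles := fun φ hφ =>
    ⟨by linarith [hφ.1, Real.pi_pos], hφ.2.trans_lt h.2⟩
  have hc : ContinuousOn (fun φ => F (crt φ) + angleGap φ) (Icc 0 ψ) :=
    (continuousOn_F.comp continuous_crt.continuousOn fun φ hφ =>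
      ⟨(crt_pos (hm φ hφ)).le, crt_le_one (hm φ hφ)⟩).add
      fun φ _ => (hasDerivAt_angleGap φ).continuousAt.continuousWithinAt
  have hd : ∀ φ ∈ Ioo 0 ψ, HasDerivAt (fun φ => F (crt φ) + angleGap φ) 0 φ := fun φ hφ => by
    have hφ' := hm φ (Ioo_subset_Icc_self hφ)
    have hp := crt_pos hφ'
    have hs : 0 < Real.sin φ := Real.sin_pos_of_pos_of_lt_pi hφ.1 (by linarith [hφ'.2, Real.pi_pos])
    have h6 : 1 - crt φ ^ 6 = Real.sin φ ^ 2 := by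
      rw [show crt φ ^ 6 = (crt φ ^ 3) ^ 2 by ring, crt_pow_three hφ']
      linarith [Real.sin_sq_add_cos_sq φ]
    have h1 : crt φ < 1 := by
      by_contra! hge
      have : 1 ≤ crt φ ^ 6 := one_le_pow₀ hge
      nlinarith
    refine ((hasDerivAt_F hp.le h1).comp φ (hasDerivAt_crt hφ')).add (hasDerivAt_angleGap φ)
      |>.congr_deriv ?_
    rw [fIntegrand, h6, Real.sqrt_sq hs.le]
    field_simp
    ring
  obtain ⟨φ, -, hφ⟩ := exists_hasDerivAt_eq_slope _ _ h0 hc hd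
  rw [eq_comm, div_eq_zero_iff] at hφ
  have := hφ.resolve_right (by linarith)
  simp only [crt_zero, angleGap_zero] at this
  rw [A]; linarith

lemma angleGap_of_nonneg {ψ : ℝ} (h : ψ ∈ angles) (h0 : 0 ≤ ψ) : angleGap ψ = A - F (crt ψ) := by
  rw [F_crt h h0]; ring

lemma angleGap_of_nonpos {ψ : ℝ} (h : ψ ∈ angles) (h0 : ψ ≤ 0) :
    angleGap ψ = -(A - F (crt ψ)) := by
  have := angleGap_of_nonneg (ψ := -ψ) ⟨by linarith [h.2], by linarith [h.1]⟩ (by linarith)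
  rw [angleGap_neg, crt_neg] at this
  linarith

/-- `ψ₀ < ψ₁` are the angles at the ends of an arc of the geodesic with apex `a`, which joins points
with first coordinates `x₀`, `x₁`, and along which `y` increases by `d`. -/
structure IsArc (x₀ x₁ d a ψ₀ ψ₁ : ℝ) : Prop where
  pos : 0 < a
  mem₀ : ψ₀ ∈ angles
  mem₁ : ψ₁ ∈ angles
  lt : ψ₀ < ψ₁
  eq₀ : x₀ = a * crt ψ₀
  eq₁ : x₁ = a * crt ψ₁
  gap : d = 2 * a ^ 4 * (angleGap ψ₁ - angleGap ψ₀)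

namespace IsArc

variable {x₀ x₁ d a ψ₀ ψ₁ : ℝ}

lemma pos₀ (h : IsArc x₀ x₁ d a ψ₀ ψ₁) : 0 < x₀ := by
  rw [h.eq₀]; exact mul_pos h.pos (crt_pos h.mem₀)

lemma pos₁ (h : IsArc x₀ x₁ d a ψ₀ ψ₁) : 0 < x₁ := by
  rw [h.eq₁]; exact mul_pos h.pos (crt_pos h.mem₁)

lemma neg₀ (h : IsArc x₀ x₁ d a ψ₀ ψ₁) (h01 : x₀ ≤ x₁) : ψ₀ < 0 := by
  have h1 : crt ψ₀ ≤ crt ψ₁ := by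
    rw [h.eq₀, h.eq₁] at h01
    exact le_of_mul_le_mul_left h01 h.pos
  have h2 := abs_le_of_crt_le h.mem₀ h.mem₁ h1
  by_contra! h3
  rw [abs_of_nonneg h3, abs_of_nonneg (h3.trans h.lt.le)] at h2
  linarith [h.lt]

lemma crt₀ (h : IsArc x₀ x₁ d a ψ₀ ψ₁) : crt ψ₀ = x₀ / a := by
  rw [h.eq₀, mul_div_cancel_left₀ _ h.pos.ne']

lemma crt₁ (h : IsArc x₀ x₁ d a ψ₀ ψ₁) : crt ψ₁ = x₁ / a := by
  rw [h.eq₁, mul_div_cancel_left₀ _ h.pos.ne']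

lemma x₁_le (h : IsArc x₀ x₁ d a ψ₀ ψ₁) : x₁ ≤ a := by
  rw [h.eq₁]; exact mul_le_of_le_one_right h.pos.le (crt_le_one h.mem₁)

lemma branch (h : IsArc x₀ x₁ d a ψ₀ ψ₁) (h01 : x₀ ≤ x₁) (hψ : ψ₁ ≤ 0) :
    x₀ < x₁ ∧ 1 / a ∈ Ioc 0 (1 / x₁) ∧ d = branchGap x₀ x₁ (1 / a) := by
  have ha := h.pos
  refine ⟨lt_of_le_of_ne h01 fun he => ?_, ⟨by positivity, one_div_le_one_div_of_le h.pos₁ h.x₁_le⟩,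
    ?_⟩
  · have h2 := abs_le_of_crt_le h.mem₁ h.mem₀ (by rw [h.crt₀, h.crt₁, he])
    rw [abs_of_nonpos hψ, abs_of_neg (h.neg₀ h01)] at h2
    linarith [h.lt]
  · rw [h.gap, angleGap_of_nonpos h.mem₁ hψ, angleGap_of_nonpos h.mem₀ (h.neg₀ h01).le, branchGap,
      h.crt₀, h.crt₁]
    field_simp
    ring_nf

lemma apex (h : IsArc x₀ x₁ d a ψ₀ ψ₁) (h01 : x₀ ≤ x₁) (hψ : 0 < ψ₁) :
    x₁ < a ∧ d = apexGap x₀ x₁ a := by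
  refine ⟨lt_of_le_of_ne h.x₁_le fun he => ?_, ?_⟩
  · have h2 := abs_le_of_crt_le (φ := ψ₁) (ψ := 0) ⟨by linarith [Real.pi_pos], by linarith [Real.pi_pos]⟩
      h.mem₁ (by rw [h.crt₁, he, div_self h.pos.ne', crt_zero])
    rw [abs_zero] at h2
    exact hψ.ne' (abs_nonpos_iff.1 h2)
  · rw [h.gap, angleGap_of_nonneg h.mem₁ hψ.le, angleGap_of_nonpos h.mem₀ (h.neg₀ h01).le, apexGap,
      h.crt₀, h.crt₁]
    ring

lemma le_of_branch (h : IsArc x₀ x₁ d a ψ₀ ψ₁) (h01 : x₀ ≤ x₁) (hψ : ψ₁ ≤ 0) :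
    d ≤ 2 * x₁ ^ 4 * (A - F (x₀ / x₁)) := by
  obtain ⟨hlt, hC, rfl⟩ := h.branch h01 hψ
  have h1 := h.pos₁
  rw [← branchGap_inv h1]
  exact (strictMonoOn_branchGap h.pos₀ hlt).monotoneOn hC ⟨by positivity, le_rfl⟩ hC.2

lemma lt_of_apex (h : IsArc x₀ x₁ d a ψ₀ ψ₁) (h01 : x₀ ≤ x₁) (hψ : 0 < ψ₁) :
    2 * x₁ ^ 4 * (A - F (x₀ / x₁)) < d := by
  obtain ⟨hlt, rfl⟩ := h.apex h01 hψ
  rw [← apexGap_self h.pos₁]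
  exact strictMonoOn_apexGap h.pos₀ h01 (mem_Ici.2 le_rfl) hlt.le hlt

/-- The arc is determined by `x₀`, `x₁` and `d`. -/
lemma unique (h : IsArc x₀ x₁ d a ψ₀ ψ₁) (h01 : x₀ ≤ x₁) {a' ψ₀' ψ₁' : ℝ}
    (h' : IsArc x₀ x₁ d a' ψ₀' ψ₁') : a = a' ∧ ψ₀ = ψ₀' ∧ ψ₁ = ψ₁' := by
  have key : ∀ {φ φ' : ℝ}, φ ∈ angles → φ' ∈ angles → crt φ = crt φ' → |φ| = |φ'| :=
    fun hφ hφ' he => le_antisymm (abs_le_of_crt_le hφ' hφ he.ge) (abs_le_of_crt_le hφ hφ' he.le)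
  have fin : a = a' → (ψ₁ ≤ 0 ↔ ψ₁' ≤ 0) → a = a' ∧ ψ₀ = ψ₀' ∧ ψ₁ = ψ₁' := by
    rintro rfl hs
    have e0 := key h.mem₀ h'.mem₀ (by rw [h.crt₀, h'.crt₀])
    have e1 := key h.mem₁ h'.mem₁ (by rw [h.crt₁, h'.crt₁])
    rw [abs_of_neg (h.neg₀ h01), abs_of_neg (h'.neg₀ h01)] at e0
    refine ⟨rfl, by linarith, ?_⟩
    by_cases hψ : ψ₁ ≤ 0
    · rw [abs_of_nonpos hψ, abs_of_nonpos (hs.1 hψ)] at e1; linarith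
    · have hψ' : ¬ ψ₁' ≤ 0 := fun h => hψ (hs.2 h)
      push Not at hψ hψ'
      rwa [abs_of_pos hψ, abs_of_pos hψ'] at e1
  by_cases hψ : ψ₁ ≤ 0 <;> by_cases hψ' : ψ₁' ≤ 0
  · obtain ⟨hlt, hC, e⟩ := h.branch h01 hψ
    obtain ⟨-, hC', e'⟩ := h'.branch h01 hψ'
    refine fin ?_ (by tauto)
    have := (strictMonoOn_branchGap h.pos₀ hlt).injOn hC hC' (by rw [← e, ← e'])
    simpa using this
  · exact absurd (h.le_of_branch h01 hψ) (not_le.2 (h'.lt_of_apex h01 (not_le.1 hψ')))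
  · exact absurd (h'.le_of_branch h01 hψ') (not_le.2 (h.lt_of_apex h01 (not_le.1 hψ)))
  · obtain ⟨hlt, e⟩ := h.apex h01 (not_le.1 hψ)
    obtain ⟨hlt', e'⟩ := h'.apex h01 (not_le.1 hψ')
    refine fin ?_ (by tauto)
    exact (strictMonoOn_apexGap h.pos₀ h01).injOn hlt.le hlt'.le (by rw [← e, ← e'])

end IsArc

lemma exists_isArc {x₀ x₁ d : ℝ} (h0 : 0 < x₀) (h01 : x₀ ≤ x₁) (hd : 0 < d) :
    ∃ a ψ₀ ψ₁, IsArc x₀ x₁ d a ψ₀ ψ₁ := by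
  have h1 : 0 < x₁ := h0.trans_le h01
  have hneg : ∀ {φ : ℝ}, φ ∈ angles → -φ ∈ angles := fun h => ⟨by linarith [h.2], by linarith [h.1]⟩
  by_cases hle : d ≤ 2 * x₁ ^ 4 * (A - F (x₀ / x₁))
  · obtain ⟨C, hC, hC1, e⟩ := exists_branchGap h0 h01 hd hle
    have ha : x₁ ≤ 1 / C := by
      rw [le_div_iff₀ h1] at hC1
      rw [le_div_iff₀ hC]; linarith
    have ha0 : 0 < 1 / C := by positivity
    obtain ⟨φ₀, m₀, p₀, c₀⟩ := exists_crt_eq (u := x₀ / (1 / C)) (by positivity)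
      (div_mem h0 (h01.trans ha)).2
    obtain ⟨φ₁, m₁, p₁, c₁⟩ := exists_crt_eq (u := x₁ / (1 / C)) (by positivity) (div_mem h1 ha).2
    have gap : d = 2 * (1 / C) ^ 4 * (angleGap (-φ₁) - angleGap (-φ₀)) := by
      rw [angleGap_of_nonpos (hneg m₁) (by linarith), angleGap_of_nonpos (hneg m₀) (by linarith),
        crt_neg, crt_neg, c₀, c₁, e, branchGap]
      field_simp
      ring_nf
    refine ⟨1 / C, -φ₀, -φ₁, ha0, hneg m₀, hneg m₁, ?_, ?_, ?_, gap⟩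
    · have h3 := abs_le_of_crt_le m₀ m₁ (by rw [c₀, c₁]; gcongr)
      rw [abs_of_nonneg p₀, abs_of_nonneg p₁] at h3
      refine lt_of_le_of_ne (by linarith) fun he => ?_
      rw [he, sub_self, mul_zero] at gap
      exact hd.ne' gap
    · rw [crt_neg, c₀]; field_simp
    · rw [crt_neg, c₁]; field_simp
  · obtain ⟨a, ha, e⟩ := exists_apexGap h0 h01 (not_le.1 hle)
    have ha0 : 0 < a := h1.trans ha
    obtain ⟨φ₀, m₀, p₀, c₀⟩ := exists_crt_eq (u := x₀ / a) (by positivity)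
      (div_mem h0 (h01.trans ha.le)).2
    obtain ⟨φ₁, m₁, p₁, c₁⟩ := exists_crt_eq (u := x₁ / a) (by positivity) (div_mem h1 ha.le).2
    have p₁' : 0 < φ₁ := by
      refine lt_of_le_of_ne p₁ ?_
      rintro rfl
      rw [crt_zero, eq_div_iff ha0.ne', one_mul] at c₁
      exact ha.ne' c₁
    refine ⟨a, -φ₀, φ₁, ha0, hneg m₀, m₁, by linarith, ?_, ?_, ?_⟩
    · rw [crt_neg, c₀]; field_simp
    · rw [c₁]; field_simp
    · rw [angleGap_of_nonneg m₁ p₁, angleGap_of_nonpos (hneg m₀) (by linarith),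
        crt_neg, c₀, c₁, e, apexGap]
      ring

end
end H2Curves

namespace H2Curves

open scoped Topology
open MeasureTheory

noncomputable section

/-! ### The boundary value problem in the half plane -/

lemma strictMonoOn_T_of_hasDerivWithinAt {f f' : ℝ → ℝ}
    (hf : ∀ t ∈ T, HasDerivWithinAt f (f' t) T t) (hpos : ∀ t ∈ T, 0 < f' t) : StrictMonoOn f T := by
  refine strictMonoOn_of_deriv_pos (convex_Icc 0 1) (fun t ht => (hf t ht).continuousWithinAt)
    fun t ht => ?_
  have h1 : T ∈ 𝓝 t := mem_interior_iff_mem_nhds.1 ht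
  rw [((hf t (interior_subset ht)).hasDerivAt h1).deriv]
  exact hpos t (interior_subset ht)

namespace IsSol

variable {x z y : ℝ → ℝ} {k : ℝ}

lemma strictMonoOn_y (h : IsSol x z y k) (hk : 0 < k) : StrictMonoOn y T :=
  strictMonoOn_T_of_hasDerivWithinAt h.dy fun t ht => by
    have := h.pos t ht
    positivity

/-- The angle of the velocity of the geodesic. -/
def angle (x z : ℝ → ℝ) (k t : ℝ) : ℝ := Real.arctan (-z t / (k * x t ^ 3))

lemma angle_mem (x z : ℝ → ℝ) (k t : ℝ) : angle x z k t ∈ angles :=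
  ⟨Real.neg_pi_div_two_lt_arctan _, Real.arctan_lt_pi_div_two _⟩

lemma hasDerivWithinAt_angle (h : IsSol x z y k) (hk : 0 < k) {t : ℝ} (ht : t ∈ T) :
    HasDerivWithinAt (angle x z k) (3 * k * x t ^ 2) T t := by
  have hx := h.pos t ht
  have h1 := ((h.dz t ht).neg.div (((h.dx t ht).pow 3).const_mul k)
    (by positivity : k * x t ^ 3 ≠ 0)).arctan
  refine h1.congr_deriv ?_
  have : k ^ 2 * x t ^ 6 + z t ^ 2 ≠ 0 := by positivity
  simp
  field_simp

/-- The first coordinate of the apex of the geodesic. -/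
def apexOf (x z : ℝ → ℝ) (k : ℝ) : ℝ := x 0 / crt (angle x z k 0)

lemma apexOf_pos (h : IsSol x z y k) : 0 < apexOf x z k :=
  div_pos (h.pos 0 zero_mem_T) (crt_pos (angle_mem x z k 0))

lemma x_eq_crt (h : IsSol x z y k) (hk : 0 < k) {t : ℝ} (ht : t ∈ T) :
    x t = apexOf x z k * crt (angle x z k t) := by
  have e6 : ∀ t ∈ T, (x t / crt (angle x z k t)) ^ 6 = (z 0 ^ 2 + k ^ 2 * x 0 ^ 6) / k ^ 2 :=
    fun t ht => by
      have hx := h.pos t ht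
      rw [← h.energy_eq ht, div_pow, show crt (angle x z k t) ^ 6 = (crt (angle x z k t) ^ 3) ^ 2 by
        ring, crt_pow_three (angle_mem x z k t), angle, Real.cos_sq_arctan]
      field_simp
      ring
  have hc := crt_pos (angle_mem x z k t)
  rw [← div_eq_iff hc.ne']
  refine (pow_left_inj₀ (div_pos (h.pos t ht) hc).le h.apexOf_pos.le (by norm_num : 6 ≠ 0)).1 ?_
  rw [e6 t ht, apexOf, e6 0 zero_mem_T]

lemma y_eq_angleGap (h : IsSol x z y k) (hk : 0 < k) {t : ℝ} (ht : t ∈ T) :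
    y t = y 0 + 2 * apexOf x z k ^ 4
      * (angleGap (angle x z k t) - angleGap (angle x z k 0)) := by
  refine eqOn_T_of_hasDerivWithinAt (g := fun t => y 0 + 2 * apexOf x z k ^ 4
    * (angleGap (angle x z k t) - angleGap (angle x z k 0))) h.dy (fun t ht => ?_) (by simp) ht
  have h1 := (hasDerivAt_angleGap (angle x z k t)).comp_hasDerivWithinAt t
    (h.hasDerivWithinAt_angle hk ht)
  refine (((h1.sub_const _).const_mul _).const_add _).congr_deriv ?_
  rw [h.x_eq_crt hk ht]
  ring

lemma isArc (h : IsSol x z y k) (hk : 0 < k) :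
    IsArc (x 0) (x 1) (y 1 - y 0) (apexOf x z k) (angle x z k 0) (angle x z k 1) := by
  refine ⟨h.apexOf_pos, angle_mem _ _ _ _, angle_mem _ _ _ _, ?_, h.x_eq_crt hk zero_mem_T,
    h.x_eq_crt hk one_mem_T, ?_⟩
  · exact strictMonoOn_T_of_hasDerivWithinAt (fun t ht => h.hasDerivWithinAt_angle hk ht)
      (fun t ht => by have := h.pos t ht; positivity) zero_mem_T one_mem_T zero_lt_one
  · rw [h.y_eq_angleGap hk one_mem_T]; ring

lemma k_mul_sq (h : IsSol x z y k) (hk : 0 < k) :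
    k * apexOf x z k ^ 2 = ∫ φ in (angle x z k 0)..(angle x z k 1), 1 / (3 * crt φ ^ 2) := by
  have hsub : angle x z k '' T ⊆ angles := by rintro _ ⟨t, -, rfl⟩; exact angle_mem _ _ _ _
  have hg : ContinuousOn (fun φ => 1 / (3 * crt φ ^ 2)) angles :=
    continuousOn_const.div (continuous_const.mul (continuous_crt.pow 2)).continuousOn fun φ hφ => by
      have := crt_pos hφ; positivity
  have hx := h.continuousOn_x
  have h1 := intervalIntegral.integral_comp_mul_deriv'' (a := 0) (b := 1) (f := angle x z k)
    (f' := fun t => 3 * k * x t ^ 2) (g := fun φ => 1 / (3 * crt φ ^ 2))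
    (fun t ht => by
      rw [uIcc_of_le zero_le_one] at ht ⊢
      exact (h.hasDerivWithinAt_angle hk ht).continuousWithinAt)
    (fun t ht => by
      rw [min_eq_left zero_le_one, max_eq_right zero_le_one] at ht
      exact ((h.hasDerivWithinAt_angle hk (Ioo_subset_Icc_self ht)).hasDerivAt
        (Icc_mem_nhds ht.1 ht.2)).hasDerivWithinAt)
    (by rw [uIcc_of_le zero_le_one]; fun_prop)
    (by rw [uIcc_of_le zero_le_one]; exact hg.mono hsub)
  rw [← h1]
  have h2 : EqOn (fun t => ((fun φ => 1 / (3 * crt φ ^ 2)) ∘ angle x z k) t * (3 * k * x t ^ 2))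
      (fun _ => k * apexOf x z k ^ 2) (uIcc 0 1) := fun t ht => by
    rw [uIcc_of_le zero_le_one] at ht
    have := crt_pos (angle_mem x z k t)
    simp only [Function.comp]
    rw [h.x_eq_crt hk ht]
    field_simp
  rw [intervalIntegral.integral_congr h2]
  simp

lemma k_eq_zero_iff (h : IsSol x z y k) : k = 0 ↔ y 0 = y 1 := by
  constructor
  · rintro rfl
    exact (eqOn_T_of_hasDerivWithinAt (g := fun _ => y 0) h.dy (fun t ht => by
      simpa using hasDerivWithinAt_const t T (y 0)) rfl one_mem_T).symm
  · intro he
    rcases lt_trichotomy k 0 with hk | hk | hk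
    · have := h.reflect.strictMonoOn_y (by linarith) zero_mem_T one_mem_T zero_lt_one
      simp [he] at this
    · exact hk
    · exact absurd (h.strictMonoOn_y hk zero_mem_T one_mem_T zero_lt_one) (by simp [he])

lemma k_pos_iff (h : IsSol x z y k) : 0 < k ↔ y 0 < y 1 := by
  refine ⟨fun hk => h.strictMonoOn_y hk zero_mem_T one_mem_T zero_lt_one, fun hy => ?_⟩
  by_contra! hk
  rcases hk.lt_or_eq with hk | hk
  · have := h.reflect.strictMonoOn_y (by linarith) zero_mem_T one_mem_T zero_lt_one
    linarith
  · exact hy.ne (h.k_eq_zero_iff.1 hk)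

lemma linear (h : IsSol x z y 0) {t : ℝ} (ht : t ∈ T) : z t = z 0 ∧ x t = x 0 + z 0 * t ∧ y t = y 0 := by
  have hz : EqOn z (fun _ => z 0) T := eqOn_T_of_hasDerivWithinAt h.dz (fun t ht => by
      simpa using hasDerivWithinAt_const t T (z 0)) rfl
  refine ⟨hz ht, eqOn_T_of_hasDerivWithinAt (g := fun t => x 0 + z 0 * t) h.dx (fun t ht => ?_)
    (by simp) ht, eqOn_T_of_hasDerivWithinAt (g := fun _ => y 0) h.dy (fun t ht => by
      simpa using hasDerivWithinAt_const t T (y 0)) rfl ht⟩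
  rw [hz ht]
  simpa using (((hasDerivAt_id t).const_mul (z 0)).const_add (x 0)).hasDerivWithinAt

variable {x' z' y' : ℝ → ℝ} {k' : ℝ}

/-- A geodesic is determined by its end points. -/
lemma unique (h : IsSol x z y k) (h' : IsSol x' z' y' k') (hx0 : x 0 = x' 0) (hx1 : x 1 = x' 1)
    (hy0 : y 0 = y' 0) (hy1 : y 1 = y' 1) : k = k' ∧ z 0 = z' 0 := by
  have up : ∀ {x z y x' z' y' : ℝ → ℝ} {k k' : ℝ}, IsSol x z y k → IsSol x' z' y' k' → 0 < k →
      0 < k' → x 0 = x' 0 → x 1 = x' 1 → y 0 = y' 0 → y 1 = y' 1 → x 0 ≤ x 1 →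
      k = k' ∧ EqOn z z' T := by
    intro x z y x' z' y' k k' h h' hk hk' hx0 hx1 hy0 hy1 h01
    have a' := h'.isArc hk'
    rw [← hx0, ← hx1, ← hy0, ← hy1] at a'
    obtain ⟨e, e0, e1⟩ := (h.isArc hk).unique h01 a'
    have hkk : k = k' := by
      have i := h.k_mul_sq hk
      rw [e0, e1, ← h'.k_mul_sq hk', e] at i
      exact mul_right_cancel₀ (pow_ne_zero 2 h'.apexOf_pos.ne') i
    subst hkk
    refine ⟨rfl, (h.eqOn h' hx0 ?_ hy0).2.1⟩
    have := Real.arctan_injective e0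
    have hx := h'.pos 0 zero_mem_T
    rw [hx0] at this
    field_simp at this
    linarith
  have pos : ∀ {x z y x' z' y' : ℝ → ℝ} {k k' : ℝ}, IsSol x z y k → IsSol x' z' y' k' → 0 < k →
      x 0 = x' 0 → x 1 = x' 1 → y 0 = y' 0 → y 1 = y' 1 → k = k' ∧ EqOn z z' T := by
    intro x z y x' z' y' k k' h h' hk hx0 hx1 hy0 hy1
    have hk' : 0 < k' := by rw [h'.k_pos_iff, ← hy0, ← hy1]; exact h.k_pos_iff.1 hk
    rcases le_total (x 0) (x 1) with h01 | h01
    · exact up h h' hk hk' hx0 hx1 hy0 hy1 h01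
    · obtain ⟨e, ez⟩ := up h.reverse.reflect h'.reverse.reflect (by simpa) (by simpa) (by simpa)
        (by simpa) (by simpa) (by simpa) (by simpa)
      refine ⟨by simpa using e, fun t ht => ?_⟩
      have := ez (x := 1 - t) ⟨by linarith [ht.2], by linarith [ht.1]⟩
      simpa using this
  rcases lt_trichotomy k 0 with hk | hk | hk
  · obtain ⟨e, ez⟩ := pos h.reflect h'.reflect (by linarith) hx0 hx1 (by simpa) (by simpa)
    exact ⟨by linarith, ez zero_mem_T⟩
  · have hk' : k' = 0 := by rw [h'.k_eq_zero_iff, ← hy0, ← hy1]; exact h.k_eq_zero_iff.1 hk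
    subst hk hk'
    have e := (h.linear one_mem_T).2.1
    have e' := (h'.linear one_mem_T).2.1
    exact ⟨rfl, by linarith⟩
  · obtain ⟨e, ez⟩ := pos h h' hk hx0 hx1 hy0 hy1
    exact ⟨e, ez zero_mem_T⟩

end IsSol

/-- A continuous function bounded below by a positive constant is the derivative of a bijection,
whose inverse is differentiable. -/
lemma exists_inverse_of_primitive {h : ℝ → ℝ} (hc : Continuous h) {m : ℝ} (hm : 0 < m)
    (hle : ∀ t, m ≤ h t) (p : ℝ) :
    ∃ ψ : ℝ → ℝ, ψ 0 = p ∧ (∀ q, ψ (∫ t in p..q, h t) = q) ∧ StrictMono ψ ∧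
      ∀ s, HasDerivAt ψ (h (ψ s))⁻¹ s := by
  set τ : ℝ → ℝ := fun q => ∫ t in p..q, h t with hτ
  have hd : ∀ q, HasDerivAt τ (h q) q := fun q => (hc.integral_hasStrictDerivAt p q).hasDerivAt
  have hcont : Continuous τ := continuous_iff_continuousAt.2 fun q => (hd q).continuousAt
  have hmono : StrictMono τ := strictMono_of_deriv_pos fun q => by
    rw [(hd q).deriv]; exact hm.trans_le (hle q)
  have hlin : Monotone fun q => τ q - m * q := by
    refine monotone_of_deriv_nonneg (fun q => ((hd q).sub ((hasDerivAt_id q).const_mul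
      m)).differentiableAt) fun q => ?_
    have e : deriv (fun q => τ q - m * q) q = h q - m * 1 :=
      ((hd q).sub ((hasDerivAt_id q).const_mul m)).deriv
    rw [e]
    linarith [hle q]
  have hsurj : Function.Surjective τ := by
    refine hcont.surjective ?_ ?_
    · refine Filter.tendsto_atTop_mono' _ (f₁ := fun q => τ p - m * p + m * q) ?_ ?_
      · filter_upwards [Filter.eventually_ge_atTop p] with q hq
        have := hlin hq
        simp only at this
        linarith
      · exact Filter.tendsto_atTop_add_const_left _ _ (Filter.tendsto_id.const_mul_atTop hm)
    · refine Filter.tendsto_atBot_mono' _ (f₁ := fun q => τ p - m * p + m * q) ?_ ?_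
      · filter_upwards [Filter.eventually_le_atBot p] with q hq
        have := hlin hq
        simp only at this
        linarith
      · exact Filter.tendsto_atBot_add_const_left _ _ (Filter.tendsto_id.const_mul_atBot hm)
  set e := hmono.orderIsoOfSurjective τ hsurj
  have he : ∀ q, e q = τ q := fun q => rfl
  refine ⟨e.symm, ?_, fun q => e.symm_apply_apply q, e.symm.strictMono, fun s => ?_⟩
  · rw [e.symm_apply_eq, he]; simp [hτ]
  · refine HasDerivAt.of_local_left_inverse e.symm.continuous.continuousAt (hd _)
      (hm.trans_le (hle _)).ne' (Filter.Eventually.of_forall fun r => ?_)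
    exact e.apply_symm_apply r

lemma IsArc.exists_isSol {x₀ x₁ d a ψ₀ ψ₁ : ℝ} (h : IsArc x₀ x₁ d a ψ₀ ψ₁) (y₀ : ℝ) :
    ∃ x z y k, IsSol x z y k ∧ x 0 = x₀ ∧ x 1 = x₁ ∧ y 0 = y₀ ∧ y 1 = y₀ + d := by
  have hm : ∀ φ ∈ Icc ψ₀ ψ₁, φ ∈ angles := fun φ hφ =>
    ⟨h.mem₀.1.trans_le hφ.1, hφ.2.trans_lt h.mem₁.2⟩
  obtain ⟨φm, hφm, hmin⟩ := isCompact_Icc.exists_isMinOn (nonempty_Icc.2 h.lt.le)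
    continuous_crt.continuousOn
  set m := crt φm with hmdef
  have hm0 : 0 < m := crt_pos (hm φm hφm)
  have hle : ∀ φ ∈ Icc ψ₀ ψ₁, m ≤ crt φ := fun φ hφ => hmin hφ
  set g : ℝ → ℝ := fun φ => 1 / (3 * max m (min 1 (crt φ)) ^ 2) with hg
  have hgc : Continuous g := by
    refine continuous_const.div (by have := continuous_crt; fun_prop) fun φ => ?_
    have : 0 < max m (min 1 (crt φ)) := lt_max_of_lt_left hm0
    positivity
  have hm1 : m ≤ 1 := crt_le_one (hm φm hφm)
  obtain ⟨ψ, hψ0, hψτ, hψm, hψd⟩ := exists_inverse_of_primitive hgc (m := 1 / 3) (by norm_num)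
    (fun φ => by
      have h0 : 0 < max m (min 1 (crt φ)) := lt_max_of_lt_left hm0
      have h1 : max m (min 1 (crt φ)) ≤ 1 := max_le hm1 (min_le_left _ _)
      simp only [hg]
      gcongr
      nlinarith) ψ₀
  set r := ∫ φ in ψ₀..ψ₁, g φ with hr
  have hr0 : 0 < r := by
    have := hψm.lt_iff_lt (a := 0) (b := r)
    rw [hψ0, hψτ] at this
    exact this.1 h.lt
  have ha := h.pos
  have hmem : ∀ t ∈ T, ψ (r * t) ∈ Icc ψ₀ ψ₁ := fun t ht => by
    have e1 : ψ r = ψ₁ := hψτ ψ₁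
    rw [← hψ0, ← e1]
    exact ⟨hψm.monotone (mul_nonneg hr0.le ht.1),
      hψm.monotone (mul_le_of_le_one_right hr0.le ht.2)⟩
  have hd : ∀ t ∈ T, HasDerivAt (fun t => ψ (r * t)) (3 * r * crt (ψ (r * t)) ^ 2) t := fun t ht => by
    have h1 := (hψd (r * t)).comp t ((hasDerivAt_id t).const_mul r)
    refine h1.congr_deriv ?_
    have hq := hmem t ht
    simp only [hg]
    rw [min_eq_right (crt_le_one (hm _ hq)), max_eq_right (hle _ hq)]
    have := crt_pos (hm _ hq)
    field_simp
  refine ⟨fun t => a * crt (ψ (r * t)), fun t => -(a * r * Real.sin (ψ (r * t))),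
    fun t => y₀ + 2 * a ^ 4 * (angleGap (ψ (r * t)) - angleGap ψ₀), r / a ^ 2,
    ⟨fun t ht => ?_, fun t ht => ?_, fun t ht => ?_, fun t ht => ?_⟩, ?_, ?_, ?_, ?_⟩
  · exact mul_pos ha (crt_pos (hm _ (hmem t ht)))
  · have hq := hm _ (hmem t ht)
    have := crt_pos hq
    refine ((((hasDerivAt_crt hq).comp t (hd t ht)).const_mul a).congr_deriv ?_).hasDerivWithinAt
    field_simp
  · have hq := hm _ (hmem t ht)
    have := crt_pos hq
    refine (((((Real.hasDerivAt_sin _).comp t (hd t ht)).const_mul (a * r)).neg).congr_deriv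
      ?_).hasDerivWithinAt
    rw [← crt_pow_three hq]
    field_simp
  · have hq := hm _ (hmem t ht)
    have := crt_pos hq
    refine ((((((hasDerivAt_angleGap _).comp t (hd t ht)).sub_const _).const_mul _).const_add
      _).congr_deriv ?_).hasDerivWithinAt
    field_simp
  · simp [hψ0, h.eq₀]
  · simp [hr, hψτ, h.eq₁]
  · simp [hψ0]
  · simp [hr, hψτ, h.gap]

/-- Any two points are joined by a geodesic. -/
lemma exists_isSol_joining {x₀ x₁ : ℝ} (h0 : 0 < x₀) (h1 : 0 < x₁) (y₀ y₁ : ℝ) :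
    ∃ x z y k, IsSol x z y k ∧ x 0 = x₀ ∧ x 1 = x₁ ∧ y 0 = y₀ ∧ y 1 = y₁ := by
  have up : ∀ x₀ x₁ y₀ y₁ : ℝ, 0 < x₀ → x₀ ≤ x₁ → y₀ < y₁ →
      ∃ x z y k, IsSol x z y k ∧ x 0 = x₀ ∧ x 1 = x₁ ∧ y 0 = y₀ ∧ y 1 = y₁ := by
    intro x₀ x₁ y₀ y₁ h0 h01 hy
    obtain ⟨a, ψ₀, ψ₁, h⟩ := exists_isArc h0 h01 (sub_pos.2 hy)
    simpa using h.exists_isSol y₀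
  have le : ∀ x₀ x₁ y₀ y₁ : ℝ, 0 < x₀ → x₀ ≤ x₁ →
      ∃ x z y k, IsSol x z y k ∧ x 0 = x₀ ∧ x 1 = x₁ ∧ y 0 = y₀ ∧ y 1 = y₁ := by
    intro x₀ x₁ y₀ y₁ h0 h01
    rcases lt_trichotomy y₀ y₁ with hy | rfl | hy
    · exact up x₀ x₁ y₀ y₁ h0 h01 hy
    · refine ⟨fun t => x₀ + (x₁ - x₀) * t, fun _ => x₁ - x₀, fun _ => y₀, 0,
        ⟨fun t ht => ?_, fun t _ => ?_, fun t _ => ?_, fun t _ => ?_⟩, by simp, by simp, rfl, rfl⟩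
      · nlinarith [ht.1, ht.2]
      · simpa using (((hasDerivAt_id t).const_mul (x₁ - x₀)).const_add x₀).hasDerivWithinAt
      · simpa using hasDerivWithinAt_const t T (x₁ - x₀)
      · simpa using hasDerivWithinAt_const t T y₀
    · obtain ⟨x, z, y, k, h, e⟩ := up x₀ x₁ (-y₀) (-y₁) h0 h01 (by linarith)
      exact ⟨x, z, _, _, h.reflect, e.1, e.2.1, by simp [e.2.2.1], by simp [e.2.2.2]⟩
  rcases le_total x₀ x₁ with h01 | h01
  · exact le x₀ x₁ y₀ y₁ h0 h01
  · obtain ⟨x, z, y, k, h, e⟩ := le x₁ x₀ y₁ y₀ h1 h01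
    exact ⟨_, _, _, _, h.reverse, by simp [e], by simp [e], by simp [e], by simp [e]⟩

end
end H2Curves

namespace H2Curves

open scoped Topology
open MeasureTheory

noncomputable section

/-! ### Jacobi fields and the smooth dependence of geodesics on their end points -/

/-- The linearized geodesic equations along the geodesic `(x, z, k)`, with `κ` the variation of
`k`. -/
structure IsJacobi (x z : ℝ → ℝ) (k : ℝ) (v ζ η : ℝ → ℝ) (κ : ℝ) : Prop where
  dv : ∀ t ∈ T, HasDerivWithinAt v (ζ t) T t
  dζ : ∀ t ∈ T, HasDerivWithinAt ζ (-(6 * k * κ * x t ^ 5 + 15 * k ^ 2 * x t ^ 4 * v t)) T t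
  dη : ∀ t ∈ T, HasDerivWithinAt η (2 * κ * x t ^ 6 + 12 * k * x t ^ 5 * v t) T t

namespace IsJacobi

variable {x z y : ℝ → ℝ} {k : ℝ} {v ζ η : ℝ → ℝ} {κ : ℝ}

/-- There are no conjugate points: the squared norm of a Jacobi field is convex. -/
lemma eq_zero (h : IsJacobi x z k v ζ η κ) (hs : IsSol x z y k) (hv0 : v 0 = 0) (hη0 : η 0 = 0)
    (hv1 : v 1 = 0) (hη1 : η 1 = 0) : ζ 0 = 0 ∧ κ = 0 := by
  have key : ConvexOn ℝ T fun t => 4 * v t ^ 2 + η t ^ 2 / x t ^ 6 := by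
    refine convexOn_of_hasDerivWithinAt2_nonneg (convex_Icc 0 1)
      (f' := fun t => 8 * v t * ζ t + 2 * η t * (2 * κ + 12 * k * v t / x t)
        - 6 * z t * η t ^ 2 / x t ^ 7)
      (f'' := fun t => 8 * (ζ t + 3 / 2 * k * η t / x t) ^ 2
        + 2 * (2 * κ * x t ^ 6 + 6 * k * x t ^ 5 * v t - 3 * z t * η t / x t) ^ 2 / x t ^ 6
        + 24 * (z t * η t - 2 * k * x t ^ 6 * v t) ^ 2 / x t ^ 8) ?_ ?_ ?_ ?_
    · intro t ht
      exact ((((h.dv t ht).pow 2).const_mul 4).add (((h.dη t ht).pow 2).div ((hs.dx t ht).pow 6)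
        (pow_ne_zero 6 (hs.pos t ht).ne'))).continuousWithinAt
    · intro t ht
      have ht' := interior_subset ht
      have hx := (hs.pos t ht').ne'
      refine (((((h.dv t ht').pow 2).const_mul 4).add (((h.dη t ht').pow 2).div
        ((hs.dx t ht').pow 6) (pow_ne_zero 6 hx))).mono interior_subset).congr_deriv ?_
      simp
      field_simp
      ring
    · intro t ht
      have ht' := interior_subset ht
      have hx := (hs.pos t ht').ne'
      refine ((((((h.dv t ht').const_mul 8).mul (h.dζ t ht')).add (((h.dη t ht').const_mul 2).mul
        ((((h.dv t ht').const_mul (12 * k)).div (hs.dx t ht') hx).const_add (2 * κ)))).sub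
        ((((hs.dz t ht').const_mul 6).mul ((h.dη t ht').pow 2)).div ((hs.dx t ht').pow 7)
          (pow_ne_zero 7 hx))).mono interior_subset).congr_deriv ?_
      simp
      field_simp
      ring
    · intro t ht
      have hx := hs.pos t (interior_subset ht)
      positivity
  have hz : ∀ t ∈ T, v t = 0 ∧ η t = 0 := fun t ht => by
    have h1 := key.2 zero_mem_T one_mem_T (show 0 ≤ 1 - t by linarith [ht.2]) ht.1 (by ring)
    simp only [smul_eq_mul, mul_zero, mul_one, zero_add, hv0, hη0, hv1, hη1, ne_eq,
      OfNat.ofNat_ne_zero, not_false_eq_true, zero_pow, zero_div] at h1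
    have hx := hs.pos t ht
    have h2 : 0 ≤ η t ^ 2 / x t ^ 6 := by positivity
    have h3 : v t ^ 2 = 0 := by nlinarith [sq_nonneg (v t)]
    have h4 : η t ^ 2 / x t ^ 6 = 0 := by nlinarith [sq_nonneg (v t)]
    refine ⟨pow_eq_zero_iff (two_ne_zero) |>.1 h3, ?_⟩
    rw [div_eq_zero_iff] at h4
    exact pow_eq_zero_iff (two_ne_zero) |>.1 (h4.resolve_right (by positivity))
  have u0 := uniqueDiffOn_T 0 zero_mem_T
  refine ⟨?_, ?_⟩
  · exact u0.eq_deriv _ (h.dv 0 zero_mem_T) ((hasDerivWithinAt_const _ _ (0 : ℝ)).congr_of_mem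
      (fun t ht => (hz t ht).1) zero_mem_T)
  · have := u0.eq_deriv _ (h.dη 0 zero_mem_T) ((hasDerivWithinAt_const _ _ (0 : ℝ)).congr_of_mem
      (fun t ht => (hz t ht).2) zero_mem_T)
    have hx := hs.pos 0 zero_mem_T
    rw [hv0, mul_zero, add_zero] at this
    have h6 : x 0 ^ 6 ≠ 0 := by positivity
    simpa [h6] using this

/-- The first variation of the energy. -/
lemma gauss (h : IsJacobi x z k v ζ η κ) (hs : IsSol x z y k) (hv0 : v 0 = 0) (hη0 : η 0 = 0) :
    4 * z 1 * v 1 + 2 * k * η 1 = 4 * (z 0 * ζ 0 + k * κ * x 0 ^ 6) := by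
  have hc : EqOn (fun t => z t * ζ t + k * κ * x t ^ 6 + 3 * k ^ 2 * x t ^ 5 * v t)
      (fun _ => z 0 * ζ 0 + k * κ * x 0 ^ 6 + 3 * k ^ 2 * x 0 ^ 5 * v 0) T := by
    refine eqOn_T_of_hasDerivWithinAt (f' := fun _ => 0) (fun t ht => ?_)
      (fun t _ => hasDerivWithinAt_const _ _ _) rfl
    refine ((((hs.dz t ht).mul (h.dζ t ht)).add (((hs.dx t ht).pow 6).const_mul (k * κ))).add
      ((((hs.dx t ht).pow 5).const_mul (3 * k ^ 2)).mul (h.dv t ht))).congr_deriv ?_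
    simp
    ring
  have := eqOn_T_of_hasDerivWithinAt (f := fun t => 4 * z t * v t + 2 * k * η t)
    (g := fun t => 4 * (z 0 * ζ 0 + k * κ * x 0 ^ 6) * t)
    (f' := fun _ => 4 * (z 0 * ζ 0 + k * κ * x 0 ^ 6)) (fun t ht => ?_)
    (fun t _ => ?_) (by simp [hv0, hη0]) one_mem_T
  · simpa using this
  · refine ((((hs.dz t ht).const_mul 4).mul (h.dv t ht)).add
      ((h.dη t ht).const_mul (2 * k))).congr_deriv ?_
    have := hc ht
    simp only [hv0, mul_zero, add_zero] at this
    rw [← this]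
    ring
  · simpa using ((hasDerivAt_id t).const_mul (4 * (z 0 * ζ 0 + k * κ * x 0 ^ 6))).hasDerivWithinAt

end IsJacobi

lemma differentiableAt_sol {P : ℝ × ℝ × ℝ} (h : P ∈ solDomain) : DifferentiableAt ℝ sol P :=
  (sol_smooth_aux h).2.differentiableAt (by simp)

lemma fderiv_endX {P : ℝ × ℝ × ℝ} (h : P ∈ solDomain) (P' : ℝ × ℝ × ℝ) :
    fderiv ℝ endX P P' = fderiv ℝ sol P P' ⟨1, one_mem_T⟩ := by
  have := ((ContinuousMap.evalCLM ℝ (⟨1, one_mem_T⟩ : T) : C(T, ℝ) →L[ℝ] ℝ).hasFDerivAt.comp P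
    (differentiableAt_sol h).hasFDerivAt).fderiv
  exact congrArg (fun L : ℝ × ℝ × ℝ →L[ℝ] ℝ => L P') this

lemma fderiv_endY {P : ℝ × ℝ × ℝ} (h : P ∈ solDomain) (P' : ℝ × ℝ × ℝ) :
    fderiv ℝ endY P P' = 2 * P'.2.2 * volterra (sol P ^ 6) ⟨1, one_mem_T⟩
      + 12 * P.2.2 * volterra (sol P ^ 5 * fderiv ℝ sol P P') ⟨1, one_mem_T⟩ := by
  have hl : HasDerivAt (fun s : ℝ => P + s • P') P' 0 := by
    simpa using ((hasDerivAt_id (0 : ℝ)).smul_const P').const_add P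
  have hs : HasDerivAt (fun s : ℝ => sol (P + s • P')) (fderiv ℝ sol P P') 0 :=
    (differentiableAt_sol h).hasFDerivAt.comp_hasDerivAt_of_eq 0 hl (by simp)
  let L : C(T, ℝ) →L[ℝ] ℝ := (ContinuousMap.evalCLM ℝ (⟨1, one_mem_T⟩ : T)) ∘L volterra
  have hk : HasDerivAt (fun s : ℝ => (P + s • P').2.2) P'.2.2 0 := hl.snd.snd
  have h1 := (hk.const_mul 2).mul
    ((L.hasFDerivAt (x := sol (P + (0 : ℝ) • P') ^ 6)).comp_hasDerivAt 0 (hs.pow 6))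
  have hd : DifferentiableAt ℝ endY P :=
    ((contDiffOn_endY P h).contDiffAt (isOpen_solDomain.mem_nhds h)).differentiableAt (by simp)
  have h2 : HasDerivAt (fun s : ℝ => endY (P + s • P')) (fderiv ℝ endY P P') 0 :=
    hd.hasFDerivAt.comp_hasDerivAt_of_eq 0 hl (by simp)
  have h3 := h2.unique h1
  rw [h3]
  have e : ((6 : ℕ) : C(T, ℝ)) * sol (P + (0 : ℝ) • P') ^ (6 - 1) * fderiv ℝ sol P P'
      = (6 : ℝ) • (sol P ^ 5 * fderiv ℝ sol P P') := by
    rw [zero_smul, add_zero]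
    ext t
    exact mul_assoc (6 : ℝ) _ _
  rw [e, map_smul]
  simp [L]
  ring

lemma exists_isJacobi {P : ℝ × ℝ × ℝ} (h : P ∈ solDomain) {x z : ℝ → ℝ}
    (hx : ∀ t : T, x t = sol P t) (P' : ℝ × ℝ × ℝ) :
    ∃ v ζ η, IsJacobi x z P.2.2 v ζ η P'.2.2 ∧ v 0 = P'.1 ∧ ζ 0 = P'.2.1 ∧ η 0 = 0 ∧
      v 1 = fderiv ℝ endX P P' ∧ η 1 = fderiv ℝ endY P P' := by
  set V := fderiv ℝ sol P P' with hV
  set f : C(T, ℝ) := (6 * P.2.2 * P'.2.2) • sol P ^ 5 + (15 * P.2.2 ^ 2) • (sol P ^ 4 * V) with hf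
  set v : ℝ → ℝ := fun t => P'.1 + P'.2.1 * t - ∫ s in (0 : ℝ)..t, iccExt (volterra f) s with hv
  have hvV : ∀ t : T, v t = V t := fun t => by
    conv_rhs => rw [hV, fderiv_sol h P', ← hV, ← hf]
    simp [hv, volterra_apply, coordT]
  have hxe : ∀ t (ht : t ∈ T), x t = sol P ⟨t, ht⟩ := fun t ht => hx ⟨t, ht⟩
  have hve : ∀ t (ht : t ∈ T), v t = V ⟨t, ht⟩ := fun t ht => hvV ⟨t, ht⟩
  refine ⟨v, fun t => P'.2.1 - ∫ s in (0 : ℝ)..t, iccExt f s,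
    fun t => 2 * P'.2.2 * (∫ s in (0 : ℝ)..t, iccExt (sol P ^ 6) s)
      + 12 * P.2.2 * ∫ s in (0 : ℝ)..t, iccExt (sol P ^ 5 * V) s,
    ⟨fun t ht => ?_, fun t ht => ?_, fun t ht => ?_⟩, by simp [hv], by simp, by simp, ?_, ?_⟩
  · have h1 := (((hasDerivAt_id t).const_mul P'.2.1).const_add P'.1).sub
      (hasDerivAt_integral_iccExt (volterra f) t)
    rw [iccExt_volterra _ ht, mul_one] at h1
    exact h1.hasDerivWithinAt
  · have h1 := (hasDerivAt_integral_iccExt f t).const_sub P'.2.1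
    rw [iccExt_of_mem _ ht] at h1
    refine h1.hasDerivWithinAt.congr_deriv ?_
    rw [hxe t ht, hve t ht]
    simp [hf]
    ring
  · have h1 := ((hasDerivAt_integral_iccExt (sol P ^ 6) t).const_mul (2 * P'.2.2)).add
      ((hasDerivAt_integral_iccExt (sol P ^ 5 * V) t).const_mul (12 * P.2.2))
    rw [iccExt_of_mem _ ht, iccExt_of_mem _ ht] at h1
    refine h1.hasDerivWithinAt.congr_deriv ?_
    rw [hxe t ht, hve t ht]
    simp
    ring
  · rw [fderiv_endX h, hve 1 one_mem_T]
  · rw [fderiv_endY h]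
    simp [volterra_apply, hV]

/-- The end points of the solutions. -/
def endMap (P : ℝ × ℝ × ℝ) : ℝ × ℝ × ℝ := (P.1, endX P, endY P)

lemma contDiffAt_endMap {P : ℝ × ℝ × ℝ} (h : P ∈ solDomain) : ContDiffAt ℝ ∞ endMap P :=
  have hn := isOpen_solDomain.mem_nhds h
  contDiffAt_fst.prodMk (((contDiffOn_endX P h).contDiffAt hn).prodMk
    ((contDiffOn_endY P h).contDiffAt hn))

lemma fderiv_endMap {P : ℝ × ℝ × ℝ} (h : P ∈ solDomain) (P' : ℝ × ℝ × ℝ) :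
    fderiv ℝ endMap P P' = (P'.1, fderiv ℝ endX P P', fderiv ℝ endY P P') := by
  have hn := isOpen_solDomain.mem_nhds h
  have hX := (((contDiffOn_endX P h).contDiffAt hn).differentiableAt (by simp)).hasFDerivAt
  have hY := (((contDiffOn_endY P h).contDiffAt hn).differentiableAt (by simp)).hasFDerivAt
  have := (hasFDerivAt_fst.prodMk (hX.prodMk hY)).fderiv
  exact congrArg (fun L : ℝ × ℝ × ℝ →L[ℝ] ℝ × ℝ × ℝ => L P') this

lemma injective_fderiv_endMap {P : ℝ × ℝ × ℝ} (h : P ∈ solDomain) :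
    Function.Injective (fderiv ℝ endMap P) := by
  refine (injective_iff_map_eq_zero _).2 fun P' h0 => ?_
  rw [fderiv_endMap h, Prod.mk_eq_zero, Prod.mk_eq_zero] at h0
  obtain ⟨x, z, y, hs, hx0, hz0, -, hx⟩ := exists_isSol h 0
  obtain ⟨v, ζ, η, hj, v0, ζ0, η0, v1, η1⟩ := exists_isJacobi (z := z) h hx P'
  have := hj.eq_zero hs (by rw [v0, h0.1]) η0 (by rw [v1, h0.2.1]) (by rw [η1, h0.2.2])
  exact Prod.ext h0.1 (Prod.ext (ζ0 ▸ this.1) this.2)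

lemma endMap_injOn : InjOn endMap solDomain := by
  intro P hP Q hQ he
  obtain ⟨x, z, y, hs, hx0, hz0, hy0, hx⟩ := exists_isSol hP 0
  obtain ⟨x', z', y', hs', hx0', hz0', hy0', hx'⟩ := exists_isSol hQ 0
  simp only [endMap, Prod.mk.injEq] at he
  have hP' : P = (x 0, z 0, P.2.2) := by rw [hx0, hz0]
  have hQ' : Q = (x' 0, z' 0, Q.2.2) := by rw [hx0', hz0']
  have eX : endX P = x 1 := by rw [hP']; exact hs.endX_eq
  have eX' : endX Q = x' 1 := by rw [hQ']; exact hs'.endX_eq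
  have eY : endY P = y 1 - y 0 := by rw [hP']; exact hs.endY_eq
  have eY' : endY Q = y' 1 - y' 0 := by rw [hQ']; exact hs'.endY_eq
  obtain ⟨hk, hz⟩ := hs.unique hs' (by rw [hx0, hx0', he.1]) (by rw [← eX, ← eX', he.2.1])
    (by rw [hy0, hy0']) (by linarith [he.2.2])
  rw [hP', hQ', hx0, hx0', he.1, hz, hk]

/-- The pairs of first coordinates, with arbitrary change of the second coordinate. -/
def endDomain : Set (ℝ × ℝ × ℝ) := {Q | 0 < Q.1 ∧ 0 < Q.2.1}

lemma isOpen_endDomain : IsOpen endDomain :=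
  (isOpen_lt continuous_const continuous_fst).inter
    (isOpen_lt continuous_const (continuous_fst.comp continuous_snd))

lemma exists_endMap_eq {Q : ℝ × ℝ × ℝ} (h : Q ∈ endDomain) : ∃ P ∈ solDomain, endMap P = Q := by
  obtain ⟨x, z, y, k, hs, hx0, hx1, hy0, hy1⟩ := exists_isSol_joining h.1 h.2 0 Q.2.2
  refine ⟨(x 0, z 0, k), hs.mem_solDomain, ?_⟩
  rw [endMap, hs.endX_eq, hs.endY_eq, hx0, hx1, hy0, hy1, sub_zero]

open Classical in
/-- The initial data of the geodesic with the given end points. -/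
def initData (Q : ℝ × ℝ × ℝ) : ℝ × ℝ × ℝ :=
  if h : Q ∈ endDomain then (exists_endMap_eq h).choose else 0

lemma initData_mem {Q : ℝ × ℝ × ℝ} (h : Q ∈ endDomain) : initData Q ∈ solDomain := by
  rw [initData, dif_pos h]; exact (exists_endMap_eq h).choose_spec.1

lemma endMap_initData {Q : ℝ × ℝ × ℝ} (h : Q ∈ endDomain) : endMap (initData Q) = Q := by
  rw [initData, dif_pos h]; exact (exists_endMap_eq h).choose_spec.2

lemma contDiffAt_initData {Q : ℝ × ℝ × ℝ} (h : Q ∈ endDomain) : ContDiffAt ℝ ∞ initData Q := by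
  set P := initData Q with hP
  have hPm : P ∈ solDomain := initData_mem h
  let e : (ℝ × ℝ × ℝ) ≃L[ℝ] (ℝ × ℝ × ℝ) := (LinearEquiv.ofInjectiveEndo
    (fderiv ℝ endMap P : (ℝ × ℝ × ℝ) →ₗ[ℝ] (ℝ × ℝ × ℝ))
    (injective_fderiv_endMap hPm)).toContinuousLinearEquiv
  have hd : HasFDerivAt endMap (e : (ℝ × ℝ × ℝ) →L[ℝ] (ℝ × ℝ × ℝ)) P :=
    ((contDiffAt_endMap hPm).differentiableAt (by simp)).hasFDerivAt.congr_fderiv (by ext1 <;> rfl)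
  set g := (contDiffAt_endMap hPm).localInverse hd (by simp) with hg
  have hgs : ContDiffAt ℝ ∞ g Q := by
    have := (contDiffAt_endMap hPm).to_localInverse hd (by simp)
    rwa [endMap_initData h] at this
  have hstrict : HasStrictFDerivAt endMap (e : (ℝ × ℝ × ℝ) →L[ℝ] (ℝ × ℝ × ℝ)) P :=
    (contDiffAt_endMap hPm).hasStrictFDerivAt' hd (by simp)
  have hgP : g Q = P := by
    rw [← endMap_initData h]; exact hstrict.localInverse_apply_image
  have hgr : ∀ᶠ R in 𝓝 Q, endMap (g R) = R := by
    rw [← endMap_initData h]; exact hstrict.eventually_right_inverse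
  have hgm : ∀ᶠ R in 𝓝 Q, g R ∈ solDomain :=
    hgs.continuousAt.eventually (isOpen_solDomain.mem_nhds (by rw [hgP]; exact hPm))
  refine hgs.congr_of_eventuallyEq ?_
  filter_upwards [hgr, hgm, isOpen_endDomain.mem_nhds h] with R h1 h2 h3
  exact endMap_injOn (initData_mem h3) h2 (by rw [endMap_initData h3, h1])

end
end H2Curves

namespace H2Curves

open scoped Topology
open MeasureTheory

noncomputable section

/-! ### Geodesics and the distance in the half plane -/

/-- The end points in the coordinates used for `initData`. -/
def endData (p q : Fin 2 → ℝ) : ℝ × ℝ × ℝ := (p 0, q 0, q 1 - p 1)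

lemma endData_mem {p q : Fin 2 → ℝ} (hp : p ∈ halfPlane) (hq : q ∈ halfPlane) :
    endData p q ∈ endDomain := ⟨hp, hq⟩

/-- The initial velocity in the first coordinate of the geodesic from `p` to `q`. -/
def initZ (p q : Fin 2 → ℝ) : ℝ := (initData (endData p q)).2.1

/-- Half the momentum of the geodesic from `p` to `q`. -/
def initK (p q : Fin 2 → ℝ) : ℝ := (initData (endData p q)).2.2

/-- The geodesic from `p` to `q`. -/
def geo (p q : Fin 2 → ℝ) (t : ℝ) : Fin 2 → ℝ :=
  ![endX (p 0, t * initZ p q, t * initK p q), p 1 + endY (p 0, t * initZ p q, t * initK p q)]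

/-- The square of the length of the geodesic from `p` to `q`. -/
def speedSq (p q : Fin 2 → ℝ) : ℝ := 4 * (initZ p q ^ 2 + initK p q ^ 2 * p 0 ^ 6)

lemma speedSq_nonneg {p : Fin 2 → ℝ} (q : Fin 2 → ℝ) : 0 ≤ speedSq p q := by
  unfold speedSq
  have : 0 ≤ p 0 ^ 6 := by positivity
  positivity

lemma initData_eq {p q : Fin 2 → ℝ} (hp : p ∈ halfPlane) (hq : q ∈ halfPlane) :
    initData (endData p q) = (p 0, initZ p q, initK p q) := by
  have := congrArg Prod.fst (endMap_initData (endData_mem hp hq))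
  exact Prod.ext this rfl

lemma exists_isSol_geo {p q : Fin 2 → ℝ} (hp : p ∈ halfPlane) (hq : q ∈ halfPlane) :
    ∃ x z y, IsSol x z y (initK p q) ∧ x 0 = p 0 ∧ z 0 = initZ p q ∧ y 0 = p 1 ∧ x 1 = q 0 ∧
      y 1 = q 1 ∧ (∀ t : T, x t = sol (p 0, initZ p q, initK p q) t) ∧
      ∀ t ∈ T, geo p q t = ![x t, y t] := by
  have hm := initData_mem (endData_mem hp hq)
  have he := endMap_initData (endData_mem hp hq)
  rw [initData_eq hp hq] at hm he
  obtain ⟨x, z, y, hs, hx0, hz0, hy0, hx⟩ := exists_isSol hm (p 1)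
  simp only at hs hx0 hz0
  simp only [endMap, endData, Prod.mk.injEq, true_and] at he
  have eX := hs.endX_eq
  have eY := hs.endY_eq
  rw [hx0, hz0, he.1] at eX
  rw [hx0, hz0, he.2, hy0] at eY
  refine ⟨x, z, y, hs, hx0, hz0, hy0, eX.symm, by linarith, hx, fun t ht => ?_⟩
  have e1 := hs.x_eq_endX ht
  have e2 := hs.y_eq_endY ht
  rw [hx0, hz0] at e1 e2
  rw [geo, e1, e2, hy0]

lemma contDiffOn_geo {E : Type*} [NormedAddCommGroup E] [NormedSpace ℝ E] {S : Set E}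
    {f g : E → Fin 2 → ℝ} {τ : E → ℝ} (hf : ContDiffOn ℝ ∞ f S) (hg : ContDiffOn ℝ ∞ g S)
    (hτ : ContDiffOn ℝ ∞ τ S) (hfm : ∀ e ∈ S, f e ∈ halfPlane) (hgm : ∀ e ∈ S, g e ∈ halfPlane)
    (hτm : ∀ e ∈ S, τ e ∈ T) : ContDiffOn ℝ ∞ (fun e => geo (f e) (g e) (τ e)) S := by
  rw [contDiffOn_pi] at hf hg
  have h1 : ContDiffOn ℝ ∞ (fun e => initData (endData (f e) (g e))) S := by
    have : ContDiffOn ℝ ∞ (fun e => endData (f e) (g e)) S :=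
      (hf 0).prodMk ((hg 0).prodMk ((hg 1).sub (hf 1)))
    exact fun e he => ContDiffAt.comp_contDiffWithinAt (g := initData) e
      (contDiffAt_initData (endData_mem (hfm e he) (hgm e he))) (this e he)
  have h2 : ContDiffOn ℝ ∞
      (fun e => (f e 0, τ e * initZ (f e) (g e), τ e * initK (f e) (g e))) S :=
    (hf 0).prodMk ((hτ.mul (contDiff_fst.comp_contDiffOn (contDiff_snd.comp_contDiffOn h1))).prodMk
      (hτ.mul (contDiff_snd.comp_contDiffOn (contDiff_snd.comp_contDiffOn h1))))
  have h3 : MapsTo (fun e => (f e 0, τ e * initZ (f e) (g e), τ e * initK (f e) (g e))) S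
      solDomain := fun e he => by
    obtain ⟨x, z, y, hs, hx0, hz0, -⟩ := exists_isSol_geo (hfm e he) (hgm e he)
    have := hs.mem_solDomain_scale (hτm e he)
    rwa [hx0, hz0] at this
  exact contDiffOn_pi.2 (Fin.forall_fin_two.2 ⟨contDiffOn_endX.comp h2 h3,
    (hf 1).add (contDiffOn_endY.comp h2 h3)⟩)

lemma isPlaneGeodesic_geo {p q : Fin 2 → ℝ} (hp : p ∈ halfPlane) (hq : q ∈ halfPlane) :
    IsPlaneGeodesic (geo p q) ∧ geo p q 0 = p ∧ geo p q 1 = q := by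
  obtain ⟨x, z, y, hs, hx0, hz0, hy0, hx1, hy1, -, hgeo⟩ := exists_isSol_geo hp hq
  refine ⟨?_, ?_, ?_⟩
  · have h := hs.isPlaneGeodesic
    have hv : EqOn (velocity (geo p q)) (velocity fun t => ![x t, y t]) T := fun t ht =>
      derivWithin_congr hgeo (hgeo t ht)
    refine ⟨⟨h.smooth.congr hgeo, fun t ht => by rw [hgeo t ht]; exact h.mem t ht⟩, fun t ht k => ?_⟩
    rw [derivWithin_congr hv (hv ht), hv ht, hgeo t ht]
    exact h.geodesic_eq t ht k
  · rw [hgeo 0 zero_mem_T, hx0, hy0, vec_eta]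
  · rw [hgeo 1 one_mem_T, hx1, hy1, vec_eta]

/-- The geodesic between two points is unique. -/
lemma IsPlaneGeodesic.eqOn_geo {δ : ℝ → Fin 2 → ℝ} (h : IsPlaneGeodesic δ) :
    EqOn δ (geo (δ 0) (δ 1)) T := by
  have hp := h.mem 0 zero_mem_T
  have hq := h.mem 1 one_mem_T
  obtain ⟨x, z, y, hs, hx0, hz0, hy0, hx1, hy1, -, hgeo⟩ := exists_isSol_geo hp hq
  obtain ⟨z', k', hs'⟩ := h.exists_isSol
  obtain ⟨hk, hz⟩ := hs'.unique hs hx0.symm hx1.symm hy0.symm hy1.symm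
  subst hk
  obtain ⟨ex, -, ey⟩ := hs'.eqOn hs hx0.symm hz hy0.symm
  intro t ht
  rw [hgeo t ht, ← ex ht, ← ey ht, vec_eta]

lemma gInner_velocity_geo {p q : Fin 2 → ℝ} (hp : p ∈ halfPlane) (hq : q ∈ halfPlane) {t : ℝ}
    (ht : t ∈ T) : gInner (geo p q t) (velocity (geo p q) t) (velocity (geo p q) t)
      = speedSq p q := by
  obtain ⟨x, z, y, hs, hx0, hz0, hy0, hx1, hy1, -, hgeo⟩ := exists_isSol_geo hp hq
  have hv : velocity (geo p q) t = ![z t, 2 * initK p q * x t ^ 6] :=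
    (derivWithin_congr hgeo (hgeo t ht)).trans (hs.velocity_eq ht)
  have he := hs.energy_eq ht
  rw [hx0, hz0] at he
  have hx := (hs.pos t ht).ne'
  rw [gInner_self, hv, hgeo t ht, speedSq, ← he, zpow_neg]
  norm_cast
  simp
  field_simp
  ring

lemma planeLength_geo {p q : Fin 2 → ℝ} (hp : p ∈ halfPlane) (hq : q ∈ halfPlane) :
    planeLength (geo p q) = √(speedSq p q) := by
  rw [planeLength, intervalIntegral.integral_congr (g := fun _ => √(speedSq p q))]
  · simp
  · intro t ht
    rw [uIcc_of_le zero_le_one] at ht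
    simp only [gInner_velocity_geo hp hq ht]

lemma gInner_self_nonneg {p : Fin 2 → ℝ} (hp : p ∈ halfPlane) (h : Fin 2 → ℝ) :
    0 ≤ gInner p h h := by
  have : 0 < p 0 := hp
  rw [gInner_self]; positivity

/-- The derivative of the squared distance from `p` along a curve. -/
lemma exists_hasDerivWithinAt_speedSq {p : Fin 2 → ℝ} (hp : p ∈ halfPlane) {δ : ℝ → Fin 2 → ℝ}
    {δ' : Fin 2 → ℝ} {S : Set ℝ} {t : ℝ} (hδ : HasDerivWithinAt δ δ' S t) (hq : δ t ∈ halfPlane) :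
    ∃ D, HasDerivWithinAt (fun s => speedSq p (δ s)) D S t ∧
      D ≤ 2 * √(speedSq p (δ t)) * √(gInner (δ t) δ' δ') := by
  obtain ⟨x, z, y, hs, hx0, hz0, hy0, hx1, hy1, hx, hgeo⟩ := exists_isSol_geo hp hq
  have hQ := endData_mem hp hq
  have hm := initData_mem hQ
  have hd0 := hasDerivWithinAt_pi.1 hδ 0
  have hd1 := hasDerivWithinAt_pi.1 hδ 1
  have hE : HasDerivWithinAt (fun s => endData p (δ s)) (0, δ' 0, δ' 1) S t :=
    (hasDerivWithinAt_const _ _ _).prodMk (hd0.prodMk (hd1.sub_const _))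
  set L := fderiv ℝ initData (endData p (δ t))
  have hI : HasDerivWithinAt (fun s => initData (endData p (δ s))) (L (0, δ' 0, δ' 1)) S t :=
    HasFDerivAt.comp_hasDerivWithinAt (l := initData) t
      ((contDiffAt_initData hQ).differentiableAt (by simp)).hasFDerivAt hE
  set P' := L (0, δ' 0, δ' 1)
  have hZ : HasDerivWithinAt (fun s => initZ p (δ s)) P'.2.1 S t := hI.snd.fst
  have hK : HasDerivWithinAt (fun s => initK p (δ s)) P'.2.2 S t := hI.snd.snd
  have hend : fderiv ℝ endMap (initData (endData p (δ t))) P' = (0, δ' 0, δ' 1) := by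
    have h1 := ((contDiffAt_endMap hm).differentiableAt (by simp)).hasFDerivAt.comp _
      ((contDiffAt_initData hQ).differentiableAt (by simp)).hasFDerivAt
    have h2 : endMap ∘ initData =ᶠ[𝓝 (endData p (δ t))] id := by
      filter_upwards [isOpen_endDomain.mem_nhds hQ] with Q hQ using endMap_initData hQ
    have h3 := h1.unique ((hasFDerivAt_id _).congr_of_eventuallyEq h2)
    exact congrArg (fun M : ℝ × ℝ × ℝ →L[ℝ] ℝ × ℝ × ℝ => M (0, δ' 0, δ' 1)) h3
  rw [fderiv_endMap hm] at hend
  simp only [Prod.mk.injEq] at hend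
  rw [initData_eq hp hq] at hm hend
  obtain ⟨v, ζ, η, hj, v0, ζ0, η0, v1, η1⟩ := exists_isJacobi (z := z) hm hx P'
  have hg := hj.gauss hs (by rw [v0, hend.1]) η0
  rw [v1, η1, hend.2.1, hend.2.2, hz0, ζ0, hx0] at hg
  refine ⟨2 * (4 * z 1 * δ' 0 + 2 * initK p (δ t) * δ' 1), ?_, ?_⟩
  · refine (((hZ.pow 2).add ((hK.pow 2).mul_const (p 0 ^ 6))).const_mul 4).congr_deriv ?_
    rw [hg]
    simp
    ring
  · have he := hs.energy_eq one_mem_T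
    rw [hx0, hz0, hx1] at he
    have hq0 : 0 < δ t 0 := hq
    rw [mul_assoc 2 (√_), ← Real.sqrt_mul (speedSq_nonneg _)]
    refine mul_le_mul_of_nonneg_left (Real.le_sqrt_of_sq_le ?_) (by norm_num)
    rw [gInner_self, speedSq, ← he, zpow_neg]
    norm_cast
    set X := δ t 0
    set K := initK p (δ t)
    have e : 4 * (z 1 ^ 2 + K ^ 2 * X ^ 6) * (4 * δ' 0 ^ 2 + (X ^ 6)⁻¹ * δ' 1 ^ 2)
        - (4 * z 1 * δ' 0 + 2 * K * δ' 1) ^ 2 = (2 * z 1 * δ' 1 / X ^ 3 - 4 * K * X ^ 3 * δ' 0) ^ 2 := by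
      field_simp
      ring
    nlinarith [sq_nonneg (2 * z 1 * δ' 1 / X ^ 3 - 4 * K * X ^ 3 * δ' 0)]

lemma speedSq_self {p : Fin 2 → ℝ} (hp : p ∈ halfPlane) : speedSq p p = 0 := by
  obtain ⟨x, z, y, hs, hx0, hz0, hy0, hx1, hy1, -, -⟩ := exists_isSol_geo hp hp
  have hk : initK p p = 0 := hs.k_eq_zero_iff.2 (by rw [hy0, hy1])
  rw [hk] at hs
  have h1 := (hs.linear one_mem_T).2.1
  rw [hx0, hx1, hz0] at h1
  have hz : initZ p p = 0 := by linarith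
  simp [speedSq, hk, hz]

lemma IsPlanePath.hasDerivWithinAt {δ : ℝ → Fin 2 → ℝ} (h : IsPlanePath δ) {t : ℝ} (ht : t ∈ T) :
    HasDerivWithinAt δ (velocity δ t) T t :=
  (h.smooth.differentiableOn (by simp) t ht).hasDerivWithinAt

lemma IsPlanePath.continuousOn_gInner {δ : ℝ → Fin 2 → ℝ} (h : IsPlanePath δ) :
    ContinuousOn (fun t => gInner (δ t) (velocity δ t) (velocity δ t)) T := by
  have hv : ContinuousOn (velocity δ) T :=
    h.smooth.continuousOn_derivWithin uniqueDiffOn_T (by simp)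
  have hc := h.smooth.continuousOn
  rw [continuousOn_pi] at hv hc
  simp only [gInner_self]
  exact (continuousOn_const.mul ((hv 0).pow 2)).add
    (((hc 0).zpow₀ _ fun t ht => Or.inl (h.mem t ht).ne').mul ((hv 1).pow 2))

/-- Geodesics are minimizing. -/
lemma IsPlanePath.sqrt_speedSq_le {δ : ℝ → Fin 2 → ℝ} (h : IsPlanePath δ) :
    √(speedSq (δ 0) (δ 1)) ≤ planeLength δ := by
  have hp := h.mem 0 zero_mem_T
  choose! D hD hle using fun t (ht : t ∈ T) =>
    exists_hasDerivWithinAt_speedSq hp (h.hasDerivWithinAt ht) (h.mem t ht)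
  refine le_of_forall_pos_le_add fun ε hε => ?_
  have hpos : ∀ t, 0 < speedSq (δ 0) (δ t) + ε ^ 2 := fun t => by
    have := speedSq_nonneg (p := δ 0) (δ t)
    positivity
  have hd : ∀ t ∈ T, HasDerivWithinAt (fun s => √(speedSq (δ 0) (δ s) + ε ^ 2))
      (D t / (2 * √(speedSq (δ 0) (δ t) + ε ^ 2))) T t := fun t ht =>
    ((hD t ht).add_const _).sqrt (hpos t).ne'
  have key := intervalIntegral.sub_le_integral_of_hasDeriv_right_of_le zero_le_one
    (g := fun s => √(speedSq (δ 0) (δ s) + ε ^ 2))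
    (φ := fun t => √(gInner (δ t) (velocity δ t) (velocity δ t)))
    (fun t ht => (hd t ht).continuousWithinAt)
    (fun t ht => ((hd t (Ioo_subset_Icc_self ht)).hasDerivAt
      (Icc_mem_nhds ht.1 ht.2)).hasDerivWithinAt)
    (h.continuousOn_gInner.sqrt.integrableOn_Icc) (fun t ht => by
      have h1 := hle t (Ioo_subset_Icc_self ht)
      have h2 : √(speedSq (δ 0) (δ t)) ≤ √(speedSq (δ 0) (δ t) + ε ^ 2) :=
        Real.sqrt_le_sqrt (by nlinarith)
      have h3 := Real.sqrt_pos.2 (hpos t)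
      rw [div_le_iff₀ (by positivity)]
      refine h1.trans ?_
      rw [mul_comm (√(gInner _ _ _))]
      gcongr)
  rw [speedSq_self hp, zero_add, Real.sqrt_sq hε.le] at key
  have h4 : √(speedSq (δ 0) (δ 1)) ≤ √(speedSq (δ 0) (δ 1) + ε ^ 2) :=
    Real.sqrt_le_sqrt (by nlinarith)
  rw [planeLength]
  linarith

lemma isLeast_planeLength {p q : Fin 2 → ℝ} (hp : p ∈ halfPlane) (hq : q ∈ halfPlane) :
    IsLeast (planeLengths p q) (planeLength (geo p q)) := by
  obtain ⟨h, h0, h1⟩ := isPlaneGeodesic_geo hp hq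
  refine ⟨⟨geo p q, h.toIsPlanePath, h0, h1, rfl⟩, ?_⟩
  rintro _ ⟨δ, hδ, rfl, rfl, rfl⟩
  rw [planeLength_geo hp hq]
  exact hδ.sqrt_speedSq_le

lemma planeDist_eq {p q : Fin 2 → ℝ} (hp : p ∈ halfPlane) (hq : q ∈ halfPlane) :
    planeDist p q = √(speedSq p q) := by
  rw [planeDist, (isLeast_planeLength hp hq).csInf_eq, planeLength_geo hp hq]

end
end H2Curves

namespace H2Curves

open scoped Topology
open MeasureTheory

noncomputable section

/-! ### Trajectories of geodesics -/

lemma crt_le_crt {φ ψ : ℝ} (hφ : φ ∈ angles) (hψ : ψ ∈ angles) (h : |ψ| ≤ |φ|) :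
    crt φ ≤ crt ψ := by
  by_contra! hlt
  exact absurd (abs_lt_of_crt_lt hψ hφ hlt) (not_lt.2 h)

namespace IsSol

variable {x z y : ℝ → ℝ} {k : ℝ}

lemma monotoneOn_angle (h : IsSol x z y k) (hk : 0 < k) : MonotoneOn (angle x z k) T :=
  (strictMonoOn_T_of_hasDerivWithinAt (fun t ht => h.hasDerivWithinAt_angle hk ht)
    (fun t ht => by have := h.pos t ht; positivity)).monotoneOn

lemma continuousOn_angle (h : IsSol x z y k) (hk : 0 < k) : ContinuousOn (angle x z k) T :=
  fun _ ht => (h.hasDerivWithinAt_angle hk ht).continuousWithinAt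

lemma crt_angle (h : IsSol x z y k) (hk : 0 < k) {t : ℝ} (ht : t ∈ T) :
    crt (angle x z k t) = x t / apexOf x z k := by
  rw [h.x_eq_crt hk ht, mul_div_cancel_left₀ _ h.apexOf_pos.ne']

lemma angle_one_nonpos (h : IsSol x z y k) (hk : 0 < k) (h01 : x 0 ≤ x 1)
    (hle : y 1 - y 0 ≤ 2 * x 1 ^ 4 * (A - F (x 0 / x 1))) : angle x z k 1 ≤ 0 := by
  by_contra! hψ
  exact absurd ((h.isArc hk).lt_of_apex h01 hψ) (not_lt.2 hle)

lemma angle_one_pos (h : IsSol x z y k) (hk : 0 < k) (h01 : x 0 ≤ x 1)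
    (hlt : 2 * x 1 ^ 4 * (A - F (x 0 / x 1)) < y 1 - y 0) : 0 < angle x z k 1 := by
  by_contra! hψ
  exact absurd ((h.isArc hk).le_of_branch h01 hψ) (not_le.2 hlt)

lemma trajectory_branch (h : IsSol x z y k) (hk : 0 < k) (h01 : x 0 ≤ x 1) {C : ℝ} (hC : 0 < C)
    (hC1 : C ≤ 1 / x 1) (hd : y 1 - y 0 = branchGap (x 0) (x 1) C)
    (hle : y 1 - y 0 ≤ 2 * x 1 ^ 4 * (A - F (x 0 / x 1))) :
    (fun t => ![x t, y t]) '' T =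
      (fun u => ![u, y 0 + 2 / C ^ 4 * (F (C * u) - F (C * x 0))]) '' Icc (x 0) (x 1) := by
  have ha := h.isArc hk
  have hψ := h.angle_one_nonpos hk h01 hle
  obtain ⟨hlt, hCm, e⟩ := ha.branch h01 hψ
  have hCa : C = 1 / apexOf x z k := (strictMonoOn_branchGap ha.pos₀ hlt).injOn ⟨hC, hC1⟩ hCm
    (by rw [← hd, ← e])
  have hψt : ∀ t ∈ T, angle x z k 0 ≤ angle x z k t ∧ angle x z k t ≤ 0 ∧
      angle x z k t ≤ angle x z k 1 := fun t ht =>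
    ⟨h.monotoneOn_angle hk zero_mem_T ht ht.1, (h.monotoneOn_angle hk ht one_mem_T ht.2).trans hψ,
      h.monotoneOn_angle hk ht one_mem_T ht.2⟩
  have hap := h.apexOf_pos
  have hy : ∀ t ∈ T, y t = y 0 + 2 / C ^ 4 * (F (C * x t) - F (C * x 0)) := fun t ht => by
    rw [h.y_eq_angleGap hk ht, angleGap_of_nonpos (angle_mem _ _ _ _) (hψt t ht).2.1,
      angleGap_of_nonpos (angle_mem _ _ _ _) (ha.neg₀ h01).le, h.crt_angle hk ht,
      h.crt_angle hk zero_mem_T, hCa, one_div_mul_eq_div, one_div_mul_eq_div]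
    field_simp
    ring
  have hx : ∀ t ∈ T, x t ∈ Icc (x 0) (x 1) := fun t ht => by
    obtain ⟨h1, h2, h3⟩ := hψt t ht
    rw [h.x_eq_crt hk zero_mem_T, h.x_eq_crt hk ht, h.x_eq_crt hk one_mem_T]
    refine ⟨mul_le_mul_of_nonneg_left (crt_le_crt (angle_mem _ _ _ _) (angle_mem _ _ _ _) ?_) hap.le,
      mul_le_mul_of_nonneg_left (crt_le_crt (angle_mem _ _ _ _) (angle_mem _ _ _ _) ?_) hap.le⟩
    · rw [abs_of_nonpos h2, abs_of_nonpos (h1.trans h2)]; linarith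
    · rw [abs_of_nonpos h2, abs_of_nonpos hψ]; linarith
  ext p
  constructor
  · rintro ⟨t, ht, rfl⟩
    exact ⟨x t, hx t ht, by simp only [← hy t ht]⟩
  · rintro ⟨u, hu, rfl⟩
    obtain ⟨t, ht, rfl⟩ := intermediate_value_Icc zero_le_one h.continuousOn_x hu
    exact ⟨t, ht, by simp only [← hy t ht]⟩

lemma trajectory_apex (h : IsSol x z y k) (hk : 0 < k) (h01 : x 0 ≤ x 1) {a : ℝ} (hxa : x 1 < a)
    (hd : y 1 - y 0 = apexGap (x 0) (x 1) a)
    (hgt : 2 * x 1 ^ 4 * (A - F (x 0 / x 1)) < y 1 - y 0) :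
    (fun t => ![x t, y t]) '' T =
      (fun u => ![u, y 0 + 2 * a ^ 4 * (F (u / a) - F (x 0 / a))]) '' Icc (x 0) a ∪
      (fun u => ![u, y 1 - 2 * a ^ 4 * (F (u / a) - F (x 1 / a))]) '' Icc (x 1) a := by
  have harc := h.isArc hk
  have hψ := h.angle_one_pos hk h01 hgt
  obtain ⟨hlt, e⟩ := harc.apex h01 hψ
  have haa : a = apexOf x z k := (strictMonoOn_apexGap harc.pos₀ h01).injOn hxa.le hlt.le
    (by rw [← hd, ← e])
  have hψ0 := (harc.neg₀ h01).le
  have hap := h.apexOf_pos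
  have hmono := h.monotoneOn_angle hk
  rw [haa]
  have hy1 : y 1 = y 0 + 2 * apexOf x z k ^ 4 *
      (2 * A - F (x 0 / apexOf x z k) - F (x 1 / apexOf x z k)) := by
    unfold apexGap at e
    linarith
  have hyl : ∀ t ∈ T, angle x z k t ≤ 0 → y t = y 0 + 2 * apexOf x z k ^ 4 *
      (F (x t / apexOf x z k) - F (x 0 / apexOf x z k)) := fun t ht hneg => by
    rw [h.y_eq_angleGap hk ht, angleGap_of_nonpos (angle_mem _ _ _ _) hneg,
      angleGap_of_nonpos (angle_mem _ _ _ _) hψ0, h.crt_angle hk ht, h.crt_angle hk zero_mem_T]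
    ring
  have hyr : ∀ t ∈ T, 0 ≤ angle x z k t → y t = y 1 - 2 * apexOf x z k ^ 4 *
      (F (x t / apexOf x z k) - F (x 1 / apexOf x z k)) := fun t ht hpos => by
    rw [h.y_eq_angleGap hk ht, angleGap_of_nonneg (angle_mem _ _ _ _) hpos,
      angleGap_of_nonpos (angle_mem _ _ _ _) hψ0, h.crt_angle hk ht, h.crt_angle hk zero_mem_T, hy1]
    ring
  have hxle : ∀ t ∈ T, x t ≤ apexOf x z k := fun t ht => by
    rw [h.x_eq_crt hk ht]; exact mul_le_of_le_one_right hap.le (crt_le_one (angle_mem _ _ _ _))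
  have hle : ∀ s ∈ T, ∀ t ∈ T, |angle x z k t| ≤ |angle x z k s| → x s ≤ x t :=
    fun s hs t ht hst => by
      rw [h.x_eq_crt hk hs, h.x_eq_crt hk ht]
      exact mul_le_mul_of_nonneg_left (crt_le_crt (angle_mem _ _ _ _) (angle_mem _ _ _ _) hst) hap.le
  obtain ⟨t₀, ht₀, hz⟩ := intermediate_value_Icc zero_le_one (h.continuousOn_angle hk) ⟨hψ0, hψ.le⟩
  have hxt : x t₀ = apexOf x z k := by rw [h.x_eq_crt hk ht₀, hz, crt_zero, mul_one]
  ext p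
  constructor
  · rintro ⟨t, ht, rfl⟩
    rcases le_total (angle x z k t) 0 with hs | hs
    · refine Or.inl ⟨x t, ⟨hle 0 zero_mem_T t ht ?_, hxle t ht⟩, by simp only [← hyl t ht hs]⟩
      rw [abs_of_nonpos hs, abs_of_nonpos hψ0]
      linarith [hmono zero_mem_T ht ht.1]
    · refine Or.inr ⟨x t, ⟨hle 1 one_mem_T t ht ?_, hxle t ht⟩, by simp only [← hyr t ht hs]⟩
      rw [abs_of_nonneg hs, abs_of_pos hψ]
      exact hmono ht one_mem_T ht.2
  · rintro (⟨u, hu, rfl⟩ | ⟨u, hu, rfl⟩)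
    · have hsub : Icc 0 t₀ ⊆ T := Icc_subset_Icc le_rfl ht₀.2
      rw [← hxt] at hu
      obtain ⟨t, ht, rfl⟩ := intermediate_value_Icc ht₀.1 (h.continuousOn_x.mono hsub) hu
      refine ⟨t, hsub ht, ?_⟩
      have : angle x z k t ≤ 0 := hz ▸ hmono (hsub ht) ht₀ ht.2
      simp only [← hyl t (hsub ht) this]
    · have hsub : Icc t₀ 1 ⊆ T := Icc_subset_Icc ht₀.1 le_rfl
      rw [← hxt] at hu
      obtain ⟨t, ht, rfl⟩ := intermediate_value_Icc' ht₀.2 (h.continuousOn_x.mono hsub) hu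
      refine ⟨t, hsub ht, ?_⟩
      have : 0 ≤ angle x z k t := hz ▸ hmono ht₀ (hsub ht) ht.1
      simp only [← hyr t (hsub ht) this]

end IsSol

/-- The trajectory of a geodesic, traversed in either direction. -/
lemma IsPlaneGeodesic.exists_isSol_image {γ : ℝ → Fin 2 → ℝ} (h : IsPlaneGeodesic γ)
    {x₀ x₁ y₀ y₁ : ℝ} (he : (γ 0 = ![x₀, y₀] ∧ γ 1 = ![x₁, y₁]) ∨
      (γ 0 = ![x₁, y₁] ∧ γ 1 = ![x₀, y₀])) :
    ∃ x z y k, IsSol x z y k ∧ x 0 = x₀ ∧ x 1 = x₁ ∧ y 0 = y₀ ∧ y 1 = y₁ ∧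
      γ '' T = (fun t => ![x t, y t]) '' T := by
  obtain ⟨z, k, hs⟩ := h.exists_isSol
  rcases he with ⟨h0, h1⟩ | ⟨h0, h1⟩
  · exact ⟨_, z, _, k, hs, by simp [h0], by simp [h1], by simp [h0], by simp [h1],
      by simp only [vec_eta]⟩
  · refine ⟨_, _, _, _, hs.reverse, by simp [h1], by simp [h0], by simp [h1], by simp [h0], ?_⟩
    simp only [vec_eta]
    have e : (fun t : ℝ => 1 - t) '' T = T := by simp
    nth_rewrite 1 [← e]
    rw [image_image]

lemma image_reflect {x y : ℝ → ℝ} :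
    (fun t => ![x t, y t]) '' T
      = (fun p : Fin 2 → ℝ => ![p 0, -p 1]) '' ((fun t => ![x t, -y t]) '' T) := by
  rw [image_image]; simp

lemma trajectory_branch {x₀ x₁ y₀ y₁ : ℝ} (h01 : x₀ ≤ x₁) (hy : y₀ ≠ y₁)
    (hle : |y₁ - y₀| ≤ 2 * x₁ ^ 4 * (A - F (x₀ / x₁))) {C : ℝ} (hC : 0 < C) (hC1 : C ≤ 1 / x₁)
    (hd : |y₁ - y₀| = 2 / C ^ 4 * (F (C * x₁) - F (C * x₀))) {γ : ℝ → Fin 2 → ℝ}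
    (hγ : IsPlaneGeodesic γ) (he : (γ 0 = ![x₀, y₀] ∧ γ 1 = ![x₁, y₁]) ∨
      (γ 0 = ![x₁, y₁] ∧ γ 1 = ![x₀, y₀])) :
    γ '' T = (fun x => ![x, y₀ + Real.sign (y₁ - y₀) * (2 / C ^ 4 * (F (C * x) - F (C * x₀)))]) ''
      Icc x₀ x₁ := by
  obtain ⟨x, z, y, k, hs, rfl, rfl, rfl, rfl, him⟩ := hγ.exists_isSol_image he
  rw [him]
  rcases lt_or_gt_of_ne hy with hy | hy
  · rw [abs_of_pos (sub_pos.2 hy)] at hle hd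
    rw [hs.trajectory_branch (hs.k_pos_iff.2 hy) h01 hC hC1 hd hle,
      Real.sign_of_pos (sub_pos.2 hy)]
    simp only [one_mul]
  · have e : |y 1 - y 0| = -y 1 - -y 0 := by rw [abs_of_neg (sub_neg.2 hy)]; ring
    rw [e] at hle hd
    have hs' := hs.reflect
    rw [image_reflect, hs'.trajectory_branch (hs'.k_pos_iff.2 (by linarith)) h01 hC hC1 hd hle,
      Real.sign_of_neg (sub_neg.2 hy), image_image]
    refine image_congr fun u _ => ?_
    simp
    ring

lemma trajectory_apex {x₀ x₁ y₀ y₁ : ℝ} (h01 : x₀ ≤ x₁) (hy : y₀ ≠ y₁)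
    (hgt : 2 * x₁ ^ 4 * (A - F (x₀ / x₁)) < |y₁ - y₀|) {a : ℝ} (ha : x₁ < a)
    (hd : |y₁ - y₀| = 2 * a ^ 4 * (2 * A - F (x₀ / a) - F (x₁ / a))) {γ : ℝ → Fin 2 → ℝ}
    (hγ : IsPlaneGeodesic γ) (he : (γ 0 = ![x₀, y₀] ∧ γ 1 = ![x₁, y₁]) ∨
      (γ 0 = ![x₁, y₁] ∧ γ 1 = ![x₀, y₀])) :
    γ '' T =
      (fun x => ![x, y₀ + Real.sign (y₁ - y₀) * (2 * a ^ 4 * (F (x / a) - F (x₀ / a)))]) ''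
        Icc x₀ a ∪
      (fun x => ![x, y₁ - Real.sign (y₁ - y₀) * (2 * a ^ 4 * (F (x / a) - F (x₁ / a)))]) ''
        Icc x₁ a := by
  obtain ⟨x, z, y, k, hs, rfl, rfl, rfl, rfl, him⟩ := hγ.exists_isSol_image he
  rw [him]
  rcases lt_or_gt_of_ne hy with hy | hy
  · rw [abs_of_pos (sub_pos.2 hy)] at hgt hd
    rw [hs.trajectory_apex (hs.k_pos_iff.2 hy) h01 ha hd hgt, Real.sign_of_pos (sub_pos.2 hy)]
    simp only [one_mul]
  · have e : |y 1 - y 0| = -y 1 - -y 0 := by rw [abs_of_neg (sub_neg.2 hy)]; ring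
    rw [e] at hgt hd
    have hs' := hs.reflect
    rw [image_reflect, hs'.trajectory_apex (hs'.k_pos_iff.2 (by linarith)) h01 ha hd hgt,
      Real.sign_of_neg (sub_neg.2 hy), image_union, image_image, image_image]
    congr 1
    all_goals
      refine image_congr fun u _ => ?_
      simp
      ring

lemma existsUnique_branchGap {x₀ x₁ d : ℝ} (h0 : 0 < x₀) (h01 : x₀ ≤ x₁) (hd : 0 < d)
    (hle : d ≤ 2 * x₁ ^ 4 * (A - F (x₀ / x₁))) :
    ∃! C : ℝ, 0 < C ∧ C ≤ 1 / x₁ ∧ d = 2 / C ^ 4 * (F (C * x₁) - F (C * x₀)) := by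
  obtain ⟨C, hC, hC1, e⟩ := exists_branchGap h0 h01 hd hle
  refine ⟨C, ⟨hC, hC1, e⟩, fun D ⟨hD, hD1, e'⟩ => ?_⟩
  have hlt : x₀ < x₁ := lt_of_le_of_ne h01 fun he => by
    rw [he, branchGap, sub_self, mul_zero] at e
    exact hd.ne' e
  exact (strictMonoOn_branchGap h0 hlt).injOn ⟨hD, hD1⟩ ⟨hC, hC1⟩ (e'.symm.trans e)

lemma existsUnique_apexGap {x₀ x₁ d : ℝ} (h0 : 0 < x₀) (h01 : x₀ ≤ x₁)
    (hlt : 2 * x₁ ^ 4 * (A - F (x₀ / x₁)) < d) :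
    ∃! a : ℝ, x₁ < a ∧ d = 2 * a ^ 4 * (2 * A - F (x₀ / a) - F (x₁ / a)) := by
  obtain ⟨a, ha, e⟩ := exists_apexGap h0 h01 hlt
  refine ⟨a, ⟨ha, e⟩, fun b ⟨hb, e'⟩ => ?_⟩
  exact (strictMonoOn_apexGap h0 h01).injOn hb.le ha.le (e'.symm.trans e)

lemma geodesic_horizontal {x₀ x₁ y : ℝ} {γ : ℝ → Fin 2 → ℝ} (h : IsPlaneGeodesic γ)
    (h0 : γ 0 = ![x₀, y]) (h1 : γ 1 = ![x₁, y]) {t : ℝ} (ht : t ∈ T) :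
    γ t = ![x₀ + t * (x₁ - x₀), y] := by
  obtain ⟨z, k, hs⟩ := h.exists_isSol
  have hk : k = 0 := hs.k_eq_zero_iff.2 (by simp [h0, h1])
  subst hk
  have e1 := (hs.linear one_mem_T).2.1
  have e := hs.linear ht
  simp only [h0, h1, Matrix.cons_val_zero, Matrix.cons_val_one] at e1 e
  rw [← vec_eta (γ t), e.2.1, e.2.2]
  congr 1
  rw [e1]
  ring

end
end H2Curves

namespace H2Curves

open scoped Topology
open MeasureTheory

noncomputable section

/-! ### The numerical value of `A` -/

/-- The moments `∫₀¹ zˢ / √(1 - z⁶) dz`. -/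
def moment (s : ℕ) : ℝ := ∫ z in (0 : ℝ)..1, z ^ s / √(1 - z ^ 6)

lemma sqrt_one_sub_pow_pos {z : ℝ} (hz : z ∈ Ioo (0 : ℝ) 1) : 0 < √(1 - z ^ 6) :=
  Real.sqrt_pos.2 (sub_pos.2 (pow_lt_one₀ hz.1.le hz.2 (by norm_num)))

lemma intervalIntegrable_moment (s : ℕ) :
    IntervalIntegrable (fun z : ℝ => z ^ s / √(1 - z ^ 6)) volume 0 1 := by
  have h1 : IntervalIntegrable (fun u : ℝ => (1 - u) ^ (-(1 / 2) : ℝ)) volume 0 1 := by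
    have := (intervalIntegral.intervalIntegrable_rpow' (a := 0) (b := 1)
      (r := -(1 / 2)) (by norm_num)).comp_sub_left 1
    simpa using this.symm
  rw [intervalIntegrable_iff_integrableOn_Ioo_of_le zero_le_one] at h1 ⊢
  refine h1.mono' (Measurable.aestronglyMeasurable (by fun_prop)) ?_
  refine (ae_restrict_iff' measurableSet_Ioo).2 (Filter.Eventually.of_forall fun u hu => ?_)
  have hs := sqrt_one_sub_pow_pos hu
  have hu0 := hu.1
  rw [Real.norm_of_nonneg (by positivity)]
  have h6 : u ^ 6 ≤ u := by
    calc u ^ 6 ≤ u ^ 1 := pow_le_pow_of_le_one hu.1.le hu.2.le (by norm_num)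
      _ = u := pow_one u
  rw [Real.rpow_neg (by linarith [hu.2]), ← Real.sqrt_eq_rpow, div_eq_mul_inv]
  have hs : 0 < √(1 - u) := Real.sqrt_pos.2 (by linarith [hu.2])
  calc u ^ s * (√(1 - u ^ 6))⁻¹ ≤ 1 * (√(1 - u))⁻¹ := by
        gcongr
        exact pow_le_one₀ hu.1.le hu.2.le
    _ = _ := one_mul _

lemma moment_eq_sub {s : ℕ} {f : ℝ → ℝ} (hc : ContinuousOn f (Icc 0 1))
    (hd : ∀ z ∈ Ioo (0 : ℝ) 1, HasDerivAt f (z ^ s / √(1 - z ^ 6)) z) : moment s = f 1 - f 0 :=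
  intervalIntegral.integral_eq_sub_of_hasDerivAt_of_le zero_le_one hc hd
    (intervalIntegrable_moment s)

lemma hasDerivAt_sqrt_one_sub_pow {z : ℝ} (hz : z ∈ Ioo (0 : ℝ) 1) :
    HasDerivAt (fun z : ℝ => √(1 - z ^ 6)) (-(3 * z ^ 5) / √(1 - z ^ 6)) z := by
  have hs := sqrt_one_sub_pow_pos hz
  have h := ((hasDerivAt_pow 6 z).const_sub 1).sqrt (Real.sqrt_pos.1 hs).ne'
  refine h.congr_deriv ?_
  field_simp
  push_cast
  ring

lemma moment_two : moment 2 = Real.pi / 6 := by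
  rw [moment_eq_sub (f := fun z => Real.arcsin (z ^ 3) / 3)]
  · norm_num [Real.arcsin_one]; ring
  · exact (by fun_prop : Continuous fun z : ℝ => Real.arcsin (z ^ 3) / 3).continuousOn
  · intro z hz
    have hz3 : z ^ 3 < 1 := pow_lt_one₀ hz.1.le hz.2 (by norm_num)
    have h0 : 0 < z ^ 3 := pow_pos hz.1 3
    have h := (HasDerivAt.comp (h₂ := Real.arcsin) (h := fun z => z ^ 3) z
      (Real.hasDerivAt_arcsin (by linarith) hz3.ne) (hasDerivAt_pow 3 z)).div_const 3
    refine h.congr_deriv ?_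
    rw [← pow_mul]
    norm_num
    ring

lemma moment_five : moment 5 = 1 / 3 := by
  rw [moment_eq_sub (f := fun z => -√(1 - z ^ 6) / 3)]
  · norm_num
  · exact (by fun_prop : Continuous fun z : ℝ => -√(1 - z ^ 6) / 3).continuousOn
  · intro z hz
    refine ((hasDerivAt_sqrt_one_sub_pow hz).neg.div_const 3).congr_deriv ?_
    ring

lemma moment_add_six (s : ℕ) : (s + 4) * moment (s + 6) = (s + 1) * moment s := by
  have h : (0 : ℝ) = ∫ z in (0 : ℝ)..1,
      ((s + 1) * (z ^ s / √(1 - z ^ 6)) - (s + 4) * (z ^ (s + 6) / √(1 - z ^ 6))) := by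
    rw [intervalIntegral.integral_eq_sub_of_hasDerivAt_of_le zero_le_one
      (f := fun z => z ^ (s + 1) * √(1 - z ^ 6))]
    · simp
    · exact (by fun_prop : Continuous fun z : ℝ => z ^ (s + 1) * √(1 - z ^ 6)).continuousOn
    · intro z hz
      have hs := sqrt_one_sub_pow_pos hz
      have hq : √(1 - z ^ 6) ^ 2 = 1 - z ^ 6 := Real.sq_sqrt (Real.sqrt_pos.1 hs).le
      refine ((hasDerivAt_pow (s + 1) z).mul (hasDerivAt_sqrt_one_sub_pow hz)).congr_deriv ?_
      field_simp
      rw [hq]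
      push_cast
      ring_nf
    · exact ((intervalIntegrable_moment s).const_mul _).sub
        ((intervalIntegrable_moment (s + 6)).const_mul _)
  rw [intervalIntegral.integral_sub ((intervalIntegrable_moment s).const_mul _)
        ((intervalIntegrable_moment (s + 6)).const_mul _), intervalIntegral.integral_const_mul,
        intervalIntegral.integral_const_mul] at h
  unfold moment
  linarith

lemma antitone_moment : Antitone moment := fun r s hrs => by
  refine intervalIntegral.integral_mono_on_of_le_Ioo zero_le_one (intervalIntegrable_moment s)
    (intervalIntegrable_moment r) fun z hz => ?_
  have := sqrt_one_sub_pow_pos hz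
  exact div_le_div_of_nonneg_right (pow_le_pow_of_le_one hz.1.le hz.2.le hrs) this.le

lemma moment_nonneg (s : ℕ) : 0 ≤ moment s :=
  intervalIntegral.integral_nonneg zero_le_one fun z hz => by
    have := hz.1
    positivity

lemma moment_mul_moment (m : ℕ) :
    moment (6 * m + 2) * moment (6 * m + 5) = Real.pi / (18 * (2 * m + 1)) := by
  induction m with
  | zero => simp [moment_two, moment_five]; ring
  | succ m ih =>
    have h2 := moment_add_six (6 * m + 2)
    have h5 := moment_add_six (6 * m + 5)
    push_cast at h2 h5
    have e2 : moment (6 * m + 2 + 6) = (6 * m + 3) / (6 * m + 6) * moment (6 * m + 2) := by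
      field_simp; linarith
    have e5 : moment (6 * m + 5 + 6) = (6 * m + 6) / (6 * m + 9) * moment (6 * m + 5) := by
      field_simp; linarith
    rw [show 6 * (m + 1) + 2 = 6 * m + 2 + 6 by ring, show 6 * (m + 1) + 5 = 6 * m + 5 + 6 by ring,
      e2, e5, mul_mul_mul_comm, ih]
    push_cast
    field_simp
    ring

lemma moment_sq_mem (m : ℕ) :
    36 * moment (6 * m + 6) ^ 2 ∈ Icc (2 * Real.pi / (2 * m + 3)) (2 * Real.pi / (2 * m + 1)) := by
  have h0 := moment_mul_moment m
  have h1 := moment_mul_moment (m + 1)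
  have a1 := antitone_moment (show 6 * m + 2 ≤ 6 * m + 6 by omega)
  have a2 := antitone_moment (show 6 * m + 5 ≤ 6 * m + 6 by omega)
  have a3 := antitone_moment (show 6 * m + 6 ≤ 6 * (m + 1) + 2 by omega)
  have a4 := antitone_moment (show 6 * m + 6 ≤ 6 * (m + 1) + 5 by omega)
  have n := moment_nonneg
  constructor
  · calc 2 * Real.pi / (2 * m + 3) = 36 * (moment (6 * (m + 1) + 2) * moment (6 * (m + 1) + 5)) := by
          rw [h1]; push_cast; field_simp; ring
      _ ≤ 36 * (moment (6 * m + 6) * moment (6 * m + 6)) := by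
          gcongr <;> exact n _
      _ = _ := by ring
  · calc 36 * moment (6 * m + 6) ^ 2 = 36 * (moment (6 * m + 6) * moment (6 * m + 6)) := by ring
      _ ≤ 36 * (moment (6 * m + 2) * moment (6 * m + 5)) := by
          gcongr <;> exact n _
      _ = _ := by rw [h0]; field_simp; ring

lemma moment_succ (m : ℕ) :
    moment (6 * (m + 1) + 6) = (6 * m + 7) / (6 * m + 10) * moment (6 * m + 6) := by
  have h := moment_add_six (6 * m + 6)
  push_cast at h
  rw [show 6 * (m + 1) + 6 = 6 * m + 6 + 6 by ring]
  field_simp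
  linarith

lemma moment_sq_mul_lower (m : ℕ) :
    36 * moment (6 * m + 6) ^ 2 * ((m + 11 / 12 : ℝ) + 1 / (32 * (m + 7 / 6))) ≤ Real.pi := by
  set u : ℕ → ℝ := fun m =>
    36 * moment (6 * m + 6) ^ 2 * ((m + 11 / 12 : ℝ) + 1 / (32 * (m + 7 / 6))) with hu
  have hmono : Monotone u := monotone_nat_of_le_succ fun m => by
    simp only [hu]
    rw [moment_succ]
    suffices h : 0 ≤ ((6 * m + 7) / (6 * m + 10)) ^ 2
        * (((m + 1 : ℕ) + 11 / 12 : ℝ) + 1 / (32 * ((m + 1 : ℕ) + 7 / 6)))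
        - ((m + 11 / 12 : ℝ) + 1 / (32 * (m + 7 / 6))) by
      have := mul_nonneg (sq_nonneg (moment (6 * m + 6))) h
      linarith
    have h : ((6 * m + 7) / (6 * m + 10)) ^ 2
        * (((m + 1 : ℕ) + 11 / 12 : ℝ) + 1 / (32 * ((m + 1 : ℕ) + 7 / 6)))
        - ((m + 11 / 12 : ℝ) + 1 / (32 * (m + 7 / 6))) = (3 / 4 * m + 5 / 8)
          / (32 * (m + 7 / 6) * (m + 13 / 6) * (m + 5 / 3) ^ 2) := by
      push_cast
      field_simp
      ring
    rw [h]
    positivity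
  have hlim : Filter.Tendsto (fun m : ℕ => Real.pi + 2 * Real.pi / (2 * m + 1)) Filter.atTop
      (𝓝 (Real.pi + 0)) := by
    refine tendsto_const_nhds.add (tendsto_const_nhds.div_atTop ?_)
    exact Filter.tendsto_atTop_add_const_right _ _
      (tendsto_natCast_atTop_atTop.const_mul_atTop two_pos)
  rw [add_zero] at hlim
  refine ge_of_tendsto hlim (Filter.eventually_atTop.2 ⟨m, fun j hj => (hmono hj).trans ?_⟩)
  have hj := (moment_sq_mem j).2
  have h3 : ((j + 11 / 12 : ℝ) + 1 / (32 * (j + 7 / 6))) ≤ j + 3 / 2 := by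
    have : 1 / (32 * (j + 7 / 6 : ℝ)) ≤ 1 / 32 := by
      gcongr
      have : (0 : ℝ) ≤ j := j.cast_nonneg
      linarith
    linarith
  calc u j ≤ 2 * Real.pi / (2 * j + 1) * (j + 3 / 2) := by
        simp only [hu]
        gcongr
    _ = _ := by field_simp; ring

lemma le_moment_sq_mul_upper (m : ℕ) :
    Real.pi ≤ 36 * moment (6 * m + 6) ^ 2 * ((m + 11 / 12 : ℝ) + 1 / (32 * (m + 11 / 12))) := by
  set u : ℕ → ℝ := fun m =>
    36 * moment (6 * m + 6) ^ 2 * ((m + 11 / 12 : ℝ) + 1 / (32 * (m + 11 / 12))) with hu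
  have hanti : Antitone u := antitone_nat_of_succ_le fun m => by
    simp only [hu]
    rw [moment_succ]
    suffices h : 0 ≤ ((m + 11 / 12 : ℝ) + 1 / (32 * (m + 11 / 12)))
        - ((6 * m + 7) / (6 * m + 10)) ^ 2
        * (((m + 1 : ℕ) + 11 / 12 : ℝ) + 1 / (32 * ((m + 1 : ℕ) + 11 / 12))) by
      have := mul_nonneg (sq_nonneg (moment (6 * m + 6))) h
      linarith
    have h : ((m + 11 / 12 : ℝ) + 1 / (32 * (m + 11 / 12)))
        - ((6 * m + 7) / (6 * m + 10)) ^ 2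
        * (((m + 1 : ℕ) + 11 / 12 : ℝ) + 1 / (32 * ((m + 1 : ℕ) + 11 / 12))) = (9 / 16)
          / (32 * (m + 11 / 12) * (m + 23 / 12) * (m + 5 / 3) ^ 2) := by
      push_cast
      field_simp
      ring
    rw [h]
    positivity
  have hlim : Filter.Tendsto (fun m : ℕ => Real.pi - 2 * Real.pi / (2 * m + 3)) Filter.atTop
      (𝓝 (Real.pi - 0)) := by
    refine tendsto_const_nhds.sub (tendsto_const_nhds.div_atTop ?_)
    exact Filter.tendsto_atTop_add_const_right _ _
      (tendsto_natCast_atTop_atTop.const_mul_atTop two_pos)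
  rw [sub_zero] at hlim
  refine le_of_tendsto hlim (Filter.eventually_atTop.2 ⟨m, fun j hj => le_trans ?_ (hanti hj)⟩)
  have hj := (moment_sq_mem j).1
  have h3 : (j + 1 / 2 : ℝ) ≤ ((j + 11 / 12 : ℝ) + 1 / (32 * (j + 11 / 12))) := by
    have : 0 ≤ 1 / (32 * (j + 11 / 12 : ℝ)) := by positivity
    linarith
  calc Real.pi - 2 * Real.pi / (2 * j + 3) = 2 * Real.pi / (2 * j + 3) * (j + 1 / 2) := by
        field_simp; ring
    _ ≤ u j := by
        simp only [hu]
        gcongr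

lemma A_bounds : (0.30358 : ℝ) ≤ A ∧ A < 0.30359 := by
  have hA : A = moment (6 * 0 + 6) := rfl
  have h6 : moment (6 * 6 + 6) = (7 / 10 * (13 / 16) * (19 / 22) * (25 / 28) * (31 / 34) * (37 / 40)) * A := by
    rw [hA]
    rw [moment_succ 5, moment_succ 4, moment_succ 3, moment_succ 2, moment_succ 1, moment_succ 0]
    push_cast
    ring
  have hl := moment_sq_mul_lower 6
  have hu := le_moment_sq_mul_upper 6
  rw [h6] at hl hu
  have hp1 := Real.pi_gt_d6
  have hp2 := Real.pi_lt_d6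
  have hA0 := A_pos
  norm_num at hl hu ⊢
  constructor
  · by_contra! h
    nlinarith
  · by_contra! h
    nlinarith

end
end H2Curves

namespace H2Curves

open scoped Topology
open MeasureTheory

noncomputable section

/-! ### The lower bound for the distance in the half plane -/

lemma monotoneOn_T_of_hasDerivWithinAt {f f' : ℝ → ℝ}
    (hf : ∀ t ∈ T, HasDerivWithinAt f (f' t) T t) (hpos : ∀ t ∈ T, 0 ≤ f' t) : MonotoneOn f T := by
  refine monotoneOn_of_deriv_nonneg (convex_Icc 0 1) (fun t ht => (hf t ht).continuousWithinAt)
    (fun t ht => ((hf t (interior_subset ht)).mono interior_subset).differentiableWithinAt)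
    fun t ht => ?_
  have h1 : T ∈ 𝓝 t := mem_interior_iff_mem_nhds.1 ht
  rw [((hf t (interior_subset ht)).hasDerivAt h1).deriv]
  exact hpos t (interior_subset ht)

lemma exists_primitive {f : ℝ → ℝ} (hf : ContinuousOn f T) :
    ∃ m : ℝ → ℝ, m 0 = 0 ∧ ∀ t ∈ T, HasDerivWithinAt m (f t) T t := by
  set f' : ℝ → ℝ := IccExtend (zero_le_one (α := ℝ)) (T.domRestrict f) with hf'
  have hc : Continuous f' := (continuousOn_iff_continuous_domRestrict.1 hf).Icc_extend'
  refine ⟨fun t => ∫ s in (0 : ℝ)..t, f' s, by simp, fun t ht => ?_⟩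
  have := (hc.integral_hasStrictDerivAt 0 t).hasDerivAt.hasDerivWithinAt (s := T)
  rwa [hf', IccExtend_of_mem _ _ ht] at this

namespace IsSol

variable {x z y : ℝ → ℝ} {k : ℝ}

/-- The Cauchy–Schwarz inequality for the chord of a geodesic. -/
lemma sq_add_sq_le_energy (h : IsSol x z y k) {m : ℝ → ℝ} (m0 : m 0 = 0)
    (hm : ∀ t ∈ T, HasDerivWithinAt m (x t ^ 3) T t) :
    (x 1 - x 0) ^ 2 + (k * m 1) ^ 2 ≤ z 0 ^ 2 + k ^ 2 * x 0 ^ 6 := by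
  set α := x 1 - x 0 with hα
  set β := k * m 1 with hβ
  set E := z 0 ^ 2 + k ^ 2 * x 0 ^ 6 with hE
  have hE0 : 0 ≤ E := by have := h.pos 0 zero_mem_T; positivity
  have hD0 : 0 ≤ α ^ 2 + β ^ 2 := by positivity
  have hmono := monotoneOn_T_of_hasDerivWithinAt
    (f := fun t => √((α ^ 2 + β ^ 2) * E) * t - (α * x t + β * (k * m t)))
    (f' := fun t => √((α ^ 2 + β ^ 2) * E) - (α * z t + β * (k * x t ^ 3)))
    (fun t ht => by
      have h1 := ((hasDerivWithinAt_id t T).const_mul √((α ^ 2 + β ^ 2) * E)).sub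
        (((h.dx t ht).const_mul α).add (((hm t ht).const_mul k).const_mul β))
      rw [mul_one] at h1
      exact h1)
    (fun t ht => by
      refine sub_nonneg.2 (Real.le_sqrt_of_sq_le ?_)
      rw [hE, ← h.energy_eq ht]
      nlinarith [sq_nonneg (α * (k * x t ^ 3) - β * z t)])
    zero_mem_T one_mem_T zero_le_one
  have h2 : α ^ 2 + β ^ 2 ≤ √((α ^ 2 + β ^ 2) * E) := by
    simp only [m0] at hmono
    nlinarith [hmono]
  rcases hD0.eq_or_lt with h3 | h3
  · rw [← h3]; exact hE0
  · have h4 := Real.le_sqrt' h3 |>.1 h2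
    rw [sq] at h4
    exact le_of_mul_le_mul_left h4 h3

lemma antitoneOn_z (h : IsSol x z y k) : AntitoneOn z T := by
  have := monotoneOn_T_of_hasDerivWithinAt (f := fun t => -z t) (fun t ht => (h.dz t ht).neg)
    (fun t ht => by have := h.pos t ht; simp only [neg_neg]; positivity)
  exact fun s hs t ht hst => neg_le_neg_iff.1 (this hs ht hst)

/-- The derivative of `(x₀⁴ + x⁴ + (k/A) m₆) m₃ - 2 m₇`, up to a positive factor. -/
lemma moment_deriv_nonneg (h : IsSol x z y k) (hk : 0 < k) (hz : ∀ t ∈ T, 0 ≤ z t) {m₃ m₆ : ℝ → ℝ}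
    (h30 : m₃ 0 = 0) (h60 : m₆ 0 = 0) (h3 : ∀ t ∈ T, HasDerivWithinAt m₃ (x t ^ 3) T t)
    (h6 : ∀ t ∈ T, HasDerivWithinAt m₆ (x t ^ 6) T t) {τ : ℝ} (hτ : τ ∈ T) :
    0 ≤ (4 * z τ + k / A * x τ ^ 3) * m₃ τ + x 0 ^ 4 - x τ ^ 4 + k / A * m₆ τ := by
  have hA := A_pos
  have hx0 := h.pos 0 zero_mem_T
  have hxτ := h.pos τ hτ
  have hzτ := hz τ hτ
  set n := √(z 0 ^ 2 + k ^ 2 * x 0 ^ 6) with hn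
  have hn0 : 0 < n := Real.sqrt_pos.2 (by positivity)
  have hn2 : ∀ t ∈ T, n ^ 2 = z t ^ 2 + k ^ 2 * x t ^ 6 := fun t ht => by
    rw [hn, h.energy_eq ht, Real.sq_sqrt (by positivity)]
  have hzn : ∀ t ∈ T, z t ≤ n := fun t ht => by
    have := h.pos t ht
    refine (sq_le_sq₀ (hz t ht) hn0.le).1 ?_
    rw [hn2 t ht]
    have : 0 ≤ k ^ 2 * x t ^ 6 := by positivity
    linarith
  by_cases hc : n - z τ ≤ k / (4 * A) * x τ ^ 3
  · have hmono := monotoneOn_T_of_hasDerivWithinAt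
      (f := fun s => (4 * z τ + k / A * x τ ^ 3) * m₃ s - x s ^ 4 + k / A * m₆ s)
      (fun s hs => (((h3 s hs).const_mul _).sub ((h.dx s hs).pow 4)).add ((h6 s hs).const_mul _))
      (fun s hs => by
        have hxs := h.pos s hs
        have h1 : 0 ≤ 4 * z τ + k / A * x τ ^ 3 - 4 * z s := by
          have : k / A * x τ ^ 3 = 4 * (k / (4 * A) * x τ ^ 3) := by field_simp
          linarith [hzn s hs]
        have h2 : 0 ≤ k / A * x s ^ 6 := by positivity
        have h4 : 0 ≤ x s ^ 3 := by positivity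
        have := mul_nonneg h4 h1
        push_cast
        linarith)
      zero_mem_T hτ hτ.1
    simp only [h30, h60] at hmono
    linarith
  · push Not at hc
    have hxx : x 0 ≤ x τ := monotoneOn_T_of_hasDerivWithinAt h.dx hz zero_mem_T hτ hτ.1
    have m3 : x τ ^ 4 - x 0 ^ 4 ≤ 4 * n * m₃ τ := by
      have := monotoneOn_T_of_hasDerivWithinAt (f := fun s => 4 * n * m₃ s - x s ^ 4)
        (fun s hs => ((h3 s hs).const_mul _).sub ((h.dx s hs).pow 4))
        (fun s hs => by
          have hxs := h.pos s hs
          have h4 : 0 ≤ x s ^ 3 := by positivity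
          have := mul_nonneg h4 (sub_nonneg.2 (hzn s hs))
          push_cast
          norm_num
          linarith) zero_mem_T hτ hτ.1
      simp only [h30] at this
      linarith
    have m6 : x τ ^ 7 - x 0 ^ 7 ≤ 7 * n * m₆ τ := by
      have := monotoneOn_T_of_hasDerivWithinAt (f := fun s => 7 * n * m₆ s - x s ^ 7)
        (fun s hs => ((h6 s hs).const_mul _).sub ((h.dx s hs).pow 7))
        (fun s hs => by
          have hxs := h.pos s hs
          have h4 : 0 ≤ x s ^ 6 := by positivity
          have := mul_nonneg h4 (sub_nonneg.2 (hzn s hs))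
          push_cast
          norm_num
          linarith) zero_mem_T hτ hτ.1
      simp only [h60] at this
      linarith
    have hm3 : 0 ≤ m₃ τ := by
      have := monotoneOn_T_of_hasDerivWithinAt h3 (fun t ht => by have := h.pos t ht; positivity)
        zero_mem_T hτ hτ.1
      rwa [h30] at this
    set w := k * x τ ^ 3 with hw
    have hw0 : 0 < w := by positivity
    set Δ := x τ ^ 4 - x 0 ^ 4 with hΔ
    have hΔ0 : 0 ≤ Δ := sub_nonneg.2 (pow_le_pow_left₀ hx0.le hxx 4)
    have m6' : w * Δ ≤ 7 * n * (k * m₆ τ) := by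
      have : x 0 ^ 3 * x 0 ^ 4 ≤ x τ ^ 3 * x 0 ^ 4 := by gcongr
      calc w * Δ = k * (x τ ^ 7 - x τ ^ 3 * x 0 ^ 4) := by rw [hw, hΔ]; ring
        _ ≤ k * (x τ ^ 7 - x 0 ^ 7) := by gcongr; linarith
        _ ≤ k * (7 * n * m₆ τ) := by gcongr
        _ = _ := by ring
    have hw2 : n ^ 2 = z τ ^ 2 + w ^ 2 := by rw [hn2 τ hτ, hw]; ring
    have hAb := A_bounds
    have hwz : n + z τ < 4 * A * w := by
      have h1 : k / (4 * A) * x τ ^ 3 = w / (4 * A) := by rw [hw]; ring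
      rw [h1, div_lt_iff₀ (by positivity)] at hc
      have h2 : 0 < n - z τ := by
        by_contra! h3
        nlinarith
      refine lt_of_mul_lt_mul_left ?_ hw0.le
      nlinarith
    have hwn : 8 * A * n ≤ (16 * A ^ 2 + 1) * w := by
      have h1 : z τ ^ 2 < (4 * A * w - n) ^ 2 := by
        apply pow_lt_pow_left₀ (by linarith) hzτ (by norm_num)
      have h2 : 0 < w * ((16 * A ^ 2 + 1) * w - 8 * A * n) := by nlinarith
      linarith [(pos_iff_pos_of_mul_pos h2).1 hw0]
    have hA2 : 16 * A ^ 2 + 1 ≤ 88 / 28 := by nlinarith [hAb.1, hAb.2]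
    have hfin : n * A ≤ 11 / 28 * w := by nlinarith
    have : Δ ≤ k / A * x τ ^ 3 * m₃ τ + k / A * m₆ τ := by
      have e : k / A * x τ ^ 3 * m₃ τ + k / A * m₆ τ = (w * m₃ τ + k * m₆ τ) / A := by
        rw [hw]; ring
      rw [e, le_div_iff₀ hA]
      refine le_of_mul_le_mul_left ?_ hn0
      have h1 := mul_le_mul_of_nonneg_left m3 hw0.le
      have h2 := mul_le_mul_of_nonneg_left hfin hΔ0
      nlinarith
    have h4 : 0 ≤ z τ * m₃ τ := mul_nonneg hzτ hm3
    linarith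

/-- The bound of `∫ x⁷` by `∫ x³` along a geodesic. -/
lemma two_mul_moment_le (h : IsSol x z y k) (hk : 0 < k) (h01 : x 0 ≤ x 1) {m₃ m₇ : ℝ → ℝ}
    (h30 : m₃ 0 = 0) (h70 : m₇ 0 = 0) (h3 : ∀ t ∈ T, HasDerivWithinAt m₃ (x t ^ 3) T t)
    (h7 : ∀ t ∈ T, HasDerivWithinAt m₇ (x t ^ 7) T t) :
    2 * m₇ 1 ≤ (x 0 ^ 4 + x 1 ^ 4 + 1 / (2 * A) * (y 1 - y 0)) * m₃ 1 := by
  have hA := A_pos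
  have hx0 := h.pos 0 zero_mem_T
  have hm3 : 0 ≤ m₃ 1 := by
    have := monotoneOn_T_of_hasDerivWithinAt h3 (fun t ht => by have := h.pos t ht; positivity)
      zero_mem_T one_mem_T zero_le_one
    rwa [h30] at this
  rcases lt_or_ge (z 1) 0 with hz | hz
  · have hψ : 0 < angle x z k 1 := by
      have := h.pos 1 one_mem_T
      exact Real.arctan_pos.2 (div_pos (neg_pos.2 hz) (by positivity))
    have harc := h.isArc hk
    obtain ⟨h1, h2⟩ := harc.apex h01 hψ
    set a := apexOf x z k with ha
    have ha0 := h.apexOf_pos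
    have hle : m₇ 1 ≤ a ^ 4 * m₃ 1 := by
      have := monotoneOn_T_of_hasDerivWithinAt (f := fun s => a ^ 4 * m₃ s - m₇ s)
        (fun s hs => ((h3 s hs).const_mul _).sub (h7 s hs))
        (fun s hs => by
          have hxs := h.pos s hs
          have hxa : x s ≤ a := by
            rw [h.x_eq_crt hk hs]
            exact mul_le_of_le_one_right ha0.le (crt_le_one (angle_mem x z k s))
          have h4 : x s ^ 4 ≤ a ^ 4 := pow_le_pow_left₀ hxs.le hxa 4
          have h3 : 0 ≤ x s ^ 3 := by positivity
          have := mul_nonneg (sub_nonneg.2 h4) h3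
          linarith) zero_mem_T one_mem_T zero_le_one
      simp only [h30, h70] at this
      linarith
    have hgap := le_apexGap hx0 h01 h1.le
    rw [← h2] at hgap
    have h5 : 2 * a ^ 4 ≤ x 0 ^ 4 + x 1 ^ 4 + 1 / (2 * A) * (y 1 - y 0) := by
      have : 1 / (2 * A) * (y 1 - y 0) = (y 1 - y 0) / (2 * A) := by ring
      rw [this, ← sub_le_iff_le_add', le_div_iff₀ (by positivity)]
      linarith
    nlinarith [mul_le_mul_of_nonneg_right h5 hm3]
  · have hz0 : ∀ t ∈ T, 0 ≤ z t := fun t ht => hz.trans (h.antitoneOn_z ht one_mem_T ht.2)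
    obtain ⟨m₆, h60, h6⟩ := exists_primitive (f := fun t => x t ^ 6) (h.continuousOn_x.pow 6)
    have hy : y 1 - y 0 = 2 * k * m₆ 1 := by
      have := eqOn_T_of_hasDerivWithinAt (g := fun t => y 0 + 2 * k * m₆ t) h.dy
        (fun t ht => ((h6 t ht).const_mul (2 * k)).const_add _) (by simp [h60]) one_mem_T
      simp only at this
      linarith
    have hmono := monotoneOn_T_of_hasDerivWithinAt
      (f := fun t => (x 0 ^ 4 + x t ^ 4 + k / A * m₆ t) * m₃ t - 2 * m₇ t)
      (fun t ht => (((((h.dx t ht).pow 4).const_add _).add ((h6 t ht).const_mul _)).mul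
        (h3 t ht)).sub ((h7 t ht).const_mul 2))
      (fun t ht => by
        have hxs := h.pos t ht
        have := mul_nonneg (pow_pos hxs 3).le (h.moment_deriv_nonneg hk hz0 h30 h60 h3 h6 ht)
        refine this.trans_eq ?_
        simp only [Pi.pow_apply, Pi.add_apply]
        push_cast
        ring) zero_mem_T one_mem_T zero_le_one
    simp only [h30, h60, h70] at hmono
    rw [hy]
    have : 1 / (2 * A) * (2 * k * m₆ 1) = k / A * m₆ 1 := by field_simp
    rw [this]
    linarith

lemma energy_ge_of_le (h : IsSol x z y k) (hk : 0 < k) (h01 : x 0 ≤ x 1) {c : ℝ} (hc : 0 < c)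
    (hS : 2 * c ^ 4 = x 0 ^ 4 + x 1 ^ 4 + 1 / (2 * A) * (y 1 - y 0)) :
    (x 1 - x 0) ^ 2 + (y 1 - y 0) ^ 2 / (4 * c ^ 6) ≤ z 0 ^ 2 + k ^ 2 * x 0 ^ 6 := by
  obtain ⟨m₃, h30, h3⟩ := exists_primitive (f := fun t => x t ^ 3) (h.continuousOn_x.pow 3)
  obtain ⟨m₆, h60, h6⟩ := exists_primitive (f := fun t => x t ^ 6) (h.continuousOn_x.pow 6)
  obtain ⟨m₇, h70, h7⟩ := exists_primitive (f := fun t => x t ^ 7) (h.continuousOn_x.pow 7)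
  have hy : y 1 - y 0 = 2 * k * m₆ 1 := by
    have := eqOn_T_of_hasDerivWithinAt (g := fun t => y 0 + 2 * k * m₆ t) h.dy
      (fun t ht => ((h6 t ht).const_mul (2 * k)).const_add _) (by simp [h60]) one_mem_T
    simp only at this
    linarith
  have hm6 : 0 ≤ m₆ 1 := by
    have := monotoneOn_T_of_hasDerivWithinAt h6 (fun t ht => by have := h.pos t ht; positivity)
      zero_mem_T one_mem_T zero_le_one
    rwa [h60] at this
  have h1 := h.two_mul_moment_le hk h01 h30 h70 h3 h7
  rw [← hS] at h1
  have h2 := monotoneOn_T_of_hasDerivWithinAt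
    (f := fun s => 3 * m₇ s - 4 * c * m₆ s + c ^ 4 * m₃ s)
    (fun s hs => (((h7 s hs).const_mul 3).sub ((h6 s hs).const_mul (4 * c))).add
      ((h3 s hs).const_mul (c ^ 4)))
    (fun s hs => by
      have hxs := h.pos s hs
      have : 0 ≤ x s ^ 3 * ((x s - c) ^ 2 * (3 * x s ^ 2 + 2 * c * x s + c ^ 2)) := by positivity
      refine this.trans_eq ?_
      ring) zero_mem_T one_mem_T zero_le_one
  simp only [h30, h60, h70] at h2
  have h4 : m₆ 1 ≤ c ^ 3 * m₃ 1 := by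
    refine le_of_mul_le_mul_left ?_ hc
    nlinarith
  refine le_trans ?_ (h.sq_add_sq_le_energy h30 h3)
  gcongr
  rw [div_le_iff₀ (by positivity), hy]
  have h5 := pow_le_pow_left₀ hm6 h4 2
  have := mul_le_mul_of_nonneg_left h5 (by positivity : 0 ≤ 4 * k ^ 2)
  nlinarith

lemma energy_ge (h : IsSol x z y k) {c : ℝ} (hc : 0 < c)
    (hS : 2 * c ^ 4 = x 0 ^ 4 + x 1 ^ 4 + 1 / (2 * A) * |y 1 - y 0|) :
    (x 1 - x 0) ^ 2 + (y 1 - y 0) ^ 2 / (4 * c ^ 6) ≤ z 0 ^ 2 + k ^ 2 * x 0 ^ 6 := by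
  have pos : ∀ {x z y : ℝ → ℝ} {k : ℝ}, IsSol x z y k → 0 < k →
      2 * c ^ 4 = x 0 ^ 4 + x 1 ^ 4 + 1 / (2 * A) * |y 1 - y 0| →
      (x 1 - x 0) ^ 2 + (y 1 - y 0) ^ 2 / (4 * c ^ 6) ≤ z 0 ^ 2 + k ^ 2 * x 0 ^ 6 := by
    intro x z y k h hk hS
    have hy := h.k_pos_iff.1 hk
    rw [abs_of_pos (sub_pos.2 hy)] at hS
    rcases le_total (x 0) (x 1) with h01 | h01
    · exact h.energy_ge_of_le hk h01 hc hS
    · have h' := h.reverse.reflect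
      rw [neg_neg] at h'
      have := h'.energy_ge_of_le hk (by simpa using h01) hc (by simp; rw [hS]; ring)
      simp only [sub_self, sub_zero] at this
      have he := h.energy_eq one_mem_T
      rw [← he]
      calc _ = (x 0 - x 1) ^ 2 + (-y 0 - -y 1) ^ 2 / (4 * c ^ 6) := by ring
        _ ≤ _ := this
        _ = _ := by ring
  rcases lt_trichotomy k 0 with hk | rfl | hk
  · have := pos h.reflect (neg_pos.2 hk) (by rw [hS, ← abs_neg (y 1 - y 0)]; ring_nf)
    calc _ = (x 1 - x 0) ^ 2 + (-y 1 - -y 0) ^ 2 / (4 * c ^ 6) := by ring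
      _ ≤ _ := this
      _ = _ := by ring
  · obtain ⟨-, h1, h2⟩ := h.linear one_mem_T
    rw [h1, h2]
    simp
  · exact pos h hk hS

end IsSol

/-- The lower bound for the squared distance of two points of the half plane. -/
def distBound (x₀ x₁ d : ℝ) : ℝ :=
  d ^ 2 / ((2 : ℝ) ^ (1 / 2 : ℝ) * (x₀ ^ 4 + x₁ ^ 4 + 1 / (2 * A) * d) ^ (3 / 2 : ℝ))

lemma speedSq_ge {p q : Fin 2 → ℝ} (hp : p ∈ halfPlane) (hq : q ∈ halfPlane) :
    4 * (|p 0 - q 0| ^ 2 + distBound (p 0) (q 0) |p 1 - q 1|) ≤ speedSq p q := by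
  obtain ⟨x, z, y, h, hx0, hz0, hy0, hx1, hy1, -⟩ := exists_isSol_geo hp hq
  have hp0 : 0 < p 0 := hp
  have hq0 : 0 < q 0 := hq
  have hA := A_pos
  set S := p 0 ^ 4 + q 0 ^ 4 + 1 / (2 * A) * |p 1 - q 1| with hS
  have hS0 : 0 < S := by positivity
  set c := (S / 2) ^ (1 / 4 : ℝ) with hc
  have hc0 : 0 < c := by positivity
  have hc4 : 2 * c ^ 4 = S := by
    rw [hc, ← Real.rpow_natCast, ← Real.rpow_mul (by positivity)]
    norm_num
    ring
  have he := h.energy_ge hc0 (by rw [hc4, hS, hx0, hx1, hy0, hy1, abs_sub_comm])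
  have hden : (2 : ℝ) ^ (1 / 2 : ℝ) * S ^ (3 / 2 : ℝ) = 4 * c ^ 6 := by
    rw [← hc4, Real.mul_rpow (by norm_num) (by positivity), ← mul_assoc,
      ← Real.rpow_add (by norm_num), ← Real.rpow_natCast c, ← Real.rpow_mul hc0.le,
      ← Real.rpow_natCast c]
    norm_num
  rw [distBound, hden, speedSq, sq_abs, sq_abs]
  rw [hx0, hx1, hy0, hy1, hz0] at he
  rw [show (p 0 - q 0) ^ 2 = (q 0 - p 0) ^ 2 by ring, show (p 1 - q 1) ^ 2 = (q 1 - p 1) ^ 2 by ring]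
  linarith

lemma le_planeDist {x₀ x₁ y₀ y₁ : ℝ} (h0 : 0 < x₀) (h1 : 0 < x₁) :
    2 * √(|x₀ - x₁| ^ 2 + distBound x₀ x₁ |y₀ - y₁|) ≤ planeDist ![x₀, y₀] ![x₁, y₁] := by
  have hp : ![x₀, y₀] ∈ halfPlane := h0
  have hq : ![x₁, y₁] ∈ halfPlane := h1
  rw [planeDist_eq hp hq]
  refine Real.le_sqrt_of_sq_le ?_
  have h := speedSq_ge hp hq
  simp only [Matrix.cons_val_zero, Matrix.cons_val_one] at h
  rw [mul_pow, Real.sq_sqrt]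
  · linarith
  · have := A_pos
    rw [distBound]
    positivity

end
end H2Curves

namespace H2Curves

open scoped Topology
open MeasureTheory

noncomputable section

/-! ### Calculus on closed domains -/

lemma intervalIntegrable_of_continuousOn_prod {X W : Type} [TopologicalSpace X]
    [NormedAddCommGroup W] {P : Set X} {a b : ℝ} {f : X × ℝ → W}
    (hf : ContinuousOn f (P ×ˢ Icc a b)) (hab : a ≤ b) {p : X} (hp : p ∈ P) :
    IntervalIntegrable (fun u => f (p, u)) volume a b := by
  refine ContinuousOn.intervalIntegrable ?_
  rw [uIcc_of_le hab]
  exact hf.comp (by fun_prop) fun u hu => ⟨hp, hu⟩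

section Calculus

variable {E V : Type} [NormedAddCommGroup E] [NormedSpace ℝ E] [NormedAddCommGroup V]
  [NormedSpace ℝ V]

/-- The derivative in the direction `v` of a function on the domain `Ω`. -/
def pderiv (Ω : Set E) (v : E) (f : E → V) (e : E) : V := fderivWithin ℝ f Ω e v

lemma contDiffOn_pderiv {Ω : Set E} (hΩ : UniqueDiffOn ℝ Ω) {f : E → V} (hf : ContDiffOn ℝ ∞ f Ω)
    (v : E) : ContDiffOn ℝ ∞ (pderiv Ω v f) Ω :=
  (hf.fderivWithin hΩ (by norm_num)).clm_apply contDiffOn_const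

lemma hasDerivWithinAt_pderiv {Ω : Set E} {f : E → V} (hf : ContDiffOn ℝ ∞ f Ω) {S : Set ℝ}
    {l : ℝ → E} {v : E} {s : ℝ} (hl : HasDerivWithinAt l v S s) (hm : MapsTo l S Ω) (hs : s ∈ S) :
    HasDerivWithinAt (fun s => f (l s)) (pderiv Ω v f (l s)) S s :=
  ((hf.differentiableOn (by norm_num) (l s) (hm hs)).hasFDerivWithinAt).comp_hasDerivWithinAt s hl hm

lemma pderiv_congr {Ω : Set E} {f g : E → V} (h : EqOn f g Ω) (v : E) {e : E} (he : e ∈ Ω) :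
    pderiv Ω v f e = pderiv Ω v g e := by
  rw [pderiv, pderiv, fderivWithin_congr h (h he)]

lemma pderiv_comm {Ω : Set E} (hΩ : UniqueDiffOn ℝ Ω) (hi : Ω ⊆ closure (interior Ω)) {f : E → V}
    (hf : ContDiffOn ℝ ∞ f Ω) (v w : E) {e : E} (he : e ∈ Ω) :
    pderiv Ω v (pderiv Ω w f) e = pderiv Ω w (pderiv Ω v f) e := by
  have hd : DifferentiableWithinAt ℝ (fderivWithin ℝ f Ω) Ω e :=
    (hf.fderivWithin hΩ (m := ∞) (by norm_num)).differentiableOn (by norm_num) e he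
  have key : ∀ v w : E, pderiv Ω v (pderiv Ω w f) e
      = fderivWithin ℝ (fderivWithin ℝ f Ω) Ω e v w := fun v w => by
    have := (hd.hasFDerivWithinAt.clm_apply (hasFDerivWithinAt_const w e Ω)).fderivWithin (hΩ e he)
    rw [pderiv]
    unfold pderiv
    rw [this]
    simp
  rw [key, key]
  exact (hf e he).isSymmSndFDerivWithinAt
    (by rw [minSmoothness_of_isRCLikeNormedField]; exact WithTop.coe_le_coe.2 le_top) hΩ (hi he) he v w

variable {P : Set E} {a b : ℝ}

lemma uniqueDiffOn_prod_Icc (hP : UniqueDiffOn ℝ P) (hab : a < b) :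
    UniqueDiffOn ℝ (P ×ˢ Icc a b) := hP.prod (uniqueDiffOn_Icc hab)

/-- The derivative of a function on `P × [a, b]` with respect to the first variable. -/
def paramDeriv (P : Set E) (a b : ℝ) (f : E × ℝ → V) (e : E × ℝ) : E →L[ℝ] V :=
  (fderivWithin ℝ f (P ×ˢ Icc a b) e).comp (ContinuousLinearMap.inl ℝ E ℝ)

lemma hasFDerivWithinAt_paramDeriv {f : E × ℝ → V} (hf : DifferentiableOn ℝ f (P ×ˢ Icc a b))
    {p : E} (hp : p ∈ P) {u : ℝ} (hu : u ∈ Icc a b) :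
    HasFDerivWithinAt (fun p => f (p, u)) (paramDeriv P a b f (p, u)) P p := by
  have h1 := (hf (p, u) ⟨hp, hu⟩).hasFDerivWithinAt
  have h2 : HasFDerivWithinAt (fun p : E => (p, u)) (ContinuousLinearMap.inl ℝ E ℝ) P p :=
    (hasFDerivAt_prodMk_left p u).hasFDerivWithinAt
  have hm : MapsTo (fun p : E => (p, u)) P (P ×ˢ Icc a b) := fun q hq => ⟨hq, hu⟩
  exact h1.comp p h2 hm

lemma hasFDerivWithinAt_integral (hP : UniqueDiffOn ℝ P) (hc : Convex ℝ P) (hab : a < b)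
    {f : E × ℝ → V} (hf : ContDiffOn ℝ 1 f (P ×ˢ Icc a b)) {p : E} (hp : p ∈ P) :
    HasFDerivWithinAt (fun p => ∫ u in a..b, f (p, u))
      (∫ u in a..b, paramDeriv P a b f (p, u)) P p := by
  have hD : ContinuousOn (paramDeriv P a b f) (P ×ˢ Icc a b) :=
    (hf.continuousOn_fderivWithin (uniqueDiffOn_prod_Icc hP hab) le_rfl).clm_comp continuousOn_const
  rw [hasFDerivWithinAt_iff_isLittleO, Asymptotics.isLittleO_iff]
  intro ε hε
  have hε' : 0 < ε / (b - a) := div_pos hε (sub_pos.2 hab)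
  obtain ⟨v, hv, hvk⟩ := isCompact_Icc.mem_uniformity_of_prod
    (f := fun p u => paramDeriv P a b f (p, u)) (s := P) (k := Icc a b) hD hp
    (Metric.dist_mem_uniformity hε')
  obtain ⟨δ, hδ, hδv⟩ := Metric.mem_nhdsWithin_iff.1 hv
  have hball : Metric.ball p δ ∩ P ∈ 𝓝[P] p :=
    Filter.inter_mem (mem_nhdsWithin_of_mem_nhds (Metric.ball_mem_nhds p hδ)) self_mem_nhdsWithin
  filter_upwards [hball] with q hq
  have hI := fun {p : E} (hp : p ∈ P) =>
    intervalIntegrable_of_continuousOn_prod hf.continuousOn hab.le hp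
  have hID := intervalIntegrable_of_continuousOn_prod hD hab.le hp
  rw [← intervalIntegral.integral_sub (hI hq.2) (hI hp),
    ContinuousLinearMap.intervalIntegral_apply hID, ← intervalIntegral.integral_sub
      ((hI hq.2).sub (hI hp)) (intervalIntegrable_of_continuousOn_prod
        (f := fun e => paramDeriv P a b f e (q - p)) (hD.clm_apply continuousOn_const) hab.le hp)]
  refine (intervalIntegral.norm_integral_le_of_norm_le_const (C := ε / (b - a) * ‖q - p‖)
    fun u hu => ?_).trans_eq ?_
  · rw [uIoc_of_le hab.le] at hu
    have hu' : u ∈ Icc a b := Ioc_subset_Icc_self hu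
    refine Convex.norm_image_sub_le_of_norm_hasFDerivWithin_le' (f := fun p => f (p, u))
      (f' := fun p => paramDeriv P a b f (p, u)) (s := Metric.ball p δ ∩ P)
      (fun r hr => (hasFDerivWithinAt_paramDeriv (hf.differentiableOn one_ne_zero) hr.2 hu').mono
        inter_subset_right) (fun r hr => ?_) ((convex_ball p δ).inter hc)
      ⟨Metric.mem_ball_self hδ, hp⟩ hq
    have := hvk r (hδv hr) u hu'
    rw [mem_ofPred_eq, dist_eq_norm] at this
    exact this.le
  · rw [abs_of_pos (sub_pos.2 hab)]
    field_simp [(sub_pos.2 hab).ne']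

lemma contDiffOn_integral_nat (hP : UniqueDiffOn ℝ P) (hc : Convex ℝ P) (hab : a < b) (n : ℕ) :
    ∀ {V : Type} [NormedAddCommGroup V] [NormedSpace ℝ V] {f : E × ℝ → V},
      ContDiffOn ℝ (n + 1) f (P ×ˢ Icc a b) →
      ContDiffOn ℝ n (fun p => ∫ u in a..b, f (p, u)) P := by
  induction n with
  | zero =>
    intro V _ _ f hf
    refine contDiffOn_zero.2 fun p hp => ?_
    exact (hasFDerivWithinAt_integral hP hc hab (by simpa using hf) hp).continuousWithinAt
  | succ n ih =>
    intro V _ _ f hf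
    have hd := fun {p} (hp : p ∈ P) => hasFDerivWithinAt_integral hP hc hab
      (hf.of_le (by push_cast; exact le_add_self)) hp
    push_cast
    refine contDiffOn_succ_of_fderivWithin (fun p hp => (hd hp).differentiableWithinAt) (by simp) ?_
    have hD : ContDiffOn ℝ (n + 1) (paramDeriv P a b f) (P ×ˢ Icc a b) :=
      (hf.fderivWithin (uniqueDiffOn_prod_Icc hP hab) (by push_cast; exact le_rfl)).clm_comp
        contDiffOn_const
    exact (ih hD).congr fun p hp => (hd hp).fderivWithin (hP p hp)

lemma contDiffOn_integral (hP : UniqueDiffOn ℝ P) (hc : Convex ℝ P) (hab : a < b) {f : E × ℝ → V}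
    (hf : ContDiffOn ℝ ∞ f (P ×ˢ Icc a b)) :
    ContDiffOn ℝ ∞ (fun p => ∫ u in a..b, f (p, u)) P :=
  contDiffOn_infty.2 fun n => contDiffOn_integral_nat hP hc hab n
    (hf.of_le (by exact_mod_cast le_top))

lemma pderiv_integral (hP : UniqueDiffOn ℝ P) (hc : Convex ℝ P) (hab : a < b) {f : E × ℝ → V}
    (hf : ContDiffOn ℝ ∞ f (P ×ˢ Icc a b)) (v : E) {p : E} (hp : p ∈ P) :
    pderiv P v (fun p => ∫ u in a..b, f (p, u)) p
      = ∫ u in a..b, pderiv (P ×ˢ Icc a b) (v, 0) f (p, u) := by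
  have hf1 : ContDiffOn ℝ 1 f (P ×ˢ Icc a b) := hf.of_le (by norm_num)
  have hD : ContinuousOn (paramDeriv P a b f) (P ×ˢ Icc a b) :=
    (hf1.continuousOn_fderivWithin (uniqueDiffOn_prod_Icc hP hab) le_rfl).clm_comp continuousOn_const
  rw [pderiv, (hasFDerivWithinAt_integral hP hc hab hf1 hp).fderivWithin (hP p hp),
    ContinuousLinearMap.intervalIntegral_apply (intervalIntegrable_of_continuousOn_prod hD hab.le hp)]
  rfl

/-- Primitives of smooth functions depend smoothly on parameters. -/
lemma contDiffOn_primitive (hP : UniqueDiffOn ℝ P) (hc : Convex ℝ P) (hb : 0 < b) {f : E × ℝ → V}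
    (hf : ContDiffOn ℝ ∞ f (P ×ˢ Icc 0 b)) :
    ContDiffOn ℝ ∞ (fun e : E × ℝ => ∫ τ in (0 : ℝ)..e.2, f (e.1, τ)) (P ×ˢ Icc 0 b) := by
  have h1 : ContDiffOn ℝ ∞ (fun w : (E × ℝ) × ℝ => f (w.1.1, w.1.2 * w.2))
      ((P ×ˢ Icc 0 b) ×ˢ Icc 0 1) := by
    refine ContDiffOn.comp (g := f) (t := P ×ˢ Icc 0 b)
      (f := fun w : (E × ℝ) × ℝ => (w.1.1, w.1.2 * w.2)) hf
      (ContDiff.contDiffOn (by fun_prop)) ?_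
    rintro ⟨⟨e, θ⟩, u⟩ ⟨⟨he, hθ⟩, hu⟩
    exact ⟨he, mul_nonneg hθ.1 hu.1, (mul_le_of_le_one_right hθ.1 hu.2).trans hθ.2⟩
  have h2 := contDiffOn_integral (uniqueDiffOn_prod_Icc hP hb) (hc.prod (convex_Icc 0 b))
    zero_lt_one h1
  have h3 : ContDiffOn ℝ ∞ (fun e : E × ℝ => e.2 • ∫ u in (0 : ℝ)..1, f (e.1, e.2 * u))
      (P ×ˢ Icc 0 b) := contDiffOn_snd.smul h2
  refine h3.congr fun e _ => ?_
  rw [intervalIntegral.smul_integral_comp_mul_left (fun τ => f (e.1, τ))]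
  simp

end Calculus

end
end H2Curves

namespace H2Curves

open scoped Topology
open MeasureTheory

noncomputable section

/-! ### The `R`-transform -/

lemma uniqueDiffOn_M : UniqueDiffOn ℝ M := uniqueDiffOn_Icc Real.two_pi_pos

lemma zero_mem_M : (0 : ℝ) ∈ M := ⟨le_rfl, Real.two_pi_pos.le⟩

section Interval

variable {V : Type} [NormedAddCommGroup V] [NormedSpace ℝ V] {b : ℝ}

lemma eqOn_Icc_of_hasDerivWithinAt {f g f' : ℝ → V} (hb : 0 < b)
    (hf : ∀ t ∈ Icc 0 b, HasDerivWithinAt f (f' t) (Icc 0 b) t)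
    (hg : ∀ t ∈ Icc 0 b, HasDerivWithinAt g (f' t) (Icc 0 b) t) (h0 : f 0 = g 0) :
    EqOn f g (Icc 0 b) :=
  eq_of_derivWithin_eq (fun t ht => (hf t ht).differentiableWithinAt)
    (fun t ht => (hg t ht).differentiableWithinAt)
    (fun t ht => by
      have ht' : t ∈ Icc 0 b := Ico_subset_Icc_self ht
      rw [(hf t ht').derivWithin (uniqueDiffOn_Icc hb t ht'),
        (hg t ht').derivWithin (uniqueDiffOn_Icc hb t ht')]) h0

lemma hasDerivWithinAt_integral_Icc [CompleteSpace V] {f : ℝ → V} (hb : 0 ≤ b)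
    (hf : ContinuousOn f (Icc 0 b)) {t : ℝ} (ht : t ∈ Icc 0 b) :
    HasDerivWithinAt (fun t => ∫ s in (0 : ℝ)..t, f s) (f t) (Icc 0 b) t := by
  set f' : ℝ → V := IccExtend hb ((Icc 0 b).domRestrict f) with hf'
  have hc : Continuous f' := (continuousOn_iff_continuous_domRestrict.1 hf).Icc_extend'
  have heq : ∀ s ∈ Icc 0 b, f' s = f s := fun s hs => by rw [hf', IccExtend_of_mem _ _ hs]; rfl
  have h1 := (hc.integral_hasStrictDerivAt 0 t).hasDerivAt.hasDerivWithinAt (s := Icc 0 b)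
  rw [heq t ht] at h1
  have h2 : ∀ s ∈ Icc 0 b, ∫ r in (0 : ℝ)..s, f r = ∫ r in (0 : ℝ)..s, f' r := fun s hs =>
    intervalIntegral.integral_congr fun r hr => by
      rw [uIcc_of_le hs.1] at hr
      exact (heq r ⟨hr.1, hr.2.trans hs.2⟩).symm
  exact h1.congr h2 (h2 t ht)

end Interval

section Parameters

variable {E V : Type} [NormedAddCommGroup E] [NormedSpace ℝ E] [NormedAddCommGroup V]
  [NormedSpace ℝ V] {P : Set E}

lemma hasDerivWithinAt_angular {f : E × ℝ → V} (hf : ContDiffOn ℝ ∞ f (P ×ˢ M)) {e : E}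
    (he : e ∈ P) {θ : ℝ} (hθ : θ ∈ M) :
    HasDerivWithinAt (fun θ => f (e, θ)) (pderiv (P ×ˢ M) (0, 1) f (e, θ)) M θ :=
  hasDerivWithinAt_pderiv hf (l := fun θ => (e, θ))
    ((hasDerivWithinAt_const θ M e).prodMk (hasDerivWithinAt_id θ M)) (fun _ h => ⟨he, h⟩) hθ

lemma dθ_eq_pderiv {C : E → ℝ → ℂ} (hC : ContDiffOn ℝ ∞ (fun w : E × ℝ => C w.1 w.2) (P ×ˢ M))
    {w : E × ℝ} (hw : w ∈ P ×ˢ M) :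
    dθ (C w.1) w.2 = pderiv (P ×ˢ M) (0, 1) (fun w : E × ℝ => C w.1 w.2) w :=
  (hasDerivWithinAt_angular hC hw.1 hw.2).derivWithin (uniqueDiffOn_M _ hw.2)

lemma contDiffOn_dθ (hP : UniqueDiffOn ℝ P) {C : E → ℝ → ℂ}
    (hC : ContDiffOn ℝ ∞ (fun w : E × ℝ => C w.1 w.2) (P ×ˢ M)) :
    ContDiffOn ℝ ∞ (fun w : E × ℝ => dθ (C w.1) w.2) (P ×ˢ M) :=
  (contDiffOn_pderiv (hP.prod uniqueDiffOn_M) hC (0, 1)).congr fun _ hw => dθ_eq_pderiv hC hw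

lemma contDiffOn_Ds (hP : UniqueDiffOn ℝ P) {C H : E → ℝ → ℂ}
    (hC : ContDiffOn ℝ ∞ (fun w : E × ℝ => C w.1 w.2) (P ×ˢ M))
    (hH : ContDiffOn ℝ ∞ (fun w : E × ℝ => H w.1 w.2) (P ×ˢ M))
    (hi : ∀ e ∈ P, ∀ θ ∈ M, dθ (C e) θ ≠ 0) :
    ContDiffOn ℝ ∞ (fun w : E × ℝ => Ds (C w.1) (H w.1) w.2) (P ×ˢ M) := by
  have h1 := ((contDiffOn_dθ hP hC).norm ℝ fun w hw => hi w.1 hw.1 w.2 hw.2).inv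
    fun w hw => (norm_pos_iff.2 (hi w.1 hw.1 w.2 hw.2)).ne'
  exact (Complex.ofRealCLM.contDiff.comp_contDiffOn h1).mul (contDiffOn_dθ hP hH)

lemma contDiffOn_R (hP : UniqueDiffOn ℝ P) {C : E → ℝ → ℂ}
    (hC : ContDiffOn ℝ ∞ (fun w : E × ℝ => C w.1 w.2) (P ×ˢ M))
    (hi : ∀ e ∈ P, ∀ θ ∈ M, dθ (C e) θ ≠ 0) :
    ContDiffOn ℝ ∞ (fun w : E × ℝ => R (C w.1) w.2) (P ×ˢ M) := by
  have hρ := (contDiffOn_dθ hP hC).norm ℝ fun w hw => hi w.1 hw.1 w.2 hw.2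
  have hv : ContDiffOn ℝ ∞ (fun w : E × ℝ => tangent (C w.1) w.2) (P ×ˢ M) :=
    contDiffOn_Ds (C := C) (H := C) hP hC hC hi
  have hn : ContDiffOn ℝ ∞ (fun w : E × ℝ => normal (C w.1) w.2) (P ×ˢ M) :=
    contDiffOn_const.mul hv
  have hκ : ContDiffOn ℝ ∞ (fun w : E × ℝ => curvature (C w.1) w.2) (P ×ˢ M) := by
    unfold curvature
    have h := contDiffOn_Ds (C := C) (H := fun e => tangent (C e)) hP hC hv hi
    exact h.inner ℝ hn
  have h0 : ContDiffOn ℝ ∞ (fun w : E × ℝ => √‖dθ (C w.1) w.2‖) (P ×ˢ M) :=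
    hρ.sqrt fun w hw => (norm_pos_iff.2 (hi w.1 hw.1 w.2 hw.2)).ne'
  have h1 : ContDiffOn ℝ ∞ (fun w : E × ℝ => curvature (C w.1) w.2 * ‖dθ (C w.1) w.2‖ ^ 2)
      (P ×ˢ M) := hκ.mul (hρ.pow 2)
  exact contDiffOn_pi.2 (Fin.forall_fin_two.2 ⟨h0, h1⟩)

/-- The turning angle `∫₀^θ q₂ / q₁²`. -/
def turning (q : ℝ → Fin 2 → ℝ) (θ : ℝ) : ℝ := ∫ τ in (0 : ℝ)..θ, q τ 1 / (q τ 0) ^ 2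

/-- The integrand of `R⁻¹`. -/
def hodograph (q : ℝ → Fin 2 → ℝ) (θ : ℝ) : ℂ :=
  (((q θ 0) ^ 2 : ℝ) : ℂ) * Complex.exp (Complex.I * (turning q θ : ℂ))

lemma contDiffOn_turning (hP : UniqueDiffOn ℝ P) (hc : Convex ℝ P) {q : E → ℝ → Fin 2 → ℝ}
    (hq : ContDiffOn ℝ ∞ (fun w : E × ℝ => q w.1 w.2) (P ×ˢ M))
    (hpos : ∀ e ∈ P, ∀ θ ∈ M, q e θ ∈ halfPlane) :
    ContDiffOn ℝ ∞ (fun w : E × ℝ => turning (q w.1) w.2) (P ×ˢ M) := by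
  have h := contDiffOn_pi.1 hq
  exact contDiffOn_primitive hP hc Real.two_pi_pos
    ((h 1).div ((h 0).pow 2) fun w hw => (pow_pos (hpos w.1 hw.1 w.2 hw.2) 2).ne')

lemma contDiffOn_hodograph (hP : UniqueDiffOn ℝ P) (hc : Convex ℝ P) {q : E → ℝ → Fin 2 → ℝ}
    (hq : ContDiffOn ℝ ∞ (fun w : E × ℝ => q w.1 w.2) (P ×ˢ M))
    (hpos : ∀ e ∈ P, ∀ θ ∈ M, q e θ ∈ halfPlane) :
    ContDiffOn ℝ ∞ (fun w : E × ℝ => hodograph (q w.1) w.2) (P ×ˢ M) :=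
  (Complex.ofRealCLM.contDiff.comp_contDiffOn ((contDiffOn_pi.1 hq 0).pow 2)).mul
    (contDiffOn_const.mul (Complex.ofRealCLM.contDiff.comp_contDiffOn
      (contDiffOn_turning hP hc hq hpos))).cexp

lemma contDiffOn_Rinv (hP : UniqueDiffOn ℝ P) (hc : Convex ℝ P) {q : E → ℝ → Fin 2 → ℝ}
    (hq : ContDiffOn ℝ ∞ (fun w : E × ℝ => q w.1 w.2) (P ×ˢ M))
    (hpos : ∀ e ∈ P, ∀ θ ∈ M, q e θ ∈ halfPlane) :
    ContDiffOn ℝ ∞ (fun w : E × ℝ => Rinv (q w.1) w.2) (P ×ˢ M) :=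
  contDiffOn_primitive hP hc Real.two_pi_pos (contDiffOn_hodograph hP hc hq hpos)

end Parameters

lemma contDiffOn_of_param {V : Type} [NormedAddCommGroup V] [NormedSpace ℝ V] {f : ℝ × ℝ → V}
    (hf : ContDiffOn ℝ ∞ f (univ ×ˢ M)) : ContDiffOn ℝ ∞ (fun θ => f (0, θ)) M :=
  hf.comp (ContDiff.contDiffOn (by fun_prop)) fun _ h => ⟨mem_univ _, h⟩

lemma contDiffOn_const_param {V : Type} [NormedAddCommGroup V] [NormedSpace ℝ V] {f : ℝ → V}
    (hf : ContDiffOn ℝ ∞ f M) : ContDiffOn ℝ ∞ (fun w : ℝ × ℝ => f w.2) (univ ×ˢ M) :=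
  hf.comp contDiffOn_snd fun _ h => h.2

lemma inner_mul_exp (a : ℂ) (α : ℝ) :
    inner ℝ (a * Complex.exp (Complex.I * α)) (Complex.exp (Complex.I * α)) = a.re := by
  have h : (starRingEnd ℂ) (Complex.exp (Complex.I * α)) * Complex.exp (Complex.I * α) = 1 := by
    rw [← Complex.normSq_eq_conj_mul_self, Complex.normSq_eq_norm_sq,
      Complex.norm_exp_I_mul_ofReal]
    simp
  rw [Complex.inner, map_mul]
  calc _ = (starRingEnd ℂ a * (starRingEnd ℂ (Complex.exp (Complex.I * α))
        * Complex.exp (Complex.I * α))).re := by ring_nf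
    _ = _ := by rw [h]; simp

lemma inner_mul_exp_normal (a : ℂ) (α : ℝ) :
    inner ℝ (a * Complex.exp (Complex.I * α)) (Complex.I * Complex.exp (Complex.I * α)) = a.im := by
  have h : (starRingEnd ℂ) (Complex.exp (Complex.I * α)) * Complex.exp (Complex.I * α) = 1 := by
    rw [← Complex.normSq_eq_conj_mul_self, Complex.normSq_eq_norm_sq,
      Complex.norm_exp_I_mul_ofReal]
    simp
  rw [Complex.inner, map_mul]
  calc _ = (starRingEnd ℂ a * Complex.I * (starRingEnd ℂ (Complex.exp (Complex.I * α))
        * Complex.exp (Complex.I * α))).re := by ring_nf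
    _ = _ := by rw [h]; simp

section Curve

variable {q : ℝ → Fin 2 → ℝ} {θ : ℝ}

lemma hasDerivWithinAt_turning (hq : ContDiffOn ℝ ∞ q M) (hpos : ∀ θ ∈ M, q θ ∈ halfPlane)
    (hθ : θ ∈ M) : HasDerivWithinAt (turning q) (q θ 1 / (q θ 0) ^ 2) M θ := by
  have h := contDiffOn_pi.1 hq
  exact hasDerivWithinAt_integral_Icc (f := fun τ => q τ 1 / (q τ 0) ^ 2) Real.two_pi_pos.le
    ((h 1).div ((h 0).pow 2) fun w hw => (pow_pos (hpos w hw) 2).ne').continuousOn hθ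

lemma hasDerivWithinAt_exp_turning (hq : ContDiffOn ℝ ∞ q M) (hpos : ∀ θ ∈ M, q θ ∈ halfPlane)
    (hθ : θ ∈ M) : HasDerivWithinAt (fun θ => Complex.exp (Complex.I * (turning q θ : ℂ)))
      (Complex.I * (q θ 1 / (q θ 0) ^ 2 : ℝ) * Complex.exp (Complex.I * (turning q θ : ℂ))) M θ := by
  have := ((hasDerivWithinAt_turning hq hpos hθ).ofReal_comp.const_mul Complex.I).cexp
  refine this.congr_deriv ?_
  ring

lemma continuousOn_hodograph (hq : ContDiffOn ℝ ∞ q M) (hpos : ∀ θ ∈ M, q θ ∈ halfPlane) :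
    ContinuousOn (hodograph q) M :=
  (contDiffOn_of_param (contDiffOn_hodograph (q := fun _ => q) uniqueDiffOn_univ convex_univ
    (contDiffOn_const_param hq) fun _ _ => hpos)).continuousOn

lemma hasDerivWithinAt_Rinv (hq : ContDiffOn ℝ ∞ q M) (hpos : ∀ θ ∈ M, q θ ∈ halfPlane)
    (hθ : θ ∈ M) : HasDerivWithinAt (Rinv q) (hodograph q θ) M θ :=
  hasDerivWithinAt_integral_Icc Real.two_pi_pos.le (continuousOn_hodograph hq hpos) hθ

lemma dθ_Rinv (hq : ContDiffOn ℝ ∞ q M) (hpos : ∀ θ ∈ M, q θ ∈ halfPlane)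
    (hθ : θ ∈ M) : dθ (Rinv q) θ = hodograph q θ :=
  (hasDerivWithinAt_Rinv hq hpos hθ).derivWithin (uniqueDiffOn_M θ hθ)

lemma norm_hodograph (q : ℝ → Fin 2 → ℝ) (θ : ℝ) : ‖hodograph q θ‖ = q θ 0 ^ 2 := by
  rw [hodograph, norm_mul, Complex.norm_exp_I_mul_ofReal, Complex.norm_real,
    Real.norm_of_nonneg (sq_nonneg _), mul_one]

lemma tangent_Rinv (hq : ContDiffOn ℝ ∞ q M) (hpos : ∀ θ ∈ M, q θ ∈ halfPlane)
    (hθ : θ ∈ M) : tangent (Rinv q) θ = Complex.exp (Complex.I * (turning q θ : ℂ)) := by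
  have h0 : (q θ 0 : ℂ) ≠ 0 := Complex.ofReal_ne_zero.2 (hpos θ hθ).ne'
  rw [tangent, Ds, dθ_Rinv hq hpos hθ, norm_hodograph, hodograph]
  push_cast
  field_simp

lemma curvature_Rinv (hq : ContDiffOn ℝ ∞ q M) (hpos : ∀ θ ∈ M, q θ ∈ halfPlane)
    (hθ : θ ∈ M) : curvature (Rinv q) θ = q θ 1 / q θ 0 ^ 4 := by
  have h0 : q θ 0 ≠ 0 := (hpos θ hθ).ne'
  have hd : dθ (tangent (Rinv q)) θ = Complex.I * (q θ 1 / (q θ 0) ^ 2 : ℝ)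
      * Complex.exp (Complex.I * (turning q θ : ℂ)) :=
    ((hasDerivWithinAt_exp_turning hq hpos hθ).congr (fun τ hτ => tangent_Rinv hq hpos hτ)
      (tangent_Rinv hq hpos hθ)).derivWithin (uniqueDiffOn_M θ hθ)
  rw [curvature, Ds, normal, hd, tangent_Rinv hq hpos hθ, dθ_Rinv hq hpos hθ, norm_hodograph,
    ← mul_assoc, inner_mul_exp_normal]
  rw [← mul_assoc, mul_comm _ Complex.I, mul_assoc, ← Complex.ofReal_mul, Complex.I_mul_im,
    Complex.ofReal_re]
  field_simp

lemma isImmMot_Rinv (hq : ContDiffOn ℝ ∞ q M) (hpos : ∀ θ ∈ M, q θ ∈ halfPlane) :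
    IsImmMot (Rinv q) where
  smooth := contDiffOn_of_param (contDiffOn_Rinv (q := fun _ => q) uniqueDiffOn_univ convex_univ
    (contDiffOn_const_param hq) fun _ _ => hpos)
  immersion θ hθ := by
    rw [dθ_Rinv hq hpos hθ, ← norm_ne_zero_iff, norm_hodograph]
    exact (pow_pos (hpos θ hθ) 2).ne'
  base := by simp [Rinv]
  angle := by rw [tangent_Rinv hq hpos zero_mem_M]; simp [turning]

lemma R_Rinv (hq : ContDiffOn ℝ ∞ q M) (hpos : ∀ θ ∈ M, q θ ∈ halfPlane) (hθ : θ ∈ M) :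
    R (Rinv q) θ = q θ := by
  have h0 : 0 < q θ 0 := hpos θ hθ
  rw [R, curvature_Rinv hq hpos hθ, dθ_Rinv hq hpos hθ, norm_hodograph, Real.sqrt_sq h0.le,
    ← vec_eta (q θ)]
  simp only [Matrix.cons_val_zero, Matrix.cons_val_one]
  congr 1
  field_simp

lemma turning_congr {r : ℝ → Fin 2 → ℝ} (h : EqOn q r M) : EqOn (turning q) (turning r) M :=
  fun θ hθ => intervalIntegral.integral_congr fun τ hτ => by
    rw [uIcc_of_le hθ.1] at hτ
    simp only [h ⟨hτ.1, hτ.2.trans hθ.2⟩]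

lemma Rinv_congr {r : ℝ → Fin 2 → ℝ} (h : EqOn q r M) : EqOn (Rinv q) (Rinv r) M :=
  fun θ hθ => intervalIntegral.integral_congr fun τ hτ => by
    rw [uIcc_of_le hθ.1] at hτ
    have hτ' : τ ∈ M := ⟨hτ.1, hτ.2.trans hθ.2⟩
    have := turning_congr h hτ'
    unfold turning at this
    simp only [h hτ', this]

end Curve

lemma dθ_congr {c d : ℝ → ℂ} (h : EqOn c d M) : EqOn (dθ c) (dθ d) M :=
  fun _ hθ => derivWithin_congr h (h hθ)

lemma Ds_congr {c d h k : ℝ → ℂ} (hc : EqOn c d M) (hh : EqOn h k M) :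
    EqOn (Ds c h) (Ds d k) M :=
  fun θ hθ => by rw [Ds, Ds, dθ_congr hc hθ, dθ_congr hh hθ]

lemma R_congr {c d : ℝ → ℂ} (h : EqOn c d M) : EqOn (R c) (R d) M := fun θ hθ => by
  have h1 := dθ_congr h hθ
  have h2 : EqOn (tangent c) (tangent d) M := Ds_congr h h
  rw [R, R, curvature, curvature, normal, normal, h1, h2 hθ, Ds_congr h h2 hθ]

namespace IsImmMot

variable {c : ℝ → ℂ}

lemma contDiffOn_R (h : IsImmMot c) : ContDiffOn ℝ ∞ (R c) M :=
  contDiffOn_of_param (H2Curves.contDiffOn_R (C := fun _ => c) uniqueDiffOn_univ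
    (contDiffOn_const_param h.smooth) fun _ _ => h.immersion)

lemma contDiffOn_tangent (h : IsImmMot c) : ContDiffOn ℝ ∞ (tangent c) M :=
  contDiffOn_of_param (contDiffOn_Ds (C := fun _ => c) (H := fun _ => c) uniqueDiffOn_univ
    (contDiffOn_const_param h.smooth) (contDiffOn_const_param h.smooth) fun _ _ => h.immersion)

lemma R_mem (h : IsImmMot c) {θ : ℝ} (hθ : θ ∈ M) : R c θ ∈ halfPlane :=
  Real.sqrt_pos.2 (norm_pos_iff.2 (h.immersion θ hθ))

lemma norm_tangent (h : IsImmMot c) {θ : ℝ} (hθ : θ ∈ M) : ‖tangent c θ‖ = 1 := by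
  have := norm_pos_iff.2 (h.immersion θ hθ)
  rw [tangent, Ds, norm_mul, Complex.norm_real, norm_inv, norm_norm, inv_mul_cancel₀ this.ne']

/-- The Frenet equation. -/
lemma dθ_tangent (h : IsImmMot c) {θ : ℝ} (hθ : θ ∈ M) :
    dθ (tangent c) θ = Complex.I * (curvature c θ * ‖dθ c θ‖ : ℝ) * tangent c θ := by
  have hρ := norm_pos_iff.2 (h.immersion θ hθ)
  have hd : HasDerivWithinAt (tangent c) (dθ (tangent c) θ) M θ :=
    (h.contDiffOn_tangent.differentiableOn (by norm_num) θ hθ).hasDerivWithinAt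
  have h1 : inner ℝ (tangent c θ) (dθ (tangent c) θ) = 0 := by
    have h2 := hd.norm_sq
    have h3 : HasDerivWithinAt (fun θ => ‖tangent c θ‖ ^ 2) 0 M θ :=
      (hasDerivWithinAt_const θ M (1 : ℝ)).congr (fun τ hτ => by rw [h.norm_tangent hτ, one_pow])
        (by rw [h.norm_tangent hθ, one_pow])
    have := (uniqueDiffOn_M θ hθ).eq_deriv _ h2 h3
    linarith
  have h2 : curvature c θ * ‖dθ c θ‖ = inner ℝ (dθ (tangent c) θ) (Complex.I * tangent c θ) := by
    rw [curvature, Ds, normal, ← Complex.real_smul, real_inner_smul_left]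
    field_simp
  have h3 : (tangent c θ).re * (tangent c θ).re + (tangent c θ).im * (tangent c θ).im = 1 := by
    rw [← Complex.normSq_apply, Complex.normSq_eq_norm_sq, h.norm_tangent hθ, one_pow]
  rw [h2]
  generalize tangent c θ = v at *
  generalize dθ (tangent c) θ = w at *
  rw [Complex.inner] at h1 ⊢
  simp only [Complex.mul_re, Complex.conj_re, Complex.conj_im] at h1
  apply Complex.ext
  · simp
    linear_combination (-w.re) * h3 + v.re * h1
  · simp
    linear_combination (-w.im) * h3 + v.im * h1

lemma tangent_eq (h : IsImmMot c) {θ : ℝ} (hθ : θ ∈ M) :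
    tangent c θ = Complex.exp (Complex.I * (turning (R c) θ : ℂ)) := by
  have hpos : ∀ θ ∈ M, R c θ ∈ halfPlane := fun θ hθ => h.R_mem hθ
  have hw : EqOn (fun θ => tangent c θ * Complex.exp (-(Complex.I * (turning (R c) θ : ℂ))))
      (fun _ => 1) M := by
    refine eqOn_Icc_of_hasDerivWithinAt (f' := fun _ => 0) Real.two_pi_pos (fun τ hτ => ?_)
      (fun τ _ => hasDerivWithinAt_const τ M 1) (by simp [h.angle, turning])
    have hd : HasDerivWithinAt (tangent c) (dθ (tangent c) τ) M τ :=
      (h.contDiffOn_tangent.differentiableOn (by norm_num) τ hτ).hasDerivWithinAt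
    have h1 := hd.mul (((hasDerivWithinAt_turning h.contDiffOn_R hpos
      hτ).ofReal_comp.const_mul Complex.I).neg.cexp)
    refine h1.congr_deriv ?_
    have hρ := norm_pos_iff.2 (h.immersion τ hτ)
    have e : R c τ 1 / R c τ 0 ^ 2 = curvature c τ * ‖dθ c τ‖ := by
      simp only [R, Matrix.cons_val_zero, Matrix.cons_val_one]
      rw [Real.sq_sqrt hρ.le]
      field_simp
    rw [h.dθ_tangent hτ, e]
    ring
  have := hw hθ
  simp only [Complex.exp_neg] at this
  rw [mul_inv_eq_one₀ (Complex.exp_ne_zero _)] at this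
  exact this

lemma dθ_eq (h : IsImmMot c) {θ : ℝ} (hθ : θ ∈ M) : dθ c θ = hodograph (R c) θ := by
  have hρ := norm_pos_iff.2 (h.immersion θ hθ)
  rw [hodograph, ← h.tangent_eq hθ, tangent, Ds, R]
  simp only [Matrix.cons_val_zero]
  rw [Real.sq_sqrt hρ.le]
  have : ((‖dθ c θ‖ : ℝ) : ℂ) ≠ 0 := Complex.ofReal_ne_zero.2 hρ.ne'
  push_cast
  field_simp

lemma Rinv_R (h : IsImmMot c) : EqOn (Rinv (R c)) c M := by
  refine eqOn_Icc_of_hasDerivWithinAt (f' := hodograph (R c)) Real.two_pi_pos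
    (fun τ hτ => hasDerivWithinAt_Rinv h.contDiffOn_R (fun θ hθ => h.R_mem hθ) hτ) (fun τ hτ => ?_)
    (by rw [h.base]; simp [Rinv])
  rw [← h.dθ_eq hτ]
  exact (h.smooth.differentiableOn (by norm_num) τ hτ).hasDerivWithinAt

end IsImmMot

end
end H2Curves

namespace H2Curves

open scoped Topology
open MeasureTheory

noncomputable section

/-! ### The metric `G` in the coordinates given by `R` -/

lemma uniqueDiffOn_TM : UniqueDiffOn ℝ (T ×ˢ M) := uniqueDiffOn_T.prod uniqueDiffOn_M

lemma T_subset_closure : T ⊆ closure (interior T) := by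
  rw [interior_Icc, closure_Ioo zero_ne_one]

lemma M_subset_closure : M ⊆ closure (interior M) := by
  rw [interior_Icc, closure_Ioo Real.two_pi_pos.ne]

lemma prod_subset_closure {X Y : Type} [TopologicalSpace X] [TopologicalSpace Y] {s : Set X}
    {t : Set Y} (hs : s ⊆ closure (interior s)) (ht : t ⊆ closure (interior t)) :
    s ×ˢ t ⊆ closure (interior (s ×ˢ t)) := by
  rw [interior_prod_eq, closure_prod_eq]
  exact prod_mono hs ht

lemma hasDerivWithinAt_time {V : Type} [NormedAddCommGroup V] [NormedSpace ℝ V] {f : ℝ × ℝ → V}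
    (hf : ContDiffOn ℝ ∞ f (T ×ˢ M)) {t θ : ℝ} (ht : t ∈ T) (hθ : θ ∈ M) :
    HasDerivWithinAt (fun s => f (s, θ)) (pderiv (T ×ˢ M) (1, 0) f (t, θ)) T t :=
  hasDerivWithinAt_pderiv hf (l := fun s => (s, θ))
    ((hasDerivWithinAt_id t T).prodMk (hasDerivWithinAt_const t T θ)) (fun _ h => ⟨h, hθ⟩) ht

namespace IsPath

variable {c : ℝ → ℝ → ℂ}

/-- The `R`-transform of a path of curves. -/
def transform (c : ℝ → ℝ → ℂ) (w : ℝ × ℝ) : Fin 2 → ℝ := R (c w.1) w.2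

lemma contDiffOn_transform (h : IsPath c) : ContDiffOn ℝ ∞ (transform c) (T ×ˢ M) :=
  contDiffOn_R uniqueDiffOn_T h.smooth fun t ht => (h.mem t ht).immersion

lemma transform_mem (h : IsPath c) {w : ℝ × ℝ} (hw : w ∈ T ×ˢ M) : transform c w ∈ halfPlane :=
  (h.mem w.1 hw.1).R_mem hw.2

lemma isPlanePath (h : IsPath c) {θ : ℝ} (hθ : θ ∈ M) : IsPlanePath fun t => transform c (t, θ) where
  smooth := h.contDiffOn_transform.comp (ContDiff.contDiffOn (by fun_prop)) fun _ ht => ⟨ht, hθ⟩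
  mem _ ht := h.transform_mem ⟨ht, hθ⟩

lemma velocity_eq (h : IsPath c) {t θ : ℝ} (ht : t ∈ T) (hθ : θ ∈ M) :
    velocity (fun s => transform c (s, θ)) t = pderiv (T ×ˢ M) (1, 0) (transform c) (t, θ) :=
  (hasDerivWithinAt_time h.contDiffOn_transform ht hθ).derivWithin (uniqueDiffOn_T t ht)

/-- The integrand of `G(c_t, c_t)`. -/
lemma integrand_eq (h : IsPath c) {t θ : ℝ} (ht : t ∈ T) (hθ : θ ∈ M) :
    (inner ℝ (Ds (c t) (pathVelocity c t) θ) (tangent (c t) θ)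
        * inner ℝ (Ds (c t) (pathVelocity c t) θ) (tangent (c t) θ)
      + inner ℝ (Ds (c t) (Ds (c t) (pathVelocity c t)) θ) (normal (c t) θ)
        * inner ℝ (Ds (c t) (Ds (c t) (pathVelocity c t)) θ) (normal (c t) θ)) * ‖dθ (c t) θ‖
      = gInner (transform c (t, θ)) (velocity (fun s => transform c (s, θ)) t)
        (velocity (fun s => transform c (s, θ)) t) := by
  set Ω : Set (ℝ × ℝ) := T ×ˢ M with hΩ
  set f := transform c with hf
  have hfs : ContDiffOn ℝ ∞ f Ω := h.contDiffOn_transform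
  set ft := pderiv Ω (1, 0) f with hft
  have hfts : ContDiffOn ℝ ∞ ft Ω := contDiffOn_pderiv uniqueDiffOn_TM hfs _
  set α : ℝ × ℝ → ℝ := fun w => turning (R (c w.1)) w.2 with hα
  have hαs : ContDiffOn ℝ ∞ α Ω := contDiffOn_turning uniqueDiffOn_T (convex_Icc 0 1) hfs
    fun t ht θ hθ => h.transform_mem (w := (t, θ)) ⟨ht, hθ⟩
  set αt := pderiv Ω (1, 0) α with hαt
  have hαts : ContDiffOn ℝ ∞ αt Ω := contDiffOn_pderiv uniqueDiffOn_TM hαs _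
  have hαθ : ∀ w ∈ Ω, pderiv Ω (0, 1) α w = f w 1 / f w 0 ^ 2 := fun w hw => by
    have h1 := hasDerivWithinAt_angular hαs hw.1 hw.2
    exact (uniqueDiffOn_M w.2 hw.2).eq_deriv _ h1 (hasDerivWithinAt_turning
      (h.mem w.1 hw.1).contDiffOn_R (fun θ hθ => (h.mem w.1 hw.1).R_mem hθ) hw.2)
  -- the first derivative of the velocity
  have hvel : ∀ w ∈ Ω, pathVelocity c w.1 w.2 = pderiv Ω (1, 0) (fun w => c w.1 w.2) w :=
    fun w hw => (hasDerivWithinAt_time h.smooth hw.1 hw.2).derivWithin (uniqueDiffOn_T w.1 hw.1)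
  have hcs : ContDiffOn ℝ ∞ (fun w : ℝ × ℝ => pathVelocity c w.1 w.2) Ω :=
    (contDiffOn_pderiv uniqueDiffOn_TM h.smooth (1, 0)).congr hvel
  have hdv : ∀ w ∈ Ω, dθ (pathVelocity c w.1) w.2
      = ((2 * f w 0 * ft w 0 : ℝ) + Complex.I * (f w 0 ^ 2 * αt w : ℝ))
        * Complex.exp (Complex.I * (α w : ℂ)) := fun w hw => by
    have e1 : dθ (pathVelocity c w.1) w.2
        = pderiv Ω (1, 0) (pderiv Ω (0, 1) fun w => c w.1 w.2) w := by
      rw [dθ_eq_pderiv hcs hw, pderiv_congr hvel _ hw,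
        pderiv_comm uniqueDiffOn_TM (prod_subset_closure T_subset_closure M_subset_closure)
          h.smooth _ _ hw]
    have e2 : EqOn (pderiv Ω (0, 1) fun w => c w.1 w.2)
        (fun w => ((f w 0 ^ 2 : ℝ) : ℂ) * Complex.exp (Complex.I * (α w : ℂ))) Ω := fun w hw => by
      rw [← dθ_eq_pderiv h.smooth hw, (h.mem w.1 hw.1).dθ_eq hw.2]
      rfl
    have h1 := hasDerivWithinAt_time (contDiffOn_pderiv uniqueDiffOn_TM h.smooth (0, 1)) hw.1 hw.2
    have hx := hasDerivWithinAt_pi.1 (hasDerivWithinAt_time hfs hw.1 hw.2) 0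
    have hαd := hasDerivWithinAt_time hαs hw.1 hw.2
    have h2 := (hx.pow 2).ofReal_comp.mul (hαd.ofReal_comp.const_mul Complex.I).cexp
    have h3 := h2.congr (fun s hs => e2 (x := (s, w.2)) ⟨hs, hw.2⟩) (e2 hw)
    rw [e1, (uniqueDiffOn_T w.1 hw.1).eq_deriv _ h1 h3]
    simp only [Prod.mk.eta, Pi.pow_apply]
    push_cast
    ring
  have hnorm : ∀ w ∈ Ω, ‖dθ (c w.1) w.2‖ = f w 0 ^ 2 := fun w hw => by
    rw [(h.mem w.1 hw.1).dθ_eq hw.2, norm_hodograph]; rfl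
  have hDs : ∀ w ∈ Ω, Ds (c w.1) (pathVelocity c w.1) w.2
      = ((2 * ft w 0 / f w 0 : ℝ) + Complex.I * (αt w : ℝ))
        * Complex.exp (Complex.I * (α w : ℂ)) := fun w hw => by
    have h0 : (f w 0 : ℂ) ≠ 0 := Complex.ofReal_ne_zero.2 (h.transform_mem hw).ne'
    rw [Ds, hdv w hw, hnorm w hw]
    push_cast
    field_simp
  -- the second derivative of the velocity
  have hw : (t, θ) ∈ Ω := ⟨ht, hθ⟩
  have h0 : f (t, θ) 0 ≠ 0 := (h.transform_mem hw).ne'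
  have hmix : pderiv Ω (0, 1) αt (t, θ)
      = ft (t, θ) 1 / f (t, θ) 0 ^ 2 - 2 * f (t, θ) 1 * ft (t, θ) 0 / f (t, θ) 0 ^ 3 := by
    rw [hαt, pderiv_comm uniqueDiffOn_TM (prod_subset_closure T_subset_closure M_subset_closure)
      hαs _ _ hw]
    have h1 := hasDerivWithinAt_time (contDiffOn_pderiv uniqueDiffOn_TM hαs (0, 1)) ht hθ
    have hx := hasDerivWithinAt_pi.1 (hasDerivWithinAt_time hfs ht hθ)
    have h2 := (hx 1).div ((hx 0).pow 2) (pow_ne_zero 2 h0)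
    have h3 := h2.congr (fun s hs => hαθ (s, θ) ⟨hs, hθ⟩) (hαθ _ hw)
    rw [(uniqueDiffOn_T t ht).eq_deriv _ h1 h3]
    simp only [Pi.pow_apply]
    push_cast
    field_simp
    ring
  obtain ⟨u', hu'⟩ : ∃ u', HasDerivWithinAt (fun θ => 2 * ft (t, θ) 0 / f (t, θ) 0) u' M θ := by
    have hx := hasDerivWithinAt_pi.1 (hasDerivWithinAt_angular hfs ht hθ)
    have hxt := hasDerivWithinAt_pi.1 (hasDerivWithinAt_angular hfts ht hθ)
    exact ⟨_, ((hxt 0).const_mul 2).div (hx 0) h0⟩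
  have hDs2 : dθ (Ds (c t) (pathVelocity c t)) θ
      = ((u' - αt (t, θ) * (f (t, θ) 1 / f (t, θ) 0 ^ 2) : ℝ)
        + Complex.I * (ft (t, θ) 1 / f (t, θ) 0 ^ 2 : ℝ))
        * Complex.exp (Complex.I * (α (t, θ) : ℂ)) := by
    have hαd := hasDerivWithinAt_angular hαs ht hθ
    have hαtd := hasDerivWithinAt_angular hαts ht hθ
    rw [hmix] at hαtd
    rw [hαθ _ hw] at hαd
    have h1 := (hu'.ofReal_comp.add (hαtd.ofReal_comp.const_mul Complex.I)).mul
      (hαd.ofReal_comp.const_mul Complex.I).cexp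
    have h2 := h1.congr (fun s hs => hDs (t, s) ⟨ht, hs⟩) (hDs _ hw)
    refine (h2.derivWithin (uniqueDiffOn_M θ hθ)).trans ?_
    simp only [Pi.add_apply]
    push_cast
    linear_combination (αt (t, θ) * f (t, θ) 1 / f (t, θ) 0 ^ 2
      * Complex.exp (Complex.I * (α (t, θ) : ℂ)) : ℂ) * Complex.I_sq
  have htan : tangent (c t) θ = Complex.exp (Complex.I * (α (t, θ) : ℂ)) :=
    (h.mem t ht).tangent_eq hθ
  have hDs3 : Ds (c t) (Ds (c t) (pathVelocity c t)) θ
      = ((‖dθ (c t) θ‖⁻¹ : ℝ) : ℂ) * dθ (Ds (c t) (pathVelocity c t)) θ := rfl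
  rw [hDs3, hDs2, hDs (t, θ) hw, normal, htan, hnorm (t, θ) hw,
    inner_mul_exp, ← mul_assoc, inner_mul_exp_normal, Complex.im_ofReal_mul, gInner_self,
    show velocity (fun s => f (s, θ)) t = ft (t, θ) from h.velocity_eq ht hθ]
  simp only [Complex.add_re, Complex.add_im, Complex.ofReal_re, Complex.ofReal_im,
    Complex.I_mul_re, Complex.I_mul_im, neg_zero, add_zero, zero_add]
  rw [zpow_neg]
  norm_cast
  field_simp
  ring

lemma G_eq (h : IsPath c) {t : ℝ} (ht : t ∈ T) :
    G (c t) (pathVelocity c t) (pathVelocity c t) = ∫ θ in (0 : ℝ)..(2 * Real.pi),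
      gInner (transform c (t, θ)) (velocity (fun s => transform c (s, θ)) t)
        (velocity (fun s => transform c (s, θ)) t) := by
  refine intervalIntegral.integral_congr fun θ hθ => ?_
  rw [uIcc_of_le Real.two_pi_pos.le] at hθ
  exact h.integrand_eq ht hθ

end IsPath

end
end H2Curves

namespace H2Curves

open scoped Topology
open MeasureTheory

noncomputable section

/-! ### The first variation of the energy -/

/-- The geodesic equation of `g`, with lowered index. -/
def residual (γ : ℝ → Fin 2 → ℝ) (t : ℝ) : Fin 2 → ℝ :=
  ![4 * derivWithin (velocity γ) T t 0 + 3 * (γ t 0 ^ 7)⁻¹ * velocity γ t 1 ^ 2,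
    (γ t 0 ^ 6)⁻¹ * derivWithin (velocity γ) T t 1
      - 6 * (γ t 0 ^ 7)⁻¹ * velocity γ t 0 * velocity γ t 1]

lemma IsPlanePath.isPlaneGeodesic_iff {γ : ℝ → Fin 2 → ℝ} (h : IsPlanePath γ) :
    IsPlaneGeodesic γ ↔ ∀ t ∈ T, residual γ t = 0 := by
  have key : ∀ t ∈ T, (∀ k : Fin 2, derivWithin (velocity γ) T t k
      + ∑ i, ∑ j, christoffel (γ t) k i j * velocity γ t i * velocity γ t j = 0)
        ↔ residual γ t = 0 := fun t ht => by
    have hx : 0 < γ t 0 := h.mem t ht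
    rw [Fin.forall_fin_two, sum_christoffel_zero hx, sum_christoffel_one hx, funext_iff,
      Fin.forall_fin_two]
    simp only [residual, Matrix.cons_val_zero, Matrix.cons_val_one, Pi.zero_apply, zpow_neg]
    norm_cast
    refine and_congr ⟨fun h => by linear_combination 4 * h, fun h => by linear_combination h / 4⟩ ?_
    have e : (γ t 0 ^ 6)⁻¹ * derivWithin (velocity γ) T t 1
        - 6 * (γ t 0 ^ 7)⁻¹ * velocity γ t 0 * velocity γ t 1 = (γ t 0 ^ 6)⁻¹
        * (derivWithin (velocity γ) T t 1 + -6 * velocity γ t 0 * velocity γ t 1 / γ t 0) := by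
      field_simp
      ring
    rw [e, mul_eq_zero, or_iff_right (by positivity)]
    push_cast
    rfl
  exact ⟨fun hg t ht => (key t ht).1 (hg.geodesic_eq t ht),
    fun hr => ⟨h, fun t ht => (key t ht).2 (hr t ht)⟩⟩

lemma gInner_self_inv (p h : Fin 2 → ℝ) :
    gInner p h h = 4 * h 0 ^ 2 + (p 0 ^ 6)⁻¹ * h 1 ^ 2 := by
  rw [gInner_self, zpow_neg]
  norm_cast

section Lines

variable {V : Type} [NormedAddCommGroup V] [NormedSpace ℝ V] {S : Set ℝ}

lemma hasDerivWithinAt_fst_line {f : (ℝ × ℝ) × ℝ → V} (hf : ContDiffOn ℝ ∞ f ((S ×ˢ T) ×ˢ M))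
    {σ t θ : ℝ} (hσ : σ ∈ S) (ht : t ∈ T) (hθ : θ ∈ M) :
    HasDerivWithinAt (fun s => f ((s, t), θ))
      (pderiv ((S ×ˢ T) ×ˢ M) ((1, 0), 0) f ((σ, t), θ)) S σ :=
  hasDerivWithinAt_pderiv hf (l := fun s => ((s, t), θ))
    (((hasDerivWithinAt_id σ S).prodMk (hasDerivWithinAt_const σ S t)).prodMk
      (hasDerivWithinAt_const σ S θ)) (fun _ h => ⟨⟨h, ht⟩, hθ⟩) hσ

lemma hasDerivWithinAt_snd_line {f : (ℝ × ℝ) × ℝ → V} (hf : ContDiffOn ℝ ∞ f ((S ×ˢ T) ×ˢ M))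
    {σ t θ : ℝ} (hσ : σ ∈ S) (ht : t ∈ T) (hθ : θ ∈ M) :
    HasDerivWithinAt (fun s => f ((σ, s), θ))
      (pderiv ((S ×ˢ T) ×ˢ M) ((0, 1), 0) f ((σ, t), θ)) T t :=
  hasDerivWithinAt_pderiv hf (l := fun s => ((σ, s), θ))
    (((hasDerivWithinAt_const t T σ).prodMk (hasDerivWithinAt_id t T)).prodMk
      (hasDerivWithinAt_const t T θ)) (fun _ h => ⟨⟨hσ, h⟩, hθ⟩) ht

end Lines

/-- The variation field of `C`, in the coordinates given by `R`. -/
def varField (ε : ℝ) (C : ℝ → ℝ → ℝ → ℂ) (t θ : ℝ) : Fin 2 → ℝ :=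
  derivWithin (fun σ => R (C σ t) θ) (Ioo (-ε) ε) 0

namespace IsVariation

variable {c : ℝ → ℝ → ℂ} {ε : ℝ} {C : ℝ → ℝ → ℝ → ℂ}

lemma isPath (h : IsVariation c ε C) {σ : ℝ} (hσ : σ ∈ Ioo (-ε) ε) : IsPath (C σ) where
  smooth := h.smooth.comp (ContDiff.contDiffOn (by fun_prop : ContDiff ℝ ∞
    fun p : ℝ × ℝ => (σ, p.1, p.2))) fun _ hp => ⟨hσ, hp.1, hp.2⟩
  mem := h.mem σ hσ

lemma contDiffOn_transform (h : IsVariation c ε C) :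
    ContDiffOn ℝ ∞ (fun w : (ℝ × ℝ) × ℝ => R (C w.1.1 w.1.2) w.2) ((Ioo (-ε) ε ×ˢ T) ×ˢ M) := by
  refine contDiffOn_R (C := fun e : ℝ × ℝ => C e.1 e.2) (isOpen_Ioo.uniqueDiffOn.prod uniqueDiffOn_T)
    ?_ fun e he => (h.mem e.1 he.1 e.2 he.2).immersion
  exact h.smooth.comp (ContDiff.contDiffOn (by fun_prop : ContDiff ℝ ∞
    fun w : (ℝ × ℝ) × ℝ => (w.1.1, w.1.2, w.2))) fun _ hp => ⟨hp.1.1, hp.1.2, hp.2⟩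

/-- The first variation formula. -/
lemma hasDerivAt_energy (h : IsVariation c ε C) (hε : 0 < ε) :
    HasDerivAt (fun σ => energy (C σ))
      (-∫ t in (0 : ℝ)..1, ∫ θ in (0 : ℝ)..(2 * Real.pi),
        (varField ε C t θ 0 * residual (fun s => R (c s) θ) t 0
          + varField ε C t θ 1 * residual (fun s => R (c s) θ) t 1)) 0 := by
  set S := Ioo (-ε) ε with hS
  have h0S : (0 : ℝ) ∈ S := ⟨neg_lt_zero.2 hε, hε⟩
  have hSu : UniqueDiffOn ℝ S := isOpen_Ioo.uniqueDiffOn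
  have hPu : UniqueDiffOn ℝ (S ×ˢ T) := hSu.prod uniqueDiffOn_T
  have hPc : Convex ℝ (S ×ˢ T) := (convex_Ioo _ _).prod (convex_Icc 0 1)
  set Ω : Set ((ℝ × ℝ) × ℝ) := (S ×ˢ T) ×ˢ M with hΩ
  have hΩu : UniqueDiffOn ℝ Ω := hPu.prod uniqueDiffOn_M
  have hΩi : Ω ⊆ closure (interior Ω) := by
    refine prod_subset_closure (prod_subset_closure ?_ T_subset_closure) M_subset_closure
    rw [isOpen_Ioo.interior_eq]
    exact subset_closure
  set f : (ℝ × ℝ) × ℝ → Fin 2 → ℝ := fun w => R (C w.1.1 w.1.2) w.2 with hf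
  have hfs : ContDiffOn ℝ ∞ f Ω := h.contDiffOn_transform
  set ft := pderiv Ω ((0, 1), 0) f with hft
  set fσ := pderiv Ω ((1, 0), 0) f with hfσ
  have hfts : ContDiffOn ℝ ∞ ft Ω := contDiffOn_pderiv hΩu hfs _
  have hfσs : ContDiffOn ℝ ∞ fσ Ω := contDiffOn_pderiv hΩu hfs _
  have hx0 : ∀ w ∈ Ω, f w 0 ≠ 0 := fun w hw => ((h.mem _ hw.1.1 _ hw.1.2).R_mem hw.2).ne'
  set e : (ℝ × ℝ) × ℝ → ℝ := fun w => 4 * ft w 0 ^ 2 + (f w 0 ^ 6)⁻¹ * ft w 1 ^ 2 with he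
  have cf := contDiffOn_pi.1 hfs
  have cft := contDiffOn_pi.1 hfts
  have cfσ := contDiffOn_pi.1 hfσs
  have cinv : ContDiffOn ℝ ∞ (fun w => (f w 0 ^ 6)⁻¹) Ω :=
    ((cf 0).pow 6).inv fun w hw => pow_ne_zero 6 (hx0 w hw)
  have hes : ContDiffOn ℝ ∞ e Ω :=
    (contDiffOn_const.mul ((cft 0).pow 2)).add (cinv.mul ((cft 1).pow 2))
  set B : (ℝ × ℝ) × ℝ → ℝ := fun w => 4 * ft w 0 * fσ w 0 + (f w 0 ^ 6)⁻¹ * ft w 1 * fσ w 1 with hB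
  have hBs : ContDiffOn ℝ ∞ B Ω :=
    ((contDiffOn_const.mul (cft 0)).mul (cfσ 0)).add ((cinv.mul (cft 1)).mul (cfσ 1))
  set W : ℝ × ℝ → ℝ := fun p => ∫ θ in (0 : ℝ)..(2 * Real.pi), e (p, θ) with hW
  have hWs : ContDiffOn ℝ ∞ W (S ×ˢ T) := contDiffOn_integral hPu hPc Real.two_pi_pos hes
  set Φ : ℝ × ℝ → ℝ := fun p => ∫ θ in (0 : ℝ)..(2 * Real.pi), B (p, θ) with hΦ
  have hΦs : ContDiffOn ℝ ∞ Φ (S ×ˢ T) := contDiffOn_integral hPu hPc Real.two_pi_pos hBs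
  -- the energy
  have hE : ∀ σ ∈ S, energy (C σ) = 1 / 2 * ∫ t in (0 : ℝ)..1, W (σ, t) := fun σ hσ => by
    rw [energy]
    congr 1
    refine intervalIntegral.integral_congr fun t ht => ?_
    rw [uIcc_of_le zero_le_one] at ht
    rw [(h.isPath hσ).G_eq ht]
    refine intervalIntegral.integral_congr fun θ hθ => ?_
    rw [uIcc_of_le Real.two_pi_pos.le] at hθ
    have hv : velocity (fun s => IsPath.transform (C σ) (s, θ)) t = ft ((σ, t), θ) :=
      (hasDerivWithinAt_snd_line hfs hσ ht hθ).derivWithin (uniqueDiffOn_T t ht)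
    rw [hv, gInner_self_inv]
    rfl
  have hder : HasDerivAt (fun σ => energy (C σ))
      (1 / 2 * ∫ t in (0 : ℝ)..1, pderiv (S ×ˢ T) (1, 0) W (0, t)) 0 := by
    have h1 := hasDerivWithinAt_pderiv (contDiffOn_integral hSu (convex_Ioo _ _) zero_lt_one hWs)
      (hasDerivWithinAt_id (0 : ℝ) S) (fun _ h => h) h0S
    simp only [id] at h1
    rw [pderiv_integral hSu (convex_Ioo _ _) zero_lt_one hWs _ h0S] at h1
    exact ((h1.const_mul (1 / 2)).congr hE (hE 0 h0S)).hasDerivAt (isOpen_Ioo.mem_nhds h0S)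
  refine hder.congr_deriv ?_
  -- the pointwise identity
  have hpt : ∀ t ∈ T, ∀ θ ∈ M, varField ε C t θ 0 * residual (fun s => R (c s) θ) t 0
      + varField ε C t θ 1 * residual (fun s => R (c s) θ) t 1
      = pderiv Ω ((0, 1), 0) B ((0, t), θ) - 1 / 2 * pderiv Ω ((1, 0), 0) e ((0, t), θ) := by
    intro t ht θ hθ
    have hw : ((0, t), θ) ∈ Ω := ⟨⟨h0S, ht⟩, hθ⟩
    have hx := hx0 _ hw
    have hvf : varField ε C t θ = fσ ((0, t), θ) :=
      (hasDerivWithinAt_fst_line hfs h0S ht hθ).derivWithin (hSu 0 h0S)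
    have hγ : ∀ s ∈ T, R (c s) θ = f ((0, s), θ) := fun s hs => (R_congr (h.center s hs) hθ).symm
    have hvel : ∀ s ∈ T, velocity (fun s => R (c s) θ) s = ft ((0, s), θ) := fun s hs =>
      ((hasDerivWithinAt_snd_line hfs h0S hs hθ).congr hγ (hγ s hs)).derivWithin
        (uniqueDiffOn_T s hs)
    have hacc : derivWithin (velocity (fun s => R (c s) θ)) T t
        = pderiv Ω ((0, 1), 0) ft ((0, t), θ) :=
      ((hasDerivWithinAt_snd_line hfts h0S ht hθ).congr hvel (hvel t ht)).derivWithin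
        (uniqueDiffOn_T t ht)
    have dx := hasDerivWithinAt_pi.1 (hasDerivWithinAt_fst_line hfs h0S ht hθ)
    have dxt := hasDerivWithinAt_pi.1 (hasDerivWithinAt_fst_line hfts h0S ht hθ)
    have tx := hasDerivWithinAt_pi.1 (hasDerivWithinAt_snd_line hfs h0S ht hθ)
    have txt := hasDerivWithinAt_pi.1 (hasDerivWithinAt_snd_line hfts h0S ht hθ)
    have txσ := hasDerivWithinAt_pi.1 (hasDerivWithinAt_snd_line hfσs h0S ht hθ)
    have hcomm : pderiv Ω ((1, 0), 0) ft ((0, t), θ) = pderiv Ω ((0, 1), 0) fσ ((0, t), θ) :=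
      pderiv_comm hΩu hΩi hfs _ _ hw
    have de := ((dxt 0).pow 2 |>.const_mul 4).add
      ((((dx 0).pow 6).inv (pow_ne_zero 6 hx)).mul ((dxt 1).pow 2))
    have tB := (((txt 0).const_mul 4).mul (txσ 0)).add
      (((((tx 0).pow 6).inv (pow_ne_zero 6 hx)).mul (txt 1)).mul (txσ 1))
    have ee := (hSu 0 h0S).eq_deriv _ (hasDerivWithinAt_fst_line hes h0S ht hθ) de
    have eB := (uniqueDiffOn_T t ht).eq_deriv _ (hasDerivWithinAt_snd_line hBs h0S ht hθ) tB
    rw [ee, eB, hvf, residual, hvel t ht, hacc, hγ t ht]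
    rw [← hΩ, hcomm, ← hft, ← hfσ]
    simp only [Matrix.cons_val_zero, Matrix.cons_val_one, Pi.pow_apply, Pi.inv_apply, Pi.mul_apply]
    push_cast
    field_simp
    ring
  -- integration over the parameter interval
  have hcB := (contDiffOn_pderiv hΩu hBs ((0, 1), 0)).continuousOn
  have hce := (contDiffOn_pderiv hΩu hes ((1, 0), 0)).continuousOn
  have hn : ∀ t ∈ T, ∫ θ in (0 : ℝ)..(2 * Real.pi),
      (varField ε C t θ 0 * residual (fun s => R (c s) θ) t 0
        + varField ε C t θ 1 * residual (fun s => R (c s) θ) t 1)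
      = pderiv (S ×ˢ T) (0, 1) Φ (0, t) - 1 / 2 * pderiv (S ×ˢ T) (1, 0) W (0, t) := fun t ht => by
    have hp : ((0 : ℝ), t) ∈ S ×ˢ T := ⟨h0S, ht⟩
    rw [pderiv_integral hPu hPc Real.two_pi_pos hBs _ hp,
      pderiv_integral hPu hPc Real.two_pi_pos hes _ hp, ← intervalIntegral.integral_const_mul,
      ← intervalIntegral.integral_sub
        (intervalIntegrable_of_continuousOn_prod hcB Real.two_pi_pos.le hp)
        ((intervalIntegrable_of_continuousOn_prod hce Real.two_pi_pos.le hp).const_mul _)]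
    refine intervalIntegral.integral_congr fun θ hθ => ?_
    rw [uIcc_of_le Real.two_pi_pos.le] at hθ
    exact hpt t ht θ hθ
  have hcΦ := (contDiffOn_pderiv hPu hΦs (0, 1)).continuousOn
  have hcW := (contDiffOn_pderiv hPu hWs (1, 0)).continuousOn
  have hiΦ := intervalIntegrable_of_continuousOn_prod hcΦ zero_le_one h0S
  have hiW := intervalIntegrable_of_continuousOn_prod hcW zero_le_one h0S
  have hend : ∀ t, (t = 0 ∨ t = 1) → Φ (0, t) = 0 := fun t ht => by
    have htT : t ∈ T := by rcases ht with rfl | rfl; exacts [zero_mem_T, one_mem_T]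
    have hz : ∀ θ ∈ M, fσ ((0, t), θ) = 0 := fun θ hθ => by
      refine (hSu 0 h0S).eq_deriv _ (hasDerivWithinAt_fst_line hfs h0S htT hθ) ?_
      refine (hasDerivWithinAt_const 0 S (R (c t) θ)).congr (fun σ hσ => ?_) ?_
      · rcases ht with rfl | rfl
        exacts [R_congr (h.fixed σ hσ).1 hθ, R_congr (h.fixed σ hσ).2 hθ]
      · exact R_congr (h.center t htT) hθ
    refine (intervalIntegral.integral_congr fun θ hθ => ?_).trans
      (intervalIntegral.integral_zero (a := 0) (b := 2 * Real.pi))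
    rw [uIcc_of_le Real.two_pi_pos.le] at hθ
    simp [hB, hz θ hθ]
  have hftc : ∫ t in (0 : ℝ)..1, pderiv (S ×ˢ T) (0, 1) Φ (0, t) = 0 := by
    have hd : ∀ t ∈ T, HasDerivWithinAt (fun t => Φ (0, t)) (pderiv (S ×ˢ T) (0, 1) Φ (0, t)) T t :=
      fun t ht => hasDerivWithinAt_pderiv hΦs (l := fun t => (0, t))
        ((hasDerivWithinAt_const t T 0).prodMk (hasDerivWithinAt_id t T)) (fun _ h => ⟨h0S, h⟩) ht
    rw [intervalIntegral.integral_eq_sub_of_hasDerivAt_of_le (f := fun t => Φ (0, t)) zero_le_one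
      (fun t ht => (hd t ht).continuousWithinAt)
      (fun t ht => (hd t (Ioo_subset_Icc_self ht)).hasDerivAt (Icc_mem_nhds ht.1 ht.2)) hiΦ,
      hend 1 (Or.inr rfl), hend 0 (Or.inl rfl), sub_zero]
  rw [intervalIntegral.integral_congr (fun t ht => hn t (by rwa [uIcc_of_le zero_le_one] at ht)),
    intervalIntegral.integral_sub hiΦ (hiW.const_mul _), hftc, intervalIntegral.integral_const_mul]
  ring

end IsVariation

end
end H2Curves

namespace H2Curves

open scoped Topology
open MeasureTheory

noncomputable section

/-! ### Geodesics of `G` -/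

lemma velocity_congr {γ δ : ℝ → Fin 2 → ℝ} (h : EqOn γ δ T) : EqOn (velocity γ) (velocity δ) T :=
  fun _ ht => derivWithin_congr h (h ht)

lemma residual_congr {γ δ : ℝ → Fin 2 → ℝ} (h : EqOn γ δ T) : EqOn (residual γ) (residual δ) T :=
  fun t ht => by
    rw [residual, residual, derivWithin_congr (velocity_congr h) (velocity_congr h ht),
      velocity_congr h ht, h ht]

lemma IsPath.isGeodesic {c : ℝ → ℝ → ℂ} (h : IsPath c)
    (hr : ∀ θ ∈ M, ∀ t ∈ T, residual (fun s => R (c s) θ) t = 0) : IsGeodesic c where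
  toIsPath := h
  critical ε hε C hC := by
    refine (hC.hasDerivAt_energy hε).congr_deriv ?_
    rw [neg_eq_zero]
    refine (intervalIntegral.integral_congr fun t ht => ?_).trans
      (intervalIntegral.integral_zero (a := 0) (b := 1))
    refine (intervalIntegral.integral_congr fun θ hθ => ?_).trans
      (intervalIntegral.integral_zero (a := 0) (b := 2 * Real.pi))
    rw [uIcc_of_le zero_le_one] at ht
    rw [uIcc_of_le Real.two_pi_pos.le] at hθ
    simp [hr θ hθ t ht]

lemma isPath_Rinv {q : ℝ → ℝ → Fin 2 → ℝ}
    (hq : ContDiffOn ℝ ∞ (fun w : ℝ × ℝ => q w.1 w.2) (T ×ˢ M))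
    (hpos : ∀ t ∈ T, ∀ θ ∈ M, q t θ ∈ halfPlane) : IsPath fun t => Rinv (q t) where
  smooth := contDiffOn_Rinv uniqueDiffOn_T (convex_Icc 0 1) hq hpos
  mem t ht := isImmMot_Rinv (hq.comp (ContDiff.contDiffOn (by fun_prop : ContDiff ℝ ∞
    fun θ : ℝ => (t, θ))) fun _ h => ⟨ht, h⟩) (hpos t ht)

lemma IsPath.contDiffOn_residual {c : ℝ → ℝ → ℂ} (h : IsPath c) :
    ContDiffOn ℝ ∞ (fun w : ℝ × ℝ => residual (fun s => R (c s) w.2) w.1) (T ×ˢ M) := by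
  set Ω : Set (ℝ × ℝ) := T ×ˢ M with hΩ
  have hfs : ContDiffOn ℝ ∞ (IsPath.transform c) Ω := h.contDiffOn_transform
  set ft := pderiv Ω (1, 0) (IsPath.transform c) with hft
  have hfts : ContDiffOn ℝ ∞ ft Ω := contDiffOn_pderiv uniqueDiffOn_TM hfs _
  set ftt := pderiv Ω (1, 0) ft with hftt
  have hftts : ContDiffOn ℝ ∞ ftt Ω := contDiffOn_pderiv uniqueDiffOn_TM hfts _
  have hv : ∀ w ∈ Ω, velocity (fun s => R (c s) w.2) w.1 = ft w := fun w hw =>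
    h.velocity_eq hw.1 hw.2
  have ha : ∀ w ∈ Ω, derivWithin (velocity (fun s => R (c s) w.2)) T w.1 = ftt w := fun w hw =>
    ((hasDerivWithinAt_time hfts hw.1 hw.2).congr (fun s hs => hv (s, w.2) ⟨hs, hw.2⟩)
      (hv w hw)).derivWithin (uniqueDiffOn_T w.1 hw.1)
  have cf := contDiffOn_pi.1 hfs
  have cft := contDiffOn_pi.1 hfts
  have cftt := contDiffOn_pi.1 hftts
  have hx : ∀ w ∈ Ω, IsPath.transform c w 0 ≠ 0 := fun w hw => (h.transform_mem hw).ne'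
  have h0 : ContDiffOn ℝ ∞ (fun w => 4 * ftt w 0
      + 3 * (IsPath.transform c w 0 ^ 7)⁻¹ * ft w 1 ^ 2) Ω :=
    (contDiffOn_const.mul (cftt 0)).add ((contDiffOn_const.mul
      (((cf 0).pow 7).inv fun w hw => pow_ne_zero 7 (hx w hw))).mul ((cft 1).pow 2))
  have h1 : ContDiffOn ℝ ∞ (fun w => (IsPath.transform c w 0 ^ 6)⁻¹ * ftt w 1
      - 6 * (IsPath.transform c w 0 ^ 7)⁻¹ * ft w 0 * ft w 1) Ω :=
    ((((cf 0).pow 6).inv fun w hw => pow_ne_zero 6 (hx w hw)).mul (cftt 1)).sub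
      (((contDiffOn_const.mul (((cf 0).pow 7).inv fun w hw => pow_ne_zero 7 (hx w hw))).mul
        (cft 0)).mul (cft 1))
  refine contDiffOn_pi.2 (Fin.forall_fin_two.2 ⟨h0.congr fun w hw => ?_, h1.congr fun w hw => ?_⟩)
  · simp only [residual, Matrix.cons_val_zero, hv w hw, ha w hw]
    rfl
  · simp only [residual, Matrix.cons_val_one, hv w hw, ha w hw]
    rfl

/-- The variation of a path of curves in the direction `t (1 - t) r`, in the coordinates given by
`R`. -/
def shiftedPath (c : ℝ → ℝ → ℂ) (r : ℝ × ℝ → Fin 2 → ℝ) (σ t θ : ℝ) : Fin 2 → ℝ :=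
  R (c t) θ + (σ * (t * (1 - t))) • r (t, θ)

section Shift

variable {c : ℝ → ℝ → ℂ} {r : ℝ × ℝ → Fin 2 → ℝ}

lemma exists_shiftedPath_mem (h : IsPath c) (hr : ContinuousOn r (T ×ˢ M)) :
    ∃ ε > 0, ∀ σ ∈ Ioo (-ε) ε, ∀ t ∈ T, ∀ θ ∈ M, shiftedPath c r σ t θ ∈ halfPlane := by
  have hK : IsCompact (T ×ˢ M) := isCompact_Icc.prod isCompact_Icc
  have hne : (T ×ˢ M).Nonempty := ⟨(0, 0), zero_mem_T, zero_mem_M⟩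
  have hf := continuousOn_pi.1 h.contDiffOn_transform.continuousOn 0
  obtain ⟨w₀, hw₀, hmin⟩ := hK.exists_isMinOn hne hf
  obtain ⟨K, hKb⟩ := hK.exists_bound_of_continuousOn (continuousOn_pi.1 hr 0)
  have hK0 : 0 ≤ K := (norm_nonneg _).trans (hKb _ hw₀)
  have hm : 0 < IsPath.transform c w₀ 0 := h.transform_mem hw₀
  refine ⟨IsPath.transform c w₀ 0 / (K + 1), by positivity, fun σ hσ t ht θ hθ => ?_⟩
  have hb := hKb (t, θ) ⟨ht, hθ⟩
  have hx : IsPath.transform c w₀ 0 ≤ R (c t) θ 0 := hmin (a := (t, θ)) ⟨ht, hθ⟩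
  have hσ' : |σ| < IsPath.transform c w₀ 0 / (K + 1) := abs_lt.2 hσ
  rw [lt_div_iff₀ (by positivity)] at hσ'
  have htt : |t * (1 - t)| ≤ 1 := by
    rw [abs_le]
    constructor <;> nlinarith [ht.1, ht.2]
  have hprod : |σ * (t * (1 - t)) * r (t, θ) 0| ≤ |σ| * K := by
    rw [abs_mul, abs_mul]
    calc |σ| * |t * (1 - t)| * |r (t, θ) 0| ≤ |σ| * 1 * K := by gcongr; exact hb
      _ = _ := by ring
  have : 0 < R (c t) θ 0 + σ * (t * (1 - t)) * r (t, θ) 0 := by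
    have := neg_abs_le (σ * (t * (1 - t)) * r (t, θ) 0)
    nlinarith [abs_nonneg σ]
  exact this

lemma contDiffOn_shiftedPath (h : IsPath c) (hr : ContDiffOn ℝ ∞ r (T ×ˢ M)) (S : Set ℝ) :
    ContDiffOn ℝ ∞ (fun w : (ℝ × ℝ) × ℝ => shiftedPath c r w.1.1 w.1.2 w.2) ((S ×ˢ T) ×ˢ M) := by
  have hp : ContDiffOn ℝ ∞ (fun w : (ℝ × ℝ) × ℝ => (w.1.2, w.2)) ((S ×ˢ T) ×ˢ M) :=
    ContDiff.contDiffOn (by fun_prop)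
  have hm : MapsTo (fun w : (ℝ × ℝ) × ℝ => (w.1.2, w.2)) ((S ×ˢ T) ×ˢ M) (T ×ˢ M) :=
    fun w hw => ⟨hw.1.2, hw.2⟩
  have h1 : ContDiffOn ℝ ∞ (fun w : (ℝ × ℝ) × ℝ => R (c w.1.2) w.2) ((S ×ˢ T) ×ˢ M) :=
    h.contDiffOn_transform.comp hp hm
  have h2 : ContDiffOn ℝ ∞ (fun w : (ℝ × ℝ) × ℝ => r (w.1.2, w.2)) ((S ×ˢ T) ×ˢ M) :=
    hr.comp hp hm
  have h3 : ContDiffOn ℝ ∞ (fun w : (ℝ × ℝ) × ℝ => w.1.1 * (w.1.2 * (1 - w.1.2)))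
      ((S ×ˢ T) ×ˢ M) := ContDiff.contDiffOn (by fun_prop)
  exact h1.add (h3.smul h2)

lemma contDiffOn_shiftedPath_angular (h : IsPath c) (hr : ContDiffOn ℝ ∞ r (T ×ˢ M)) (σ : ℝ)
    {t : ℝ} (ht : t ∈ T) : ContDiffOn ℝ ∞ (shiftedPath c r σ t) M :=
  (contDiffOn_shiftedPath h hr univ).comp (ContDiff.contDiffOn (by fun_prop : ContDiff ℝ ∞
    fun θ : ℝ => ((σ, t), θ))) fun _ h => ⟨⟨mem_univ _, ht⟩, h⟩

lemma contDiffOn_Rinv_shiftedPath (h : IsPath c) (hr : ContDiffOn ℝ ∞ r (T ×ˢ M)) {ε : ℝ}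
    (hm : ∀ σ ∈ Ioo (-ε) ε, ∀ t ∈ T, ∀ θ ∈ M, shiftedPath c r σ t θ ∈ halfPlane) :
    ContDiffOn ℝ ∞ (fun p : ℝ × ℝ × ℝ => Rinv (shiftedPath c r p.1 p.2.1) p.2.2)
      (Ioo (-ε) ε ×ˢ T ×ˢ M) := by
  have hu : UniqueDiffOn ℝ (Ioo (-ε) ε ×ˢ T) := isOpen_Ioo.uniqueDiffOn.prod uniqueDiffOn_T
  have hc : Convex ℝ (Ioo (-ε) ε ×ˢ T) := (convex_Ioo _ _).prod (convex_Icc 0 1)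
  have h1 : ContDiffOn ℝ ∞ (fun w : (ℝ × ℝ) × ℝ => Rinv (shiftedPath c r w.1.1 w.1.2) w.2)
      ((Ioo (-ε) ε ×ˢ T) ×ˢ M) :=
    contDiffOn_Rinv (q := fun e : ℝ × ℝ => shiftedPath c r e.1 e.2) hu hc
      (contDiffOn_shiftedPath h hr (Ioo (-ε) ε)) fun e he => hm e.1 he.1 e.2 he.2
  have h2 : ContDiffOn ℝ ∞ (fun p : ℝ × ℝ × ℝ => ((p.1, p.2.1), p.2.2)) (Ioo (-ε) ε ×ˢ T ×ˢ M) :=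
    ContDiff.contDiffOn (by fun_prop)
  have hmap : MapsTo (fun p : ℝ × ℝ × ℝ => ((p.1, p.2.1), p.2.2)) (Ioo (-ε) ε ×ˢ T ×ˢ M)
      ((Ioo (-ε) ε ×ˢ T) ×ˢ M) := fun _ hp => ⟨⟨hp.1, hp.2.1⟩, hp.2.2⟩
  have h3 := ContDiffOn.comp h1 h2 hmap
  simpa only [Function.comp_def] using h3

lemma isVariation_shiftedPath (h : IsPath c) (hr : ContDiffOn ℝ ∞ r (T ×ˢ M)) {ε : ℝ}
    (hm : ∀ σ ∈ Ioo (-ε) ε, ∀ t ∈ T, ∀ θ ∈ M, shiftedPath c r σ t θ ∈ halfPlane) :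
    IsVariation c ε fun σ t => Rinv (shiftedPath c r σ t) where
  smooth := contDiffOn_Rinv_shiftedPath h hr hm
  mem σ hσ t ht := isImmMot_Rinv (contDiffOn_shiftedPath_angular h hr σ ht) (hm σ hσ t ht)
  center t ht := by
    have : shiftedPath c r 0 t = R (c t) := by funext θ; simp [shiftedPath]
    simp only [this]
    exact (h.mem t ht).Rinv_R
  fixed σ _ := by
    have e0 : shiftedPath c r σ 0 = R (c 0) := by funext θ; simp [shiftedPath]
    have e1 : shiftedPath c r σ 1 = R (c 1) := by funext θ; simp [shiftedPath]
    simp only [Connects, e0, e1]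
    exact ⟨(h.mem 0 zero_mem_T).Rinv_R, (h.mem 1 one_mem_T).Rinv_R⟩

lemma varField_shiftedPath (h : IsPath c) (hr : ContDiffOn ℝ ∞ r (T ×ˢ M)) {ε : ℝ} (hε : 0 < ε)
    (hm : ∀ σ ∈ Ioo (-ε) ε, ∀ t ∈ T, ∀ θ ∈ M, shiftedPath c r σ t θ ∈ halfPlane) {t θ : ℝ}
    (ht : t ∈ T) (hθ : θ ∈ M) :
    varField ε (fun σ t => Rinv (shiftedPath c r σ t)) t θ = (t * (1 - t)) • r (t, θ) := by
  have h0 : (0 : ℝ) ∈ Ioo (-ε) ε := ⟨neg_lt_zero.2 hε, hε⟩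
  have heq : ∀ σ ∈ Ioo (-ε) ε, R (Rinv (shiftedPath c r σ t)) θ = shiftedPath c r σ t θ :=
    fun σ hσ => R_Rinv (contDiffOn_shiftedPath_angular h hr σ ht) (hm σ hσ t ht) hθ
  have hd : HasDerivWithinAt (fun σ => shiftedPath c r σ t θ) ((t * (1 - t)) • r (t, θ))
      (Ioo (-ε) ε) 0 := by
    have := ((((hasDerivAt_id (0 : ℝ)).mul_const (t * (1 - t))).smul_const (r (t, θ))).const_add
      (R (c t) θ)).hasDerivWithinAt (s := Ioo (-ε) ε)
    rw [one_mul] at this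
    exact this
  exact (hd.congr heq (heq 0 h0)).derivWithin (isOpen_Ioo.uniqueDiffOn 0 h0)

end Shift

lemma eq_zero_of_integral_eq_zero {f : ℝ → ℝ} {a b : ℝ} (hab : a < b) (hc : ContinuousOn f (Icc a b))
    (h0 : ∀ t ∈ Icc a b, 0 ≤ f t) (hi : ∫ t in a..b, f t = 0) : ∀ t ∈ Icc a b, f t = 0 := by
  by_contra! hne
  obtain ⟨t, ht, hft⟩ := hne
  exact (intervalIntegral.integral_pos hab hc (fun s hs => h0 s (Ioc_subset_Icc_self hs))
    ⟨t, ht, lt_of_le_of_ne (h0 t ht) hft.symm⟩).ne' hi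

/-- A critical point of the energy is pointwise a geodesic of `g`. -/
lemma IsGeodesic.residual_eq_zero {c : ℝ → ℝ → ℂ} (h : IsGeodesic c) {t θ : ℝ} (ht : t ∈ T)
    (hθ : θ ∈ M) : residual (fun s => R (c s) θ) t = 0 := by
  have hp := h.toIsPath
  set r : ℝ × ℝ → Fin 2 → ℝ := fun w => residual (fun s => R (c s) w.2) w.1 with hrdef
  have hr : ContDiffOn ℝ ∞ r (T ×ˢ M) := hp.contDiffOn_residual
  obtain ⟨ε, hε, hm⟩ := exists_shiftedPath_mem hp hr.continuousOn
  have hv := isVariation_shiftedPath hp hr hm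
  have h1 := (hv.hasDerivAt_energy hε).unique (h.critical ε hε _ hv)
  rw [neg_eq_zero] at h1
  set g : ℝ × ℝ → ℝ := fun w => w.1 * (1 - w.1) * (r w 0 ^ 2 + r w 1 ^ 2) with hg
  have hgs : ContDiffOn ℝ ∞ g (T ×ˢ M) := by
    have cr := contDiffOn_pi.1 hr
    have ct : ContDiffOn ℝ ∞ (fun w : ℝ × ℝ => w.1 * (1 - w.1)) (T ×ˢ M) :=
      ContDiff.contDiffOn (by fun_prop)
    exact ct.mul (((cr 0).pow 2).add ((cr 1).pow 2))
  have hg0 : ∀ w ∈ T ×ˢ M, 0 ≤ g w := fun w hw =>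
    mul_nonneg (mul_nonneg hw.1.1 (sub_nonneg.2 hw.1.2)) (by positivity)
  have h2 : ∫ t in (0 : ℝ)..1, ∫ θ in (0 : ℝ)..(2 * Real.pi), g (t, θ) = 0 := by
    refine Eq.trans ?_ h1
    refine intervalIntegral.integral_congr fun t ht => ?_
    refine intervalIntegral.integral_congr fun θ hθ => ?_
    rw [uIcc_of_le zero_le_one] at ht
    rw [uIcc_of_le Real.two_pi_pos.le] at hθ
    simp only [varField_shiftedPath hp hr hε hm ht hθ, Pi.smul_apply, smul_eq_mul, hg]
    ring
  have h3 := eq_zero_of_integral_eq_zero zero_lt_one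
    (contDiffOn_integral uniqueDiffOn_T (convex_Icc 0 1) Real.two_pi_pos hgs).continuousOn
    (fun t ht => intervalIntegral.integral_nonneg Real.two_pi_pos.le fun θ hθ => hg0 _ ⟨ht, hθ⟩) h2
  have h4 : ∀ t ∈ Ioo (0 : ℝ) 1, r (t, θ) = 0 := fun t ht => by
    have ht' : t ∈ T := Ioo_subset_Icc_self ht
    have h5 := eq_zero_of_integral_eq_zero Real.two_pi_pos (f := fun θ => g (t, θ))
      (hgs.continuousOn.comp (by fun_prop) fun θ hθ => ⟨ht', hθ⟩)
      (fun θ hθ => hg0 _ ⟨ht', hθ⟩) (h3 t ht') θ hθ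
    have h6 : 0 < t * (1 - t) := mul_pos ht.1 (sub_pos.2 ht.2)
    have h7 : r (t, θ) 0 ^ 2 + r (t, θ) 1 ^ 2 = 0 := (mul_eq_zero.1 h5).resolve_left h6.ne'
    have h8 := sq_nonneg (r (t, θ) 0)
    have h9 := sq_nonneg (r (t, θ) 1)
    exact funext (Fin.forall_fin_two.2 ⟨(pow_eq_zero_iff two_ne_zero).1 (by linarith),
      (pow_eq_zero_iff two_ne_zero).1 (by linarith)⟩)
  have hct : ContinuousOn (fun t => r (t, θ)) T :=
    hr.continuousOn.comp (by fun_prop) fun t ht => ⟨ht, hθ⟩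
  refine Set.EqOn.of_subset_closure (s := Ioo 0 1) (t := T) (f := fun t => r (t, θ))
    (g := fun _ => 0) h4 hct continuousOn_const Ioo_subset_Icc_self ?_ ht
  rw [closure_Ioo zero_ne_one]

lemma IsGeodesic.isPlaneGeodesic {c : ℝ → ℝ → ℂ} (h : IsGeodesic c) {θ : ℝ} (hθ : θ ∈ M) :
    IsPlaneGeodesic fun t => R (c t) θ :=
  (h.toIsPath.isPlanePath hθ).isPlaneGeodesic_iff.2 fun _ ht => h.residual_eq_zero ht hθ

end
end H2Curves

namespace H2Curves

open scoped Topology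
open MeasureTheory

noncomputable section

/-! ### Minkowski's integral inequality -/

lemma integral_mul_le_sqrt_mul_sqrt {f g : ℝ → ℝ} (hf : Continuous f) (hg : Continuous g) {a b : ℝ}
    (hab : a ≤ b) :
    ∫ θ in a..b, f θ * g θ ≤ √(∫ θ in a..b, f θ ^ 2) * √(∫ θ in a..b, g θ ^ 2) := by
  have hi : ∀ {h : ℝ → ℝ}, Continuous h → IntervalIntegrable h volume a b :=
    fun hh => hh.intervalIntegrable a b
  have key : ∀ x : ℝ, 0 ≤ (∫ θ in a..b, f θ ^ 2) * (x * x)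
      + (-2 * ∫ θ in a..b, f θ * g θ) * x + ∫ θ in a..b, g θ ^ 2 := fun x => by
    have h1 : 0 ≤ ∫ θ in a..b, (x * f θ - g θ) ^ 2 :=
      intervalIntegral.integral_nonneg hab fun θ _ => sq_nonneg _
    refine h1.trans_eq ?_
    have e : ∀ θ, (x * f θ - g θ) ^ 2 = x * x * f θ ^ 2 + (-2 * x) * (f θ * g θ) + g θ ^ 2 :=
      fun θ => by ring
    simp only [e]
    rw [intervalIntegral.integral_add (hi (by fun_prop)) (hi (by fun_prop)),
      intervalIntegral.integral_add (hi (by fun_prop)) (hi (by fun_prop)),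
      intervalIntegral.integral_const_mul, intervalIntegral.integral_const_mul]
    ring
  have hd := discrim_le_zero key
  rw [discrim] at hd
  have h0 : 0 ≤ ∫ θ in a..b, f θ ^ 2 := intervalIntegral.integral_nonneg hab fun θ _ => sq_nonneg _
  rw [← Real.sqrt_mul h0]
  refine Real.le_sqrt_of_sq_le ?_
  linarith

lemma sqrt_integral_sq_integral_le {f : ℝ → ℝ → ℝ} (hf : Continuous f.uncurry) {a b c d : ℝ}
    (hab : a ≤ b) (hcd : c ≤ d) :
    √(∫ θ in c..d, (∫ t in a..b, f t θ) ^ 2) ≤ ∫ t in a..b, √(∫ θ in c..d, f t θ ^ 2) := by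
  set Φ : ℝ → ℝ := fun θ => ∫ t in a..b, f t θ with hΦ
  have hf' : Continuous (Function.uncurry fun θ t => f t θ) := hf.comp continuous_swap
  have hΦc : Continuous Φ :=
    intervalIntegral.continuous_parametric_intervalIntegral_of_continuous' hf' a b
  set N : ℝ → ℝ := fun t => √(∫ θ in c..d, f t θ ^ 2) with hN
  have hNc : Continuous N := by
    refine Continuous.sqrt ?_
    exact intervalIntegral.continuous_parametric_intervalIntegral_of_continuous'
      (f := fun t θ => f t θ ^ 2) (by exact hf.pow 2) c d
  set J := ∫ θ in c..d, Φ θ ^ 2 with hJ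
  have hJ0 : 0 ≤ J := intervalIntegral.integral_nonneg hcd fun θ _ => sq_nonneg _
  have h1 : J = ∫ t in a..b, ∫ θ in c..d, Φ θ * f t θ := by
    have hc : Continuous (Function.uncurry fun t θ => Φ θ * f t θ) :=
      (hΦc.comp continuous_snd).mul hf
    rw [intervalIntegral_intervalIntegral_swap]
    · refine intervalIntegral.integral_congr fun θ _ => ?_
      simp only [intervalIntegral.integral_const_mul, sq]
      rfl
    · exact (hc.continuousOn.integrableOn_compact (isCompact_uIcc.prod isCompact_uIcc)).mono_set
        (prod_mono uIoc_subset_uIcc uIoc_subset_uIcc)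
  have hft : ∀ t, Continuous (f t) := fun t => hf.comp (by fun_prop : Continuous fun θ => (t, θ))
  have h2 : J ≤ √J * ∫ t in a..b, N t := by
    rw [← intervalIntegral.integral_const_mul, h1]
    refine intervalIntegral.integral_mono_on hab ?_ ((hNc.const_mul _).intervalIntegrable a b)
      fun t _ => ?_
    · have hc : Continuous (Function.uncurry fun t θ => Φ θ * f t θ) :=
        (hΦc.comp continuous_snd).mul hf
      exact (intervalIntegral.continuous_parametric_intervalIntegral_of_continuous' hc
        c d).intervalIntegrable a b
    · rw [← h1]
      exact integral_mul_le_sqrt_mul_sqrt hΦc (hft t) hcd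
  rcases hJ0.eq_or_lt with h3 | h3
  · rw [← h3, Real.sqrt_zero]
    exact intervalIntegral.integral_nonneg hab fun t _ => Real.sqrt_nonneg _
  · refine le_of_mul_le_mul_left ?_ (Real.sqrt_pos.2 h3)
    rwa [Real.mul_self_sqrt hJ0]

lemma exists_continuous_extension {f : ℝ × ℝ → ℝ} {a b c d : ℝ} (hab : a ≤ b)
    (hcd : c ≤ d) (hf : ContinuousOn f (Icc a b ×ˢ Icc c d)) :
    ∃ f' : ℝ → ℝ → ℝ, Continuous f'.uncurry ∧
      ∀ t ∈ Icc a b, ∀ θ ∈ Icc c d, f (t, θ) = f' t θ := by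
  refine ⟨fun t θ => f (projIcc a b hab t, projIcc c d hcd θ), ?_, fun t ht θ hθ => by
    simp only [projIcc_of_mem hab ht, projIcc_of_mem hcd hθ]⟩
  refine hf.comp_continuous (f := fun w : ℝ × ℝ => ((projIcc a b hab w.1 : ℝ),
    (projIcc c d hcd w.2 : ℝ))) ?_ fun w => ⟨Subtype.coe_prop _, Subtype.coe_prop _⟩
  exact ((continuous_subtype_val.comp continuous_projIcc).comp continuous_fst).prodMk
    ((continuous_subtype_val.comp continuous_projIcc).comp continuous_snd)

lemma continuousOn_integral_fst {f : ℝ × ℝ → ℝ} {a b c d : ℝ} (hab : a ≤ b)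
    (hcd : c ≤ d) (hf : ContinuousOn f (Icc a b ×ˢ Icc c d)) :
    ContinuousOn (fun θ => ∫ t in a..b, f (t, θ)) (Icc c d) := by
  obtain ⟨f', hc, heq⟩ := exists_continuous_extension hab hcd hf
  have hc' : Continuous (Function.uncurry fun θ t => f' t θ) := hc.comp continuous_swap
  refine (intervalIntegral.continuous_parametric_intervalIntegral_of_continuous' hc'
    a b).continuousOn.congr fun θ hθ => intervalIntegral.integral_congr fun t ht => ?_
  rw [uIcc_of_le hab] at ht
  exact heq t ht θ hθ

lemma sqrt_integral_sq_integral_le_of_continuousOn {f : ℝ × ℝ → ℝ} {a b c d : ℝ} (hab : a ≤ b)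
    (hcd : c ≤ d) (hf : ContinuousOn f (Icc a b ×ˢ Icc c d)) :
    √(∫ θ in c..d, (∫ t in a..b, f (t, θ)) ^ 2)
      ≤ ∫ t in a..b, √(∫ θ in c..d, f (t, θ) ^ 2) := by
  obtain ⟨f', hc, heq⟩ := exists_continuous_extension hab hcd hf
  have h1 := sqrt_integral_sq_integral_le hc hab hcd
  have e1 : ∫ θ in c..d, (∫ t in a..b, f (t, θ)) ^ 2 = ∫ θ in c..d, (∫ t in a..b, f' t θ) ^ 2 := by
    refine intervalIntegral.integral_congr fun θ hθ => ?_
    rw [uIcc_of_le hcd] at hθ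
    congr 1
    refine intervalIntegral.integral_congr fun t ht => ?_
    rw [uIcc_of_le hab] at ht
    exact heq t ht θ hθ
  have e2 : ∫ t in a..b, √(∫ θ in c..d, f (t, θ) ^ 2) = ∫ t in a..b, √(∫ θ in c..d, f' t θ ^ 2) := by
    refine intervalIntegral.integral_congr fun t ht => ?_
    rw [uIcc_of_le hab] at ht
    congr 1
    refine intervalIntegral.integral_congr fun θ hθ => ?_
    rw [uIcc_of_le hcd] at hθ
    simp only [heq t ht θ hθ]
  rw [e1, e2]
  exact h1

/-! ### The geodesic between two curves -/

/-- The geodesic between two curves, in the coordinates given by `R`. -/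
def curveGeo (c₀ c₁ : ℝ → ℂ) (t θ : ℝ) : Fin 2 → ℝ := geo (R c₀ θ) (R c₁ θ) t

section CurveGeo

variable {c₀ c₁ : ℝ → ℂ}

lemma isPlaneGeodesic_curveGeo (h₀ : IsImmMot c₀) (h₁ : IsImmMot c₁) {θ : ℝ} (hθ : θ ∈ M) :
    IsPlaneGeodesic (fun t => curveGeo c₀ c₁ t θ) ∧ curveGeo c₀ c₁ 0 θ = R c₀ θ ∧
      curveGeo c₀ c₁ 1 θ = R c₁ θ :=
  isPlaneGeodesic_geo (h₀.R_mem hθ) (h₁.R_mem hθ)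

lemma contDiffOn_curveGeo (h₀ : IsImmMot c₀) (h₁ : IsImmMot c₁) :
    ContDiffOn ℝ ∞ (fun w : ℝ × ℝ => curveGeo c₀ c₁ w.1 w.2) (T ×ˢ M) :=
  contDiffOn_geo (f := fun w : ℝ × ℝ => R c₀ w.2) (g := fun w => R c₁ w.2) (τ := fun w => w.1)
    (h₀.contDiffOn_R.comp contDiffOn_snd fun _ h => h.2)
    (h₁.contDiffOn_R.comp contDiffOn_snd fun _ h => h.2) contDiffOn_fst
    (fun _ h => h₀.R_mem h.2) (fun _ h => h₁.R_mem h.2) fun _ h => h.1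

lemma curveGeo_mem (h₀ : IsImmMot c₀) (h₁ : IsImmMot c₁) : ∀ t ∈ T, ∀ θ ∈ M,
    curveGeo c₀ c₁ t θ ∈ halfPlane :=
  fun t ht _ hθ => (isPlaneGeodesic_curveGeo h₀ h₁ hθ).1.mem t ht

lemma contDiffOn_curveGeo_angular (h₀ : IsImmMot c₀) (h₁ : IsImmMot c₁) {t : ℝ} (ht : t ∈ T) :
    ContDiffOn ℝ ∞ (curveGeo c₀ c₁ t) M :=
  contDiffOn_geo (τ := fun _ => t) h₀.contDiffOn_R h₁.contDiffOn_R contDiffOn_const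
    (fun _ h => h₀.R_mem h) (fun _ h => h₁.R_mem h) fun _ _ => ht

lemma isPath_curveGeo (h₀ : IsImmMot c₀) (h₁ : IsImmMot c₁) :
    IsPath fun t => Rinv (curveGeo c₀ c₁ t) :=
  isPath_Rinv (contDiffOn_curveGeo h₀ h₁) (curveGeo_mem h₀ h₁)

lemma R_Rinv_curveGeo (h₀ : IsImmMot c₀) (h₁ : IsImmMot c₁) {t θ : ℝ} (ht : t ∈ T) (hθ : θ ∈ M) :
    R (Rinv (curveGeo c₀ c₁ t)) θ = curveGeo c₀ c₁ t θ :=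
  R_Rinv (contDiffOn_curveGeo_angular h₀ h₁ ht) (curveGeo_mem h₀ h₁ t ht) hθ

lemma isGeodesic_curveGeo (h₀ : IsImmMot c₀) (h₁ : IsImmMot c₁) :
    IsGeodesic fun t => Rinv (curveGeo c₀ c₁ t) :=
  (isPath_curveGeo h₀ h₁).isGeodesic fun θ hθ t ht => by
    rw [residual_congr (fun s hs => R_Rinv_curveGeo h₀ h₁ hs hθ) ht]
    have h := (isPlaneGeodesic_curveGeo h₀ h₁ hθ).1
    exact h.toIsPlanePath.isPlaneGeodesic_iff.1 h t ht

lemma connects_curveGeo (h₀ : IsImmMot c₀) (h₁ : IsImmMot c₁) :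
    Connects (fun t => Rinv (curveGeo c₀ c₁ t)) c₀ c₁ :=
  ⟨(Rinv_congr fun _ hθ => (isPlaneGeodesic_curveGeo h₀ h₁ hθ).2.1).trans h₀.Rinv_R,
    (Rinv_congr fun _ hθ => (isPlaneGeodesic_curveGeo h₀ h₁ hθ).2.2).trans h₁.Rinv_R⟩

lemma IsGeodesic.eqOn_curveGeo {c : ℝ → ℝ → ℂ} (h : IsGeodesic c) (hc : Connects c c₀ c₁) {t : ℝ}
    (ht : t ∈ T) : EqOn (c t) (Rinv (curveGeo c₀ c₁ t)) M := by
  refine (h.mem t ht).Rinv_R.symm.trans (Rinv_congr fun θ hθ => ?_)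
  have h1 := (h.isPlaneGeodesic hθ).eqOn_geo ht
  simp only [R_congr hc.1 hθ, R_congr hc.2 hθ] at h1
  exact h1

lemma G_curveGeo (h₀ : IsImmMot c₀) (h₁ : IsImmMot c₁) {t : ℝ} (ht : t ∈ T) :
    G (Rinv (curveGeo c₀ c₁ t)) (pathVelocity (fun t => Rinv (curveGeo c₀ c₁ t)) t)
      (pathVelocity (fun t => Rinv (curveGeo c₀ c₁ t)) t)
      = ∫ θ in (0 : ℝ)..(2 * Real.pi), speedSq (R c₀ θ) (R c₁ θ) := by
  rw [(isPath_curveGeo h₀ h₁).G_eq ht]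
  refine intervalIntegral.integral_congr fun θ hθ => ?_
  rw [uIcc_of_le Real.two_pi_pos.le] at hθ
  have he : EqOn (fun s => IsPath.transform (fun t => Rinv (curveGeo c₀ c₁ t)) (s, θ))
      (geo (R c₀ θ) (R c₁ θ)) T := fun s hs => R_Rinv_curveGeo h₀ h₁ hs hθ
  have h1 := gInner_velocity_geo (h₀.R_mem hθ) (h₁.R_mem hθ) ht
  rw [← velocity_congr he ht, ← he ht] at h1
  exact h1

lemma pathLength_curveGeo (h₀ : IsImmMot c₀) (h₁ : IsImmMot c₁) :
    pathLength (fun t => Rinv (curveGeo c₀ c₁ t))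
      = √(∫ θ in (0 : ℝ)..(2 * Real.pi), speedSq (R c₀ θ) (R c₁ θ)) := by
  rw [pathLength, intervalIntegral.integral_congr
    (g := fun _ => √(∫ θ in (0 : ℝ)..(2 * Real.pi), speedSq (R c₀ θ) (R c₁ θ)))]
  · simp
  · intro t ht
    rw [uIcc_of_le zero_le_one] at ht
    simp only [G_curveGeo h₀ h₁ ht]

lemma IsPath.continuousOn_gInner {c : ℝ → ℝ → ℂ} (h : IsPath c) :
    ContinuousOn (fun w : ℝ × ℝ => gInner (transform c w) (velocity (fun s => transform c (s, w.2)) w.1)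
      (velocity (fun s => transform c (s, w.2)) w.1)) (T ×ˢ M) := by
  have hf := continuousOn_pi.1 h.contDiffOn_transform.continuousOn
  have hft := continuousOn_pi.1
    (contDiffOn_pderiv uniqueDiffOn_TM h.contDiffOn_transform (1, 0)).continuousOn
  have h1 : ContinuousOn (fun w : ℝ × ℝ => 4 * pderiv (T ×ˢ M) (1, 0) (transform c) w 0 ^ 2
      + (transform c w 0 ^ 6)⁻¹ * pderiv (T ×ˢ M) (1, 0) (transform c) w 1 ^ 2) (T ×ˢ M) :=
    (continuousOn_const.mul ((hft 0).pow 2)).add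
      ((((hf 0).pow 6).inv₀ fun w hw => pow_ne_zero 6 (h.transform_mem hw).ne').mul ((hft 1).pow 2))
  refine h1.congr fun w hw => ?_
  simp only [gInner_self_inv, h.velocity_eq hw.1 hw.2]

lemma continuousOn_speedSq (h₀ : IsImmMot c₀) (h₁ : IsImmMot c₁) :
    ContinuousOn (fun θ => speedSq (R c₀ θ) (R c₁ θ)) M := by
  have h := (isPath_curveGeo h₀ h₁).continuousOn_gInner
  refine (h.comp (f := fun θ => ((0 : ℝ), θ)) (by fun_prop)
    fun θ hθ => ⟨zero_mem_T, hθ⟩).congr fun θ hθ => ?_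
  have he : EqOn (fun s => IsPath.transform (fun t => Rinv (curveGeo c₀ c₁ t)) (s, θ))
      (geo (R c₀ θ) (R c₁ θ)) T := fun s hs => R_Rinv_curveGeo h₀ h₁ hs hθ
  have h1 := gInner_velocity_geo (h₀.R_mem hθ) (h₁.R_mem hθ) zero_mem_T
  rw [← velocity_congr he zero_mem_T, ← he zero_mem_T] at h1
  exact h1.symm

lemma IsPath.sqrt_integral_speedSq_le {c : ℝ → ℝ → ℂ} (h : IsPath c) (hc : Connects c c₀ c₁) :
    √(∫ θ in (0 : ℝ)..(2 * Real.pi), speedSq (R c₀ θ) (R c₁ θ)) ≤ pathLength c := by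
  set f : ℝ × ℝ → ℝ := fun w => √(gInner (transform c w)
    (velocity (fun s => transform c (s, w.2)) w.1) (velocity (fun s => transform c (s, w.2)) w.1))
    with hf
  have hfc : ContinuousOn f (T ×ˢ M) := h.continuousOn_gInner.sqrt
  have h1 := sqrt_integral_sq_integral_le_of_continuousOn zero_le_one Real.two_pi_pos.le hfc
  have e2 : pathLength c = ∫ t in (0 : ℝ)..1, √(∫ θ in (0 : ℝ)..(2 * Real.pi), f (t, θ) ^ 2) := by
    refine intervalIntegral.integral_congr fun t ht => ?_
    rw [uIcc_of_le zero_le_one] at ht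
    rw [h.G_eq ht]
    congr 1
    refine intervalIntegral.integral_congr fun θ hθ => ?_
    rw [uIcc_of_le Real.two_pi_pos.le] at hθ
    simp only [hf]
    rw [Real.sq_sqrt (gInner_self_nonneg (h.transform_mem (w := (t, θ)) ⟨ht, hθ⟩) _)]
  rw [e2]
  refine le_trans (Real.sqrt_le_sqrt ?_) h1
  rw [intervalIntegral.integral_of_le Real.two_pi_pos.le,
    intervalIntegral.integral_of_le Real.two_pi_pos.le]
  refine integral_mono_of_nonneg (Filter.Eventually.of_forall fun θ => speedSq_nonneg _) ?_ ?_
  · exact ((continuousOn_integral_fst zero_le_one Real.two_pi_pos.le hfc).pow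
      2).integrableOn_Icc.mono_set Ioc_subset_Icc_self
  · refine (ae_restrict_iff' measurableSet_Ioc).2 (Filter.Eventually.of_forall fun θ hθ => ?_)
    have hθ' : θ ∈ M := Ioc_subset_Icc_self hθ
    have h2 := (h.isPlanePath hθ').sqrt_speedSq_le
    simp only [transform, R_congr hc.1 hθ', R_congr hc.2 hθ'] at h2
    have h3 := pow_le_pow_left₀ (Real.sqrt_nonneg _) h2 2
    rw [Real.sq_sqrt (speedSq_nonneg _)] at h3
    exact h3

lemma isLeast_pathLength (h₀ : IsImmMot c₀) (h₁ : IsImmMot c₁) :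
    IsLeast (pathLengths c₀ c₁) (pathLength (fun t => Rinv (curveGeo c₀ c₁ t))) := by
  refine ⟨⟨_, isPath_curveGeo h₀ h₁, connects_curveGeo h₀ h₁, rfl⟩, ?_⟩
  rintro _ ⟨c, hc, hcc, rfl⟩
  rw [pathLength_curveGeo h₀ h₁]
  exact hc.sqrt_integral_speedSq_le hcc

lemma distOp_sq (h₀ : IsImmMot c₀) (h₁ : IsImmMot c₁) :
    distOp c₀ c₁ ^ 2 = ∫ θ in (0 : ℝ)..(2 * Real.pi), speedSq (R c₀ θ) (R c₁ θ) := by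
  rw [distOp, (isLeast_pathLength h₀ h₁).csInf_eq, pathLength_curveGeo h₀ h₁, Real.sq_sqrt]
  exact intervalIntegral.integral_nonneg Real.two_pi_pos.le fun θ _ => speedSq_nonneg _

lemma IsSol.y_pos {x z y : ℝ → ℝ} {k : ℝ} (h : IsSol x z y k) (h0 : 0 < y 0) (h1 : 0 < y 1) {t : ℝ}
    (ht : t ∈ T) : 0 < y t := by
  rcases lt_trichotomy k 0 with hk | rfl | hk
  · have := h.reflect.strictMonoOn_y (neg_pos.2 hk) |>.monotoneOn ht one_mem_T ht.2
    linarith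
  · rw [(h.linear ht).2.2]
    exact h0
  · exact h0.trans_le ((h.strictMonoOn_y hk).monotoneOn zero_mem_T ht ht.1)

lemma isConvex_iff {c : ℝ → ℂ} (h : IsImmMot c) : IsConvex c ↔ ∀ θ ∈ M, 0 < R c θ 1 := by
  refine forall₂_congr fun θ hθ => ?_
  have := norm_pos_iff.2 (h.immersion θ hθ)
  change _ ↔ 0 < curvature c θ * ‖dθ c θ‖ ^ 2
  rw [mul_pos_iff_of_pos_right (by positivity)]

lemma isConvex_curveGeo (h₀ : IsImmMot c₀) (h₁ : IsImmMot c₁) (hc₀ : IsConvex c₀)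
    (hc₁ : IsConvex c₁) {t : ℝ} (ht : t ∈ T) : IsConvex (Rinv (curveGeo c₀ c₁ t)) := by
  rw [isConvex_iff h₀] at hc₀
  rw [isConvex_iff h₁] at hc₁
  rw [isConvex_iff ((isPath_curveGeo h₀ h₁).mem t ht)]
  intro θ hθ
  obtain ⟨hg, e0, e1⟩ := isPlaneGeodesic_curveGeo h₀ h₁ hθ
  obtain ⟨z, k, hs⟩ := hg.exists_isSol
  rw [R_Rinv_curveGeo h₀ h₁ ht hθ]
  exact hs.y_pos (by simp only [e0]; exact hc₀ θ hθ) (by simp only [e1]; exact hc₁ θ hθ) ht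

/-- The lower bound for the squared distance of two curves, in the coordinates given by `R`. -/
lemma integral_distBound_le (h₀ : IsImmMot c₀) (h₁ : IsImmMot c₁) :
    ∫ θ in (0 : ℝ)..(2 * Real.pi), 4 * (|R c₀ θ 0 - R c₁ θ 0| ^ 2
      + distBound (R c₀ θ 0) (R c₁ θ 0) |R c₀ θ 1 - R c₁ θ 1|) ≤ distOp c₀ c₁ ^ 2 := by
  rw [distOp_sq h₀ h₁]
  rw [intervalIntegral.integral_of_le Real.two_pi_pos.le,
    intervalIntegral.integral_of_le Real.two_pi_pos.le]
  have hA := A_pos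
  refine integral_mono_of_nonneg ?_ ?_ ?_
  · refine Filter.Eventually.of_forall fun θ => ?_
    simp only [Pi.zero_apply, distBound]
    have h4 : ∀ r : ℝ, 0 ≤ r ^ 4 := fun r => by positivity
    have := h4 (R c₀ θ 0)
    have := h4 (R c₁ θ 0)
    positivity
  · exact ((continuousOn_speedSq h₀ h₁).integrableOn_Icc).mono_set Ioc_subset_Icc_self
  · refine (ae_restrict_iff' measurableSet_Ioc).2 (Filter.Eventually.of_forall fun θ hθ => ?_)
    have hθ' : θ ∈ M := Ioc_subset_Icc_self hθ
    exact speedSq_ge (h₀.R_mem hθ') (h₁.R_mem hθ')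

lemma distBound_R (c₀ c₁ : ℝ → ℂ) (θ : ℝ) :
    4 * (|R c₀ θ 0 - R c₁ θ 0| ^ 2 + distBound (R c₀ θ 0) (R c₁ θ 0) |R c₀ θ 1 - R c₁ θ 1|)
      = (2 : ℝ) ^ (3 / 2 : ℝ)
          * (‖dθ c₁ θ‖ ^ 2 * curvature c₁ θ - ‖dθ c₀ θ‖ ^ 2 * curvature c₀ θ) ^ 2
        / (‖dθ c₀ θ‖ ^ 2 + ‖dθ c₁ θ‖ ^ 2 + 1 / (2 * A)
            * |‖dθ c₁ θ‖ ^ 2 * curvature c₁ θ - ‖dθ c₀ θ‖ ^ 2 * curvature c₀ θ|)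
          ^ (3 / 2 : ℝ)
      + 4 * (√‖dθ c₁ θ‖ - √‖dθ c₀ θ‖) ^ 2 := by
  have e4 : ∀ r : ℝ, 0 ≤ r → √r ^ 4 = r ^ 2 := fun r hr => by
    rw [show √r ^ 4 = (√r ^ 2) ^ 2 by ring, Real.sq_sqrt hr]
  have hD : |R c₀ θ 1 - R c₁ θ 1|
      = |‖dθ c₁ θ‖ ^ 2 * curvature c₁ θ - ‖dθ c₀ θ‖ ^ 2 * curvature c₀ θ| := by
    rw [abs_sub_comm]
    simp only [R, Matrix.cons_val_one, Matrix.cons_val_fin_one]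
    ring_nf
  have h2 : (2 : ℝ) ^ (1 / 2 : ℝ) ≠ 0 := by positivity
  have h3 : (2 : ℝ) ^ (3 / 2 : ℝ) = 4 / (2 : ℝ) ^ (1 / 2 : ℝ) := by
    rw [eq_div_iff h2, ← Real.rpow_add (by norm_num)]
    norm_num
  rw [distBound, hD, h3, sq_abs, sq_abs]
  simp only [R, Matrix.cons_val_zero, e4 _ (norm_nonneg _)]
  ring

end CurveGeo

end
end H2Curves

theorem mainTheorem4 :
    -- the constant `A = 0.30358...`
    ((0.30358 : ℝ) ≤ A ∧ A < 0.30359) ∧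
    -- any two points of the half plane are joined by a unique geodesic, and it is minimizing
    (∀ p₀ ∈ halfPlane, ∀ p₁ ∈ halfPlane,
      ∃ γ, IsPlaneGeodesic γ ∧ γ 0 = p₀ ∧ γ 1 = p₁ ∧
        (∀ δ, IsPlaneGeodesic δ → δ 0 = p₀ → δ 1 = p₁ → Set.EqOn δ γ T) ∧
        IsLeast (planeLengths p₀ p₁) (planeLength γ)) ∧
    -- geodesics between points with the same second coordinate
    (∀ x₀ x₁ y : ℝ, 0 < x₀ → 0 < x₁ → ∀ γ, IsPlaneGeodesic γ → γ 0 = ![x₀, y] → γ 1 = ![x₁, y] →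
      ∀ t ∈ T, γ t = ![x₀ + t * (x₁ - x₀), y]) ∧
    -- the trajectories of all other geodesics, traversed in either direction
    (∀ x₀ x₁ y₀ y₁ : ℝ, 0 < x₀ → x₀ ≤ x₁ → y₀ ≠ y₁ →
      -- the two points lie on the same branch
      (|y₁ - y₀| ≤ 2 * x₁ ^ 4 * (A - F (x₀ / x₁)) →
        (∃! C : ℝ, 0 < C ∧ C ≤ 1 / x₁ ∧
          |y₁ - y₀| = 2 / C ^ 4 * (F (C * x₁) - F (C * x₀))) ∧
        ∀ C : ℝ, 0 < C → C ≤ 1 / x₁ →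
          |y₁ - y₀| = 2 / C ^ 4 * (F (C * x₁) - F (C * x₀)) →
          ∀ γ, IsPlaneGeodesic γ →
            (γ 0 = ![x₀, y₀] ∧ γ 1 = ![x₁, y₁]) ∨ (γ 0 = ![x₁, y₁] ∧ γ 1 = ![x₀, y₀]) →
            γ '' T =
              (fun x => ![x, y₀ + Real.sign (y₁ - y₀) * (2 / C ^ 4 * (F (C * x) - F (C * x₀)))]) ''
                Set.Icc x₀ x₁) ∧
      -- the two points are separated by the apex, whose first coordinate is `a`
      (2 * x₁ ^ 4 * (A - F (x₀ / x₁)) < |y₁ - y₀| →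
        (∃! a : ℝ, x₁ < a ∧ |y₁ - y₀| = 2 * a ^ 4 * (2 * A - F (x₀ / a) - F (x₁ / a))) ∧
        ∀ a : ℝ, x₁ < a → |y₁ - y₀| = 2 * a ^ 4 * (2 * A - F (x₀ / a) - F (x₁ / a)) →
          ∀ γ, IsPlaneGeodesic γ →
            (γ 0 = ![x₀, y₀] ∧ γ 1 = ![x₁, y₁]) ∨ (γ 0 = ![x₁, y₁] ∧ γ 1 = ![x₀, y₀]) →
            γ '' T =
              (fun x => ![x, y₀ + Real.sign (y₁ - y₀) * (2 * a ^ 4 * (F (x / a) - F (x₀ / a)))]) ''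
                Set.Icc x₀ a ∪
              (fun x => ![x, y₁ - Real.sign (y₁ - y₀) * (2 * a ^ 4 * (F (x / a) - F (x₁ / a)))]) ''
                Set.Icc x₁ a)) ∧
    -- the lower bound for the distance in the half plane
    (∀ x₀ x₁ y₀ y₁ : ℝ, 0 < x₀ → 0 < x₁ →
      2 * √(|x₀ - x₁| ^ 2 + |y₀ - y₁| ^ 2 /
          ((2 : ℝ) ^ (1 / 2 : ℝ) * (x₀ ^ 4 + x₁ ^ 4 + 1 / (2 * A) * |y₀ - y₁|) ^ (3 / 2 : ℝ)))
        ≤ planeDist ![x₀, y₀] ![x₁, y₁]) ∧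
    ∀ c₀ c₁ : ℝ → ℂ, IsImmMot c₀ → IsImmMot c₁ →
      -- the unique geodesic between two open curves is given pointwise by the plane geodesics
      (∃ q : ℝ → ℝ → Fin 2 → ℝ,
        (∀ θ ∈ M, IsPlaneGeodesic (fun t => q t θ) ∧ q 0 θ = R c₀ θ ∧ q 1 θ = R c₁ θ) ∧
        IsGeodesic (fun t => Rinv (q t)) ∧
        Connects (fun t => Rinv (q t)) c₀ c₁ ∧
        (∀ c, IsGeodesic c → Connects c c₀ c₁ → ∀ t ∈ T, Set.EqOn (c t) (Rinv (q t)) M) ∧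
        IsLeast (pathLengths c₀ c₁) (pathLength (fun t => Rinv (q t))) ∧
        (IsConvex c₀ → IsConvex c₁ → ∀ t ∈ T, IsConvex (Rinv (q t)))) ∧
      -- the lower bound for the distance between two open curves
      (∫ θ in (0 : ℝ)..(2 * Real.pi),
          ((2 : ℝ) ^ (3 / 2 : ℝ)
              * (‖dθ c₁ θ‖ ^ 2 * curvature c₁ θ - ‖dθ c₀ θ‖ ^ 2 * curvature c₀ θ) ^ 2
            / (‖dθ c₀ θ‖ ^ 2 + ‖dθ c₁ θ‖ ^ 2 + 1 / (2 * A)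
                * |‖dθ c₁ θ‖ ^ 2 * curvature c₁ θ - ‖dθ c₀ θ‖ ^ 2 * curvature c₀ θ|)
              ^ (3 / 2 : ℝ)
          + 4 * (√‖dθ c₁ θ‖ - √‖dθ c₀ θ‖) ^ 2))
        ≤ distOp c₀ c₁ ^ 2 := by
  refine ⟨A_bounds, fun p₀ h₀ p₁ h₁ => ?_, fun x₀ x₁ y _ _ γ hγ h0 h1 t ht =>
    geodesic_horizontal hγ h0 h1 ht, fun x₀ x₁ y₀ y₁ h0 h01 hy => ⟨fun hle => ?_, fun hlt => ?_⟩,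
    fun x₀ x₁ y₀ y₁ h0 h1 => le_planeDist h0 h1, fun c₀ c₁ h₀ h₁ => ⟨?_, ?_⟩⟩
  · obtain ⟨hg, e0, e1⟩ := isPlaneGeodesic_geo h₀ h₁
    refine ⟨geo p₀ p₁, hg, e0, e1, fun δ hδ d0 d1 => ?_, isLeast_planeLength h₀ h₁⟩
    rw [← d0, ← d1]
    exact hδ.eqOn_geo
  · exact ⟨existsUnique_branchGap h0 h01 (abs_pos.2 (sub_ne_zero.2 hy.symm)) hle,
      fun C hC hC1 hd γ hγ he => trajectory_branch h01 hy hle hC hC1 hd hγ he⟩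
  · exact ⟨existsUnique_apexGap h0 h01 hlt,
      fun a ha hd γ hγ he => trajectory_apex h01 hy hlt ha hd hγ he⟩
  · exact ⟨curveGeo c₀ c₁, fun θ hθ => isPlaneGeodesic_curveGeo h₀ h₁ hθ,
      isGeodesic_curveGeo h₀ h₁, connects_curveGeo h₀ h₁,
      fun c hc hcc t ht => hc.eqOn_curveGeo hcc ht, isLeast_pathLength h₀ h₁,
      fun hc₀ hc₁ t ht => isConvex_curveGeo h₀ h₁ hc₀ hc₁ ht⟩
  · have h := integral_distBound_le h₀ h₁
    simp only [distBound_R] at h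
    exact h
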